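/- Let $\mathcal V$ be a braided monoidal category with braiding $\beta$ (coherence isomorphisms of $\mathcal V$ are suppressed below, and composition $f\circ g$ is written from left to right: first $f$, then $g$). **The 2-category $\mathcal V\mathrm{MonCat}$.** For a $\mathcal V$-category $\mathcal A$ with identity elements $j_a:1_{\mathcal V}\to\mathcal A(a\to a)$, its underlying category $A$ has the same objects and $A(a\to b)=\mathcal V(1_{\mathcal V}\to\mathcal A(a\to b))$. A *$\mathcal V$-monoidal category* is a $\mathcal V$-category $\mathcal A$ with a monoidal structure on $A$ and morphisms $-\otimes-:\mathcal A(a\to c)\,\mathcal A(b\to d)\to\mathcal A(a\otimes b\to c\otimes d)$ in $\mathcal V$ that induce the tensor product of morphisms of $A$ (so $j_a\otimes j_b=j_{a\otimes b}$), satisfy the braided interchange relation $$(-\otimes-)(-\otimes-)\circ(-\circ_{\mathcal A}-)=(1\,\beta_{\mathcal A(d\to e),\mathcal A(b\to c)}\,1)\circ(-\circ_{\mathcal A}-)(-\circ_{\mathcal A}-)\circ(-\otimes-)$$ from $\mathcal A(a\to b)\mathcal A(d\to e)\mathcal A(b\to c)\mathcal A(e\to f)$ to $\mathcal A(a\otimes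 d\to c\otimes f)$, and for which the associators and unitors of $A$ are natural with respect to the hom-objects of $\mathcal A$. It is *strict* if these associators and unitors are identities, and *rigid* if $A$ is rigid. * 0-cells: rigid $\mathcal V$-monoidal categories $\mathcal A$ such that $x\mapsto\mathcal A(1_{\mathcal A}\to x)$, $A\to\mathcal V$, has a left adjoint. * 1-cells: strictly unital lax $\mathcal V$-monoidal functors $(\mathcal R,\rho):\mathcal A\to\mathcal B$, that is, $\mathcal V$-functors $\mathcal R$ with $\mathcal R(1_{\mathcal A})=1_{\mathcal B}$ and $1_{\mathcal V}$-graded morphisms $\rho_{a,b}:\mathcal R(a)\otimes\mathcal R(b)\to\mathcal R(a\otimes b)$, natural with respect to hom-objects, associative, and unital with respect to the identity $1_{\mathcal B}=\mathcal R(1_{\mathcal A})$ (in the strict case: $\rho_{1,a}=1=\rho_{a,1}$). * 2-cells: $1_{\mathcal V}$-graded monoidal natural transformations $\theta:(\mathcal R,\rho)\Rightarrow(\mathcal S,\sigma)$, that is, families $\theta_a\in\mathcal V(1_{\mathcal V}\to\mathcal B(\mathcal R(a)\to\mathcal S(a)))$, natural with respect to hom-objects, with $\rho_{a,b}\circ\theta_{a\otimes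 b}=(\theta_a\otimes\theta_b)\circ\sigma_{a,b}$ and $\theta_{1_{\mathcal A}}=1_{1_{\mathcal B}}$. **The 2-category $\mathcal V\mathrm{ModTens}$.** For a monoidal category $A$, objects of the Drinfeld center $Z(A)$ are pairs of an object $x$ and a half-braiding $e_{a,x}:a\otimes x\to x\otimes a$, and the braiding of $Z(A)$ is given by the $e_{x,y}$. * 0-cells: rigid weakly tensored $\mathcal V$-module tensor categories $(A,\mathcal F_A^Z)$: $A$ is a rigid monoidal category, $\mathcal F_A^Z:\mathcal V\to Z(A)$ is a braided oplax monoidal functor, with oplaxitor $\mu^{\mathcal F_A}_{u,v}:\mathcal F_A(uv)\to\mathcal F_A(u)\otimes\mathcal F_A(v)$ and invertible counit $\mathcal F_A(1_{\mathcal V})\to1_A$, and its composite $\mathcal F_A:\mathcal V\to A$ with the forgetful functor has a right adjoint. * 1-cells $(A,\mathcal F_A^Z)\to(B,\mathcal F_B^Z)$: triples $(R,\rho,r)$ with $(R,\rho):A\to B$ a strictly unital lax monoidal functor and $r_v:\mathcal F_B(v)\to R(\mathcal F_A(v))$ a natural transformation, such that $r_{1_{\mathcal V}}$ is compatible with the counits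 (it is the identity of $1_B$ if $\mathcal F_A(1_{\mathcal V})$ and $\mathcal F_B(1_{\mathcal V})$ are identified with the units), and for all $a\in A$, $u,v\in\mathcal V$ $$e_{R(a),\mathcal F_B(v)}\circ(r_v\otimes1)\circ\rho_{\mathcal F_A(v),a}=(1\otimes r_v)\circ\rho_{a,\mathcal F_A(v)}\circ R(e_{a,\mathcal F_A(v)}),$$ $$r_{uv}\circ R(\mu^{\mathcal F_A}_{u,v})=\mu^{\mathcal F_B}_{u,v}\circ(r_u\otimes r_v)\circ\rho_{\mathcal F_A(u),\mathcal F_A(v)}.$$ * 2-cells $(R,\rho,r)\Rightarrow(S,\sigma,s)$: monoidal natural transformations $\Theta:(R,\rho)\Rightarrow(S,\sigma)$ with $r_v\circ\Theta_{\mathcal F_A(v)}=s_v$ for all $v$. In both 2-categories compositions are the usual ones; the composite of $(R,\rho,r):A\to B$ with $(S,\sigma,s):B\to C$ has functor $R\circ S$, laxitor $\sigma_{R(a),R(b)}\circ S(\rho_{a,b})$ and transformation $s_v\circ S(r_v)$. **The 2-functor $P:\mathcal V\mathrm{MonCat}\to\mathcal V\mathrm{ModTens}$.** Choose for every 0-cell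 $\mathcal A$ a left adjoint $\mathcal F_A$ of $x\mapsto\mathcal A(1_{\mathcal A}\to x)$, with unit $\eta_v:v\to\mathcal A(1_{\mathcal A}\to\mathcal F_A(v))$. The *mate* of $f:a\otimes\mathcal F_A(v)\to b$ is the composite of $j_a\otimes\eta_v:v\to\mathcal A(a\to a\otimes\mathcal F_A(v))$ with $\mathcal A(a\to f)$. Then $P(\mathcal A)=(A,\mathcal F_A^Z)$, where $\mathcal F_A^Z$ lifts $\mathcal F_A$ by the half-braidings $e_{a,\mathcal F_A(v)}$ with mate $\eta_v\otimes j_a:v\to\mathcal A(a\to\mathcal F_A(v)\otimes a)$; the oplaxitor $\mathcal F_A(uv)\to\mathcal F_A(u)\otimes\mathcal F_A(v)$ is the one with mate $\eta_u\otimes\eta_v$ and the counit $\mathcal F_A(1_{\mathcal V})\to1_A$ the one with mate $j_{1_{\mathcal A}}$. A 1-cell $(\mathcal R,\rho)$ is sent to $(R,\rho,r)$, where $R$ is the underlying functor, the laxitor is the same, and $r_v:\mathcal F_B(v)\to R(\mathcal F_A(v))$ is the morphism with mate $\eta_v\circ\mathcal R_{1_{\mathcal A}\to\mathcal F_A(v)}$.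 A 2-cell $\theta$ is sent to the natural transformation with the same components. **Theorem.** For every choice of the left adjoints, these data exist and define a 2-functor $P:\mathcal V\mathrm{MonCat}\to\mathcal V\mathrm{ModTens}$ (strictly preserving compositions and identities), and $P$ is a 2-equivalence: every 0-cell $B$ of $\mathcal V\mathrm{ModTens}$ is equivalent, inside the 2-category $\mathcal V\mathrm{ModTens}$, to $P(\mathcal A)$ for some 0-cell $\mathcal A$ of $\mathcal V\mathrm{MonCat}$, and for all 0-cells $\mathcal A,\mathcal B$ the functor $P_{\mathcal A\to\mathcal B}:\mathcal V\mathrm{MonCat}(\mathcal A\to\mathcal B)\to\mathcal V\mathrm{ModTens}(P(\mathcal A)\to P(\mathcal B))$ is an equivalence of categories. Moreover $P$ restricts to a 2-equivalence between the sub-2-categories with only the strong 1-cells (all laxitors $\rho_{a,b}$ invertible), between the sub-2-categories with only the strict 0-cells ($\mathcal A$ strict, respectively $A$ strict), and between those with strict 0-cells and strong 1-cells. -/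

import Mathlib

open CategoryTheory MonoidalCategory Opposite

universe w v u

namespace BraidedEnriched

section Enriched

variable {V : Type u} [Category.{v} V] [MonoidalCategory V]
variable {C D E : Type w} [EnrichedCategory V C] [EnrichedCategory V D] [EnrichedCategory V E]

/-- The morphism `𝒜(a → b) ⟶ ℬ(R a → R b)` of a `V`-functor `R`, with `a` and `b` regarded as
objects of the underlying category. -/
def vmap (R : EnrichedFunctor V C D) (a b : ForgetEnrichment V C) :
    (a ⟶[V] b) ⟶ (R.forget.obj a ⟶[V] R.forget.obj b) :=
  R.map a b

theorem eHomEquiv_forget_map (R : EnrichedFunctor V C D) {a b : ForgetEnrichment V C}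
    (f : a ⟶ b) : eHomEquiv V (R.forget.map f) = eHomEquiv V f ≫ vmap R a b := rfl

theorem eComp_vmap (R : EnrichedFunctor V C D) (a b c : ForgetEnrichment V C) :
    eComp V a b c ≫ vmap R a c = (vmap R a b ⊗ₘ vmap R b c) ≫ eComp V _ _ _ :=
  R.map_comp a b c

theorem vmap_whiskerLeft (R : EnrichedFunctor V C D) (a : ForgetEnrichment V C)
    {b c : ForgetEnrichment V C} (g : b ⟶ c) :
    vmap R a b ≫ eHomWhiskerLeft V _ (R.forget.map g) =
      eHomWhiskerLeft V a g ≫ vmap R a c := by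
  simp only [eHomWhiskerLeft, Category.assoc, eComp_vmap, eHomEquiv_forget_map,
    rightUnitor_inv_naturality_assoc, MonoidalCategory.tensorHom_def',
    MonoidalCategory.whiskerLeft_comp, whisker_exchange_assoc]

theorem vmap_whiskerRight (R : EnrichedFunctor V C D) {a b : ForgetEnrichment V C}
    (g : a ⟶ b) (c : ForgetEnrichment V C) :
    vmap R b c ≫ eHomWhiskerRight V (R.forget.map g) _ =
      eHomWhiskerRight V g c ≫ vmap R a c := by
  simp only [eHomWhiskerRight, Category.assoc, eComp_vmap, eHomEquiv_forget_map,
    leftUnitor_inv_naturality_assoc, MonoidalCategory.tensorHom_def, comp_whiskerRight,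
    whisker_exchange_assoc]

theorem forget_id_map {a b : ForgetEnrichment V C} (f : a ⟶ b) :
    (EnrichedFunctor.id V C).forget.map f = f := Category.comp_id _

theorem forget_comp_map (R : EnrichedFunctor V C D) (S : EnrichedFunctor V D E)
    {a b : ForgetEnrichment V C} (f : a ⟶ b) :
    (R.comp V S).forget.map f = S.forget.map (R.forget.map f) := (Category.assoc _ _ _).symm

theorem vmap_comp (R : EnrichedFunctor V C D) (S : EnrichedFunctor V D E)
    (a b : ForgetEnrichment V C) :
    vmap (R.comp V S) a b = vmap R a b ≫ vmap S (R.forget.obj a) (R.forget.obj b) := rfl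

theorem vmap_id (a b : ForgetEnrichment V C) : vmap (EnrichedFunctor.id V C) a b = 𝟙 _ := rfl

theorem enriched_id_comp (R : EnrichedFunctor V C D) : (EnrichedFunctor.id V C).comp V R = R :=
  EnrichedFunctor.ext V (fun _ => rfl) fun a b =>
    (Category.comp_id (𝟙 _ ≫ R.map a b)).trans (Category.id_comp _)

theorem enriched_comp_id (R : EnrichedFunctor V C D) : R.comp V (EnrichedFunctor.id V D) = R :=
  EnrichedFunctor.ext V (fun _ => rfl) fun a b =>
    (Category.comp_id (R.map a b ≫ 𝟙 _)).trans (Category.comp_id _)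

theorem enriched_assoc {E' : Type w} [EnrichedCategory V E'] (R : EnrichedFunctor V C D)
    (S : EnrichedFunctor V D E) (T : EnrichedFunctor V E E') :
    (R.comp V S).comp V T = R.comp V (S.comp V T) :=
  EnrichedFunctor.ext V (fun _ => rfl) fun a b =>
    (Category.comp_id ((R.map a b ≫ S.map _ _) ≫ T.map _ _)).trans (Category.assoc _ _ _)

end Enriched

variable (V : Type u) [Category.{v} V] [MonoidalCategory V] [BraidedCategory V]

/-- A `V`-monoidal category for a braided monoidal category `V`: a `V`-category `C` whose underlying
category is monoidal, together with morphisms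
`tens : 𝒜(a → c) ⊗ 𝒜(b → d) ⟶ 𝒜(a ⊗ b → c ⊗ d)` in `V` which induce the tensor product of
morphisms of the underlying category, satisfy the braided interchange relation (`tensorμ` applies
the braiding of `V` to the two middle factors), and for which associator and unitors are natural
at the level of hom-objects of `V`. In the strict case (identity associators and unitors) the last
three fields say that `tens` is strictly associative and unital. -/
class VMonoidal (C : Type w) [EnrichedCategory V C]
    [MonoidalCategory (ForgetEnrichment V C)] where
  tens (a b c d : ForgetEnrichment V C) :
    (a ⟶[V] c) ⊗ (b ⟶[V] d) ⟶ ((a ⊗ b : ForgetEnrichment V C) ⟶[V] (c ⊗ d))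
  eHomEquiv_tensorHom {a b c d : ForgetEnrichment V C} (f : a ⟶ c) (g : b ⟶ d) :
    eHomEquiv V (f ⊗ₘ g) = (λ_ (𝟙_ V)).inv ≫ (eHomEquiv V f ⊗ₘ eHomEquiv V g) ≫ tens a b c d
  interchange (a b c d e f : ForgetEnrichment V C) :
    (tens a d b e ⊗ₘ tens b e c f) ≫ eComp V (a ⊗ d) (b ⊗ e) (c ⊗ f) =
      tensorμ (a ⟶[V] b) (d ⟶[V] e) (b ⟶[V] c) (e ⟶[V] f) ≫
        (eComp V a b c ⊗ₘ eComp V d e f) ≫ tens a d c f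
  associator_vnatural (a b c d e f : ForgetEnrichment V C) :
    tens a b d e ▷ (c ⟶[V] f) ≫ tens (a ⊗ b) c (d ⊗ e) f ≫ eHomWhiskerLeft V _ (α_ d e f).hom =
      (α_ (a ⟶[V] d) (b ⟶[V] e) (c ⟶[V] f)).hom ≫ (a ⟶[V] d) ◁ tens b c e f ≫
        tens a (b ⊗ c) d (e ⊗ f) ≫ eHomWhiskerRight V (α_ a b c).hom _
  leftUnitor_vnatural (a b : ForgetEnrichment V C) :
    (λ_ (a ⟶[V] b)).inv ≫ eId V (𝟙_ (ForgetEnrichment V C)) ▷ (a ⟶[V] b) ≫ tens _ a _ b ≫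
        eHomWhiskerLeft V _ (λ_ b).hom =
      eHomWhiskerRight V (λ_ a).hom b
  rightUnitor_vnatural (a b : ForgetEnrichment V C) :
    (ρ_ (a ⟶[V] b)).inv ≫ (a ⟶[V] b) ◁ eId V (𝟙_ (ForgetEnrichment V C)) ≫ tens a _ b _ ≫
        eHomWhiskerLeft V _ (ρ_ b).hom =
      eHomWhiskerRight V (ρ_ a).hom b

open VMonoidal (tens)

/-- A rigid `V`-monoidal category `𝒜` such that `x ↦ 𝒜(𝟙 → x)`, as a functor from the underlying
category of `𝒜` to `V`, has a left adjoint. -/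
structure VMonCat where
  carrier : Type w
  [enriched : EnrichedCategory V carrier]
  [monoidal : MonoidalCategory (ForgetEnrichment V carrier)]
  [vmonoidal : VMonoidal V carrier]
  rigid : Nonempty (RigidCategory (ForgetEnrichment V carrier))
  trace_isRightAdjoint : (eCoyoneda V (𝟙_ (ForgetEnrichment V carrier))).IsRightAdjoint

namespace VMonCat

variable {V}

attribute [instance] enriched monoidal vmonoidal

/-- The underlying category: its morphisms `a ⟶ b` are the morphisms `𝟙_ V ⟶ 𝒜(a → b)`. -/
abbrev Und (𝒜 : VMonCat.{w} V) : Type w := ForgetEnrichment V 𝒜.carrier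

/-- The functor `x ↦ 𝒜(𝟙 → x)` from the underlying category to `V`. -/
abbrev trace (𝒜 : VMonCat.{w} V) : 𝒜.Und ⥤ V := eCoyoneda V (𝟙_ 𝒜.Und)

/-- A strictly unital lax `V`-monoidal functor: a `V`-functor `R` with `𝟙 = R 𝟙` and a laxitor
`μ a b : R a ⊗ R b ⟶ R (a ⊗ b)` of `𝟙_ V`-graded morphisms, natural at the level of hom-objects,
associative, and unital with respect to the identity `𝟙 = R 𝟙` (so that, in the strict case,
`μ 𝟙 a` and `μ a 𝟙` are identities). -/
structure OneCell (𝒜 ℬ : VMonCat.{w} V) where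
  functor : EnrichedFunctor V 𝒜.carrier ℬ.carrier
  μ (a b : 𝒜.Und) : functor.forget.obj a ⊗ functor.forget.obj b ⟶ functor.forget.obj (a ⊗ b)
  unit_eq : 𝟙_ ℬ.Und = functor.forget.obj (𝟙_ 𝒜.Und)
  μ_vnatural (a b c d : 𝒜.Und) :
    tens a b c d ≫ vmap functor (a ⊗ b) (c ⊗ d) ≫ eHomWhiskerRight V (μ a b) _ =
      (vmap functor a c ⊗ₘ vmap functor b d) ≫ tens _ _ _ _ ≫ eHomWhiskerLeft V _ (μ c d)
  associativity (a b c : 𝒜.Und) :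
    μ a b ▷ functor.forget.obj c ≫ μ (a ⊗ b) c ≫ functor.forget.map (α_ a b c).hom =
      (α_ _ _ _).hom ≫ functor.forget.obj a ◁ μ b c ≫ μ a (b ⊗ c)
  left_unitality (a : 𝒜.Und) :
    (λ_ (functor.forget.obj a)).hom =
      eqToHom unit_eq ▷ functor.forget.obj a ≫ μ (𝟙_ _) a ≫ functor.forget.map (λ_ a).hom
  right_unitality (a : 𝒜.Und) :
    (ρ_ (functor.forget.obj a)).hom =
      functor.forget.obj a ◁ eqToHom unit_eq ≫ μ a (𝟙_ _) ≫ functor.forget.map (ρ_ a).hom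

theorem eHomEquiv_comp_left {𝒜 : VMonCat.{w} V} {a b c : 𝒜.Und} (f : a ⟶ b) (g : b ⟶ c) :
    eHomEquiv V (f ≫ g) = eHomEquiv V f ≫ eHomWhiskerLeft V a g := by
  rw [eHomEquiv_comp, eHomWhiskerLeft, rightUnitor_inv_naturality_assoc,
    MonoidalCategory.tensorHom_def, Category.assoc, unitors_inv_equal]

theorem eHomEquiv_comp_right {𝒜 : VMonCat.{w} V} {a b c : 𝒜.Und} (f : a ⟶ b) (g : b ⟶ c) :
    eHomEquiv V (f ≫ g) = eHomEquiv V g ≫ eHomWhiskerRight V f c := by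
  rw [eHomEquiv_comp, eHomWhiskerRight, leftUnitor_inv_naturality_assoc,
    MonoidalCategory.tensorHom_def', Category.assoc]

variable {𝒜 ℬ 𝒞 𝒟 : VMonCat.{w} V}
namespace OneCell

theorem μ_natural (R : OneCell 𝒜 ℬ) {a b c d : 𝒜.Und} (f : a ⟶ c) (g : b ⟶ d) :
    (R.functor.forget.map f ⊗ₘ R.functor.forget.map g) ≫ R.μ c d =
      R.μ a b ≫ R.functor.forget.map (f ⊗ₘ g) := by
  apply (eHomEquiv V).injective
  rw [eHomEquiv_comp_left, eHomEquiv_comp_right, VMonoidal.eHomEquiv_tensorHom,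
    eHomEquiv_forget_map, eHomEquiv_forget_map, eHomEquiv_forget_map,
    VMonoidal.eHomEquiv_tensorHom]
  simp only [Category.assoc, R.μ_vnatural]
  rw [← tensorHom_comp_tensorHom_assoc]

/-- The lax monoidal structure on the underlying functor, with unit map the identity `𝟙 = R 𝟙`. -/
@[reducible]
def lax (R : OneCell 𝒜 ℬ) : R.functor.forget.LaxMonoidal where
  ε := eqToHom R.unit_eq
  μ := R.μ
  μ_natural_left f X' := by
    have := R.μ_natural f (𝟙 X')
    simpa using this
  μ_natural_right X' f := by
    have := R.μ_natural (𝟙 X') f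
    simpa using this
  associativity := R.associativity
  left_unitality := R.left_unitality
  right_unitality := R.right_unitality

theorem ext' {R S : OneCell 𝒜 ℬ} (h : R.functor = S.functor)
    (hμ : ∀ a b, HEq (R.μ a b) (S.μ a b)) : R = S := by
  obtain ⟨R, μ⟩ := R
  obtain ⟨S, ν⟩ := S
  obtain rfl : R = S := h
  obtain rfl : μ = ν := by
    funext a b
    exact eq_of_heq (hμ a b)
  rfl

/-- The identity 1-cell. -/
def id (𝒜 : VMonCat.{w} V) : OneCell 𝒜 𝒜 where
  functor := EnrichedFunctor.id V 𝒜.carrier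
  μ a b := 𝟙 (a ⊗ b)
  unit_eq := rfl
  μ_vnatural a b c d := by
    have h : tens a b c d ≫ 𝟙 _ ≫ eHomWhiskerRight V (𝟙 (a ⊗ b)) (c ⊗ d) =
      (𝟙 (a ⟶[V] c) ⊗ₘ 𝟙 (b ⟶[V] d)) ≫ tens a b c d ≫
        eHomWhiskerLeft V (a ⊗ b) (𝟙 (c ⊗ d)) := by simp
    exact h
  associativity a b c := by
    have h : 𝟙 (a ⊗ b) ▷ c ≫ 𝟙 ((a ⊗ b) ⊗ c) ≫ (α_ a b c).hom =
      (α_ a b c).hom ≫ a ◁ 𝟙 (b ⊗ c) ≫ 𝟙 (a ⊗ (b ⊗ c)) := by simp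
    rw [forget_id_map]
    exact h
  left_unitality a := by
    have h : (λ_ a).hom = 𝟙 (𝟙_ 𝒜.Und) ▷ a ≫ 𝟙 (𝟙_ 𝒜.Und ⊗ a) ≫ (λ_ a).hom := by simp
    rw [forget_id_map]
    exact h
  right_unitality a := by
    have h : (ρ_ a).hom = a ◁ 𝟙 (𝟙_ 𝒜.Und) ≫ 𝟙 (a ⊗ 𝟙_ 𝒜.Und) ≫ (ρ_ a).hom := by simp
    rw [forget_id_map]
    exact h

/-- The composite 1-cell `S ∘ R`, with laxitor `μ_S ≫ S(μ_R)`. -/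
def comp (R : OneCell 𝒜 ℬ) (S : OneCell ℬ 𝒞) : OneCell 𝒜 𝒞 where
  functor := R.functor.comp V S.functor
  μ a b := S.μ (R.functor.forget.obj a) (R.functor.forget.obj b) ≫ S.functor.forget.map (R.μ a b)
  unit_eq := S.unit_eq.trans (congrArg S.functor.forget.obj R.unit_eq)
  μ_vnatural a b c d := by
    have h : tens a b c d ≫ (vmap R.functor (a ⊗ b) (c ⊗ d) ≫ vmap S.functor _ _) ≫
        eHomWhiskerRight V (S.μ _ _ ≫ S.functor.forget.map (R.μ a b)) _ =
      ((vmap R.functor a c ≫ vmap S.functor _ _) ⊗ₘ (vmap R.functor b d ≫ vmap S.functor _ _)) ≫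
        tens _ _ _ _ ≫ eHomWhiskerLeft V _ (S.μ _ _ ≫ S.functor.forget.map (R.μ c d)) := by
      rw [eHomWhiskerRight_comp, eHomWhiskerLeft_comp, ← tensorHom_comp_tensorHom_assoc,
        ← (reassoc_of% S.μ_vnatural)]
      simp only [Category.assoc]
      rw [(reassoc_of% vmap_whiskerRight), (reassoc_of% R.μ_vnatural), ← eHom_whisker_exchange,
        (reassoc_of% vmap_whiskerLeft)]
    exact h
  associativity a b c := by
    let _ := R.lax
    let _ := S.lax
    have h := Functor.LaxMonoidal.associativity (R.functor.forget ⋙ S.functor.forget) a b c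
    rw [forget_comp_map]
    exact h
  left_unitality a := by
    let _ := R.lax
    let _ := S.lax
    have h : (λ_ (S.functor.forget.obj (R.functor.forget.obj a))).hom =
        (eqToHom S.unit_eq ≫ S.functor.forget.map (eqToHom R.unit_eq)) ▷
          S.functor.forget.obj (R.functor.forget.obj a) ≫
        (S.μ (R.functor.forget.obj (𝟙_ _)) (R.functor.forget.obj a) ≫
          S.functor.forget.map (R.μ (𝟙_ _) a)) ≫
        S.functor.forget.map (R.functor.forget.map (λ_ a).hom) :=
      Functor.LaxMonoidal.left_unitality (R.functor.forget ⋙ S.functor.forget) a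
    rw [eqToHom_map, eqToHom_trans] at h
    rw [forget_comp_map]
    exact h
  right_unitality a := by
    let _ := R.lax
    let _ := S.lax
    have h : (ρ_ (S.functor.forget.obj (R.functor.forget.obj a))).hom =
        S.functor.forget.obj (R.functor.forget.obj a) ◁
          (eqToHom S.unit_eq ≫ S.functor.forget.map (eqToHom R.unit_eq)) ≫
        (S.μ (R.functor.forget.obj a) (R.functor.forget.obj (𝟙_ _)) ≫
          S.functor.forget.map (R.μ a (𝟙_ _))) ≫
        S.functor.forget.map (R.functor.forget.map (ρ_ a).hom) :=
      Functor.LaxMonoidal.right_unitality (R.functor.forget ⋙ S.functor.forget) a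
    rw [eqToHom_map, eqToHom_trans] at h
    rw [forget_comp_map]
    exact h

end OneCell

/-- A `𝟙_ V`-graded monoidal natural transformation: `𝟙_ V`-graded morphisms `R a ⟶ S a`, natural at
the level of hom-objects, compatible with the laxitors and with the units. -/
@[ext]
structure TwoCell {𝒜 ℬ : VMonCat.{w} V} (R S : OneCell 𝒜 ℬ) where
  app (a : 𝒜.Und) : R.functor.forget.obj a ⟶ S.functor.forget.obj a
  vnatural (a b : 𝒜.Und) :
    vmap R.functor a b ≫ eHomWhiskerLeft V _ (app b) =
      vmap S.functor a b ≫ eHomWhiskerRight V (app a) _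
  tensor (a b : 𝒜.Und) : R.μ a b ≫ app (a ⊗ b) = (app a ⊗ₘ app b) ≫ S.μ a b
  unit : eqToHom R.unit_eq ≫ app (𝟙_ 𝒜.Und) = eqToHom S.unit_eq

namespace TwoCell

theorem natural {R S : OneCell 𝒜 ℬ} (θ : TwoCell R S) {a b : 𝒜.Und} (f : a ⟶ b) :
    R.functor.forget.map f ≫ θ.app b = θ.app a ≫ S.functor.forget.map f := by
  apply (eHomEquiv V).injective
  rw [eHomEquiv_comp_left, eHomEquiv_comp_right, eHomEquiv_forget_map, eHomEquiv_forget_map,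
    Category.assoc, Category.assoc, θ.vnatural]

/-- The natural transformation of underlying functors given by a 2-cell. -/
def toNatTrans {R S : OneCell 𝒜 ℬ} (θ : TwoCell R S) : R.functor.forget ⟶ S.functor.forget where
  app := θ.app
  naturality _ _ f := θ.natural f

/-- The identity 2-cell. -/
def id (R : OneCell 𝒜 ℬ) : TwoCell R R where
  app a := 𝟙 _
  vnatural a b := by simp
  tensor a b := by simp
  unit := by simp

/-- Vertical composition. -/
def comp {R S T : OneCell 𝒜 ℬ} (θ : TwoCell R S) (φ : TwoCell S T) : TwoCell R T where
  app a := θ.app a ≫ φ.app a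
  vnatural a b := by
    rw [eHomWhiskerLeft_comp, eHomWhiskerRight_comp, (reassoc_of% θ.vnatural), ← eHom_whisker_exchange,
      (reassoc_of% φ.vnatural)]
  tensor a b := by
    rw [(reassoc_of% θ.tensor), φ.tensor, tensorHom_comp_tensorHom_assoc]
  unit := by rw [(reassoc_of% θ.unit), φ.unit]

end TwoCell

instance (𝒜 ℬ : VMonCat.{w} V) : Category (OneCell 𝒜 ℬ) where
  Hom := TwoCell
  id := TwoCell.id
  comp := TwoCell.comp
  id_comp _ := TwoCell.ext (funext fun _ => Category.id_comp _)
  comp_id _ := TwoCell.ext (funext fun _ => Category.comp_id _)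
  assoc _ _ _ := TwoCell.ext (funext fun _ => Category.assoc _ _ _)

@[simp]
theorem id_app (R : OneCell 𝒜 ℬ) (a : 𝒜.Und) : TwoCell.app (𝟙 R) a = 𝟙 _ := rfl

@[simp]
theorem comp_app {R S T : OneCell 𝒜 ℬ} (θ : R ⟶ S) (φ : S ⟶ T) (a : 𝒜.Und) :
    TwoCell.app (θ ≫ φ) a = θ.app a ≫ φ.app a := rfl

theorem hom_ext {R S : OneCell 𝒜 ℬ} {θ φ : R ⟶ S} (h : ∀ a, θ.app a = φ.app a) : θ = φ :=
  TwoCell.ext (funext h)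

/-- Whiskering: the 2-cell `R ≫ S ⟶ R ≫ T` with components `φ (R a)`. -/
def whiskerLeft (R : OneCell 𝒜 ℬ) {S T : OneCell ℬ 𝒞} (φ : S ⟶ T) : R.comp S ⟶ R.comp T where
  app a := φ.app (R.functor.forget.obj a)
  vnatural a b := by
    have h : (vmap R.functor a b ≫ vmap S.functor _ _) ≫
          eHomWhiskerLeft V _ (φ.app (R.functor.forget.obj b)) =
        (vmap R.functor a b ≫ vmap T.functor _ _) ≫
          eHomWhiskerRight V (φ.app (R.functor.forget.obj a)) _ := by
      rw [Category.assoc, Category.assoc, φ.vnatural]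
    exact h
  tensor a b := by
    have h : (S.μ _ _ ≫ S.functor.forget.map (R.μ a b)) ≫ φ.app (R.functor.forget.obj (a ⊗ b)) =
        (φ.app (R.functor.forget.obj a) ⊗ₘ φ.app (R.functor.forget.obj b)) ≫
          T.μ _ _ ≫ T.functor.forget.map (R.μ a b) := by
      rw [Category.assoc, φ.natural, (reassoc_of% φ.tensor)]
    exact h
  unit := by
    have h : (eqToHom S.unit_eq ≫ S.functor.forget.map (eqToHom R.unit_eq)) ≫
        φ.app (R.functor.forget.obj (𝟙_ 𝒜.Und)) =
          eqToHom T.unit_eq ≫ T.functor.forget.map (eqToHom R.unit_eq) := by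
      rw [Category.assoc, φ.natural, (reassoc_of% φ.unit)]
    rw [eqToHom_map, eqToHom_map, eqToHom_trans, eqToHom_trans] at h
    exact h

/-- Whiskering: the 2-cell `R ≫ T ⟶ S ≫ T` with components `T (θ a)`. -/
def whiskerRight {R S : OneCell 𝒜 ℬ} (θ : R ⟶ S) (T : OneCell ℬ 𝒞) : R.comp T ⟶ S.comp T where
  app a := T.functor.forget.map (θ.app a)
  vnatural a b := by
    have h : (vmap R.functor a b ≫ vmap T.functor _ _) ≫
          eHomWhiskerLeft V _ (T.functor.forget.map (θ.app b)) =
        (vmap S.functor a b ≫ vmap T.functor _ _) ≫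
          eHomWhiskerRight V (T.functor.forget.map (θ.app a)) _ := by
      rw [Category.assoc, Category.assoc, vmap_whiskerLeft, vmap_whiskerRight,
        (reassoc_of% θ.vnatural)]
    exact h
  tensor a b := by
    have h : (T.μ _ _ ≫ T.functor.forget.map (R.μ a b)) ≫ T.functor.forget.map (θ.app (a ⊗ b)) =
        (T.functor.forget.map (θ.app a) ⊗ₘ T.functor.forget.map (θ.app b)) ≫
          T.μ _ _ ≫ T.functor.forget.map (S.μ a b) := by
      rw [reassoc_of% T.μ_natural, Category.assoc, ← Functor.map_comp, ← Functor.map_comp,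
        θ.tensor]
    exact h
  unit := by
    have h : (eqToHom T.unit_eq ≫ T.functor.forget.map (eqToHom R.unit_eq)) ≫
        T.functor.forget.map (θ.app (𝟙_ 𝒜.Und)) =
          eqToHom T.unit_eq ≫ T.functor.forget.map (eqToHom S.unit_eq) := by
      rw [Category.assoc, ← Functor.map_comp, θ.unit]
    rw [eqToHom_map, eqToHom_map, eqToHom_trans, eqToHom_trans] at h
    exact h

theorem id_comp' (R : OneCell 𝒜 ℬ) : (OneCell.id 𝒜).comp R = R := by
  refine OneCell.ext' ?_ fun a b => heq_of_eq ?_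
  · exact enriched_id_comp R.functor
  · have h : R.μ a b ≫ R.functor.forget.map (𝟙 (a ⊗ b)) = R.μ a b := by simp
    exact h

theorem comp_id' (R : OneCell 𝒜 ℬ) : R.comp (OneCell.id ℬ) = R := by
  refine OneCell.ext' ?_ fun a b => heq_of_eq ?_
  · exact enriched_comp_id R.functor
  · have h : 𝟙 _ ≫ (EnrichedFunctor.id V ℬ.carrier).forget.map (R.μ a b) = R.μ a b := by
      rw [Category.id_comp, forget_id_map]
    exact h

theorem assoc' (R : OneCell 𝒜 ℬ) (S : OneCell ℬ 𝒞) (T : OneCell 𝒞 𝒟) :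
    (R.comp S).comp T = R.comp (S.comp T) := by
  refine OneCell.ext' ?_ fun a b => heq_of_eq ?_
  · exact enriched_assoc R.functor S.functor T.functor
  · have h : T.μ _ _ ≫ T.functor.forget.map (S.μ _ _ ≫ S.functor.forget.map (R.μ a b)) =
        (T.μ _ _ ≫ T.functor.forget.map (S.μ _ _)) ≫
          T.functor.forget.map (S.functor.forget.map (R.μ a b)) := by
      rw [Functor.map_comp, Category.assoc]
    refine Eq.trans h (Eq.symm ?_)
    exact congrArg (_ ≫ ·) (forget_comp_map S.functor T.functor (R.μ a b))

/-- The invertible 2-cell with the given components between equal 1-cells. -/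
def isoOfEq {R S : OneCell 𝒜 ℬ} (h : R = S)
    (app : ∀ a, R.functor.forget.obj a ⟶ S.functor.forget.obj a)
    (inv : ∀ a, S.functor.forget.obj a ⟶ R.functor.forget.obj a)
    (happ : ∀ a, app a = eqToHom (by rw [h])) (hinv : ∀ a, inv a = eqToHom (by rw [h])) :
    R ≅ S where
  hom := { app := app
           vnatural := by subst h; intro a b; simp [happ]
           tensor := by subst h; intro a b; simp [happ]
           unit := by subst h; simp [happ] }
  inv := { app := inv
           vnatural := by subst h; intro a b; simp [hinv]
           tensor := by subst h; intro a b; simp [hinv]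
           unit := by subst h; simp [hinv] }
  hom_inv_id := hom_ext fun a => by subst h; simp [happ, hinv]
  inv_hom_id := hom_ext fun a => by subst h; simp [happ, hinv]

theorem isoOfEq_eq {R S : OneCell 𝒜 ℬ} (h : R = S) (app inv happ hinv) :
    isoOfEq h app inv happ hinv = eqToIso h := by
  subst h
  ext1
  exact hom_ext fun a => happ a

/-- The 2-category of rigid `V`-monoidal categories. -/
instance : Bicategory (VMonCat.{w} V) where
  Hom := OneCell
  id := OneCell.id
  comp := OneCell.comp
  homCategory 𝒜 ℬ := inferInstanceAs (Category (OneCell 𝒜 ℬ))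
  whiskerLeft R _ _ φ := whiskerLeft R φ
  whiskerRight θ T := whiskerRight θ T
  associator R S T := isoOfEq (assoc' R S T) (fun _ => 𝟙 _) (fun _ => 𝟙 _)
    (fun _ => rfl) (fun _ => rfl)
  leftUnitor R := isoOfEq (id_comp' R) (fun _ => 𝟙 _) (fun _ => 𝟙 _)
    (fun _ => rfl) (fun _ => rfl)
  rightUnitor R := isoOfEq (comp_id' R) (fun _ => 𝟙 _) (fun _ => 𝟙 _)
    (fun _ => rfl) (fun _ => rfl)
  whiskerLeft_id R S := rfl
  whiskerLeft_comp R _ _ _ θ φ := rfl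
  id_whiskerLeft θ := hom_ext fun a =>
    (show θ.app a = 𝟙 _ ≫ θ.app a ≫ 𝟙 _ by simp)
  comp_whiskerLeft R S _ _ θ := hom_ext fun a =>
    (show θ.app (S.functor.forget.obj (R.functor.forget.obj a)) = 𝟙 _ ≫ θ.app _ ≫ 𝟙 _ by simp)
  id_whiskerRight R T := hom_ext fun a => T.functor.forget.map_id _
  comp_whiskerRight θ φ T := hom_ext fun a => T.functor.forget.map_comp _ _
  whiskerRight_id θ := hom_ext fun a =>
    (forget_id_map _).trans (show θ.app a = 𝟙 _ ≫ θ.app a ≫ 𝟙 _ by simp)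
  whiskerRight_comp θ S T := hom_ext fun a =>
    (forget_comp_map _ _ _).trans
      (show T.functor.forget.map (S.functor.forget.map (θ.app a)) =
        𝟙 _ ≫ T.functor.forget.map (S.functor.forget.map (θ.app a)) ≫ 𝟙 _ by simp)
  whisker_assoc R _ _ θ T := hom_ext fun a =>
    (show T.functor.forget.map (θ.app (R.functor.forget.obj a)) =
        𝟙 _ ≫ T.functor.forget.map (θ.app (R.functor.forget.obj a)) ≫ 𝟙 _ by simp)
  whisker_exchange {_ _ _ R S T U} θ φ := hom_ext fun a =>
    (φ.natural (θ.app a)).symm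
  pentagon R S T U := hom_ext fun a => by
    have h : U.functor.forget.map (𝟙 (T.functor.forget.obj
        (S.functor.forget.obj (R.functor.forget.obj a)))) ≫ 𝟙 _ ≫ 𝟙 _ = 𝟙 _ ≫ 𝟙 _ := by simp
    exact h
  triangle R S := hom_ext fun a => by
    have h : 𝟙 _ ≫ 𝟙 _ = S.functor.forget.map (𝟙 (R.functor.forget.obj a)) := by simp
    exact h

instance : Bicategory.Strict (VMonCat.{w} V) where
  id_comp := id_comp'
  comp_id := comp_id'
  assoc := assoc'
  leftUnitor_eqToIso _ := isoOfEq_eq _ _ _ _ _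
  rightUnitor_eqToIso _ := isoOfEq_eq _ _ _ _ _
  associator_eqToIso _ _ _ := isoOfEq_eq _ _ _ _ _

end VMonCat

section Module

variable (A : Type w) [Category.{v} A] [MonoidalCategory A]

/-- A strongly unital, oplax, braided monoidal functor from `V` to the Drinfeld center of `A`.
The objects of the center carry half-braidings `e : a ⊗ F v ⟶ F v ⊗ a`; Mathlib's `Center` records
the inverse morphisms `F v ⊗ a ⟶ a ⊗ F v`, so the braiding of the center given by the `e` is the
inverse of Mathlib's braiding, and `braided` is stated for that inverse. -/
structure CentralStructure where
  FZ : V ⥤ Center A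
  [oplax : FZ.OplaxMonoidal]
  isIso_η : IsIso (Functor.OplaxMonoidal.η FZ)
  braided (u v : V) :
    Functor.OplaxMonoidal.δ FZ u v ≫ (β_ (FZ.obj v) (FZ.obj u)).inv =
      FZ.map (β_ u v).hom ≫ Functor.OplaxMonoidal.δ FZ v u

namespace CentralStructure

variable {V A}

attribute [instance] oplax

/-- The composite of the functor to the center with the forgetful functor. -/
abbrev F (X : CentralStructure V A) : V ⥤ A := X.FZ ⋙ Center.forget A

/-- The half-braiding `e : a ⊗ F v ⟶ F v ⊗ a`. -/
def e (X : CentralStructure V A) (a : A) (v : V) : a ⊗ X.F.obj v ⟶ X.F.obj v ⊗ a :=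
  ((X.FZ.obj v).2.β a).inv

/-- The oplaxitor `F (u ⊗ v) ⟶ F u ⊗ F v`. -/
def δ (X : CentralStructure V A) (u v : V) : X.F.obj (u ⊗ v) ⟶ X.F.obj u ⊗ X.F.obj v :=
  (Functor.OplaxMonoidal.δ X.FZ u v).f

/-- The (invertible) counit `F 𝟙 ⟶ 𝟙`. -/
def η (X : CentralStructure V A) : X.F.obj (𝟙_ V) ⟶ 𝟙_ A :=
  (Functor.OplaxMonoidal.η X.FZ).f

end CentralStructure

end Module

/-- A rigid weakly tensored `V`-module tensor category: a rigid monoidal category `A` with a strongly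
unital, oplax, braided monoidal functor `V ⥤ Z(A)` whose composite with the forgetful functor
`Z(A) ⥤ A` has a right adjoint. -/
structure VModTens where
  carrier : Type w
  [category : Category.{v} carrier]
  [monoidal : MonoidalCategory carrier]
  rigid : Nonempty (RigidCategory carrier)
  central : CentralStructure V carrier
  weaklyTensored : central.F.IsLeftAdjoint

namespace VModTens

variable {V}

attribute [instance] category monoidal

/-- The data of a 1-cell: a lax monoidal functor `R` and a family `r v : F_Y v ⟶ R (F_X v)`. -/
structure PreOneCell (X Y : VModTens.{w} V) where
  functor : X.carrier ⥤ Y.carrier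
  [lax : functor.LaxMonoidal]
  r (v : V) : Y.central.F.obj v ⟶ functor.obj (X.central.F.obj v)

attribute [instance] PreOneCell.lax

open Functor.LaxMonoidal

variable {X Y Z W : VModTens.{w} V}

/-- The conditions on the data of a 1-cell: `R` is strictly unital, and `r` is natural, unital, and
satisfies the half-braiding and the action coherence. -/
structure PreOneCell.IsOneCell (R : PreOneCell X Y) : Prop where
  strictly_unital : ∃ h : 𝟙_ Y.carrier = R.functor.obj (𝟙_ X.carrier), ε R.functor = eqToHom h
  r_natural {u v : V} (f : u ⟶ v) :
    Y.central.F.map f ≫ R.r v = R.r u ≫ R.functor.map (X.central.F.map f)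
  r_unit : R.r (𝟙_ V) ≫ R.functor.map X.central.η = Y.central.η ≫ ε R.functor
  half_braiding_coherence (a : X.carrier) (v : V) :
    Y.central.e (R.functor.obj a) v ≫ R.r v ▷ R.functor.obj a ≫
        μ R.functor (X.central.F.obj v) a =
      R.functor.obj a ◁ R.r v ≫ μ R.functor a (X.central.F.obj v) ≫
        R.functor.map (X.central.e a v)
  action_coherence (u v : V) :
    R.r (u ⊗ v) ≫ R.functor.map (X.central.δ u v) =
      Y.central.δ u v ≫ (R.r u ⊗ₘ R.r v) ≫ μ R.functor (X.central.F.obj u) (X.central.F.obj v)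

/-- A 1-cell of `V`-module tensor categories. -/
structure OneCell (X Y : VModTens.{w} V) extends PreOneCell X Y where
  isOneCell : toPreOneCell.IsOneCell

namespace OneCell

/-- The identity 1-cell. -/
def id (X : VModTens.{w} V) : OneCell X X where
  functor := 𝟭 X.carrier
  r _ := 𝟙 _
  isOneCell :=
    { strictly_unital := ⟨rfl, rfl⟩
      r_natural f := (Category.comp_id (X.central.F.map f)).trans
        (Category.id_comp (X.central.F.map f)).symm
      r_unit := by simp
      half_braiding_coherence := by simp
      action_coherence := by simp }

/-- The composite 1-cell, with coherence transformation `s v ≫ S (r v)`. -/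
def comp (R : OneCell X Y) (S : OneCell Y Z) : OneCell X Z where
  functor := R.functor ⋙ S.functor
  r v := S.r v ≫ S.functor.map (R.r v)
  isOneCell :=
    { strictly_unital := by
        obtain ⟨h, hR⟩ := R.isOneCell.strictly_unital
        obtain ⟨k, hS⟩ := S.isOneCell.strictly_unital
        exact ⟨k.trans (congrArg S.functor.obj h), by
          rw [comp_ε, hR, hS, eqToHom_map, eqToHom_trans]⟩
      r_natural f := by
        have h : Z.central.F.map f ≫ S.r _ ≫ S.functor.map (R.r _) =
            (S.r _ ≫ S.functor.map (R.r _)) ≫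
              S.functor.map (R.functor.map (X.central.F.map f)) := by
          rw [← Category.assoc, S.isOneCell.r_natural, Category.assoc, Category.assoc,
            ← Functor.map_comp, R.isOneCell.r_natural, Functor.map_comp]
        exact h
      r_unit := by
        rw [comp_ε, Functor.comp_map, Category.assoc, ← Functor.map_comp, R.isOneCell.r_unit,
          Functor.map_comp, ← Category.assoc, S.isOneCell.r_unit, Category.assoc]
      half_braiding_coherence a v := by
        have h₁ := R.isOneCell.half_braiding_coherence a v
        have h₂ := S.isOneCell.half_braiding_coherence (R.functor.obj a) v
        simp only [comp_μ, Functor.comp_obj, Functor.comp_map, comp_whiskerRight,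
          MonoidalCategory.whiskerLeft_comp, Category.assoc, μ_natural_left_assoc,
          μ_natural_right_assoc]
        rw [reassoc_of% h₂]
        simp only [← Functor.map_comp]
        exact congrArg (fun t => _ ≫ _ ≫ S.functor.map t) h₁
      action_coherence u v := by
        have h₁ := R.isOneCell.action_coherence u v
        have h₂ := S.isOneCell.action_coherence u v
        simp only [comp_μ, Functor.comp_obj, Functor.comp_map, ← tensorHom_comp_tensorHom,
          Category.assoc, μ_natural_assoc]
        rw [← reassoc_of% h₂]
        simp only [← Functor.map_comp]
        exact congrArg (fun t => _ ≫ S.functor.map t) h₁ }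

theorem ext' {R S : OneCell X Y} (h : R.toPreOneCell = S.toPreOneCell) : R = S := by
  cases R; cases S; cases h; rfl

theorem preext {F : X.carrier ⥤ Y.carrier} (l l' : F.LaxMonoidal)
    {r r' : ∀ v, Y.central.F.obj v ⟶ F.obj (X.central.F.obj v)}
    (hε : l.ε = l'.ε) (hμ : ∀ a b, l.μ a b = l'.μ a b) (hr : ∀ v, r v = r' v) :
    @PreOneCell.mk V _ _ _ X Y F l r = @PreOneCell.mk V _ _ _ X Y F l' r' := by
  obtain rfl : l = l' := Functor.LaxMonoidal.ext hε (funext fun a => funext fun b => hμ a b)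
  obtain rfl : r = r' := funext hr
  rfl

end OneCell

theorem id_comp' (R : OneCell X Y) : (OneCell.id X).comp R = R :=
  OneCell.ext' (OneCell.preext ((OneCell.id X).comp R).lax (R).lax
    (show ε R.functor ≫ R.functor.map (𝟙 _) = ε R.functor by simp)
    (fun a b => show μ R.functor a b ≫ R.functor.map (𝟙 _) = μ R.functor a b by simp)
    (fun v => show R.r v ≫ R.functor.map (𝟙 _) = R.r v by simp))

theorem comp_id' (R : OneCell X Y) : R.comp (OneCell.id Y) = R :=
  OneCell.ext' (OneCell.preext (R.comp (OneCell.id Y)).lax (R).lax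
    (show 𝟙 _ ≫ ε R.functor = ε R.functor by simp)
    (fun a b => show 𝟙 _ ≫ μ R.functor a b = μ R.functor a b by simp)
    (fun v => show 𝟙 _ ≫ R.r v = R.r v by simp))

theorem assoc' (R : OneCell X Y) (S : OneCell Y Z) (T : OneCell Z W) :
    (R.comp S).comp T = R.comp (S.comp T) :=
  OneCell.ext' (OneCell.preext ((R.comp S).comp T).lax (R.comp (S.comp T)).lax
    (show ε T.functor ≫ T.functor.map (ε S.functor ≫ S.functor.map (ε R.functor)) =
      (ε T.functor ≫ T.functor.map (ε S.functor)) ≫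
        T.functor.map (S.functor.map (ε R.functor)) by simp)
    (fun a b => show μ T.functor _ _ ≫ T.functor.map (μ S.functor _ _ ≫
        S.functor.map (μ R.functor a b)) =
      (μ T.functor _ _ ≫ T.functor.map (μ S.functor _ _)) ≫
        T.functor.map (S.functor.map (μ R.functor a b)) by simp)
    (fun v => show T.r v ≫ T.functor.map (S.r v ≫ S.functor.map (R.r v)) =
      (T.r v ≫ T.functor.map (S.r v)) ≫ T.functor.map (S.functor.map (R.r v)) by simp))

/-- A 2-cell: a monoidal natural transformation `Θ : R ⟶ S` with `r v ≫ Θ (F_X v) = s v`. -/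
@[ext]
structure TwoCell (R S : OneCell X Y) where
  toNatTrans : R.functor ⟶ S.functor
  isMonoidal : NatTrans.IsMonoidal toNatTrans
  coherence (v : V) : R.r v ≫ toNatTrans.app (X.central.F.obj v) = S.r v

attribute [instance] TwoCell.isMonoidal

namespace TwoCell

/-- The identity 2-cell. -/
def id (R : OneCell X Y) : TwoCell R R where
  toNatTrans := 𝟙 _
  isMonoidal := inferInstance
  coherence v := by simp

/-- Vertical composition. -/
def comp {R S T : OneCell X Y} (Θ : TwoCell R S) (Φ : TwoCell S T) : TwoCell R T where
  toNatTrans := Θ.toNatTrans ≫ Φ.toNatTrans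
  isMonoidal := inferInstance
  coherence v := by
    rw [NatTrans.comp_app, ← Category.assoc, Θ.coherence, Φ.coherence]

end TwoCell

instance (X Y : VModTens.{w} V) : Category (OneCell X Y) where
  Hom := TwoCell
  id := TwoCell.id
  comp := TwoCell.comp
  id_comp _ := TwoCell.ext (Category.id_comp _)
  comp_id _ := TwoCell.ext (Category.comp_id _)
  assoc _ _ _ := TwoCell.ext (Category.assoc _ _ _)

theorem hom_ext {R S : OneCell X Y} {Θ Φ : R ⟶ S}
    (h : ∀ a, Θ.toNatTrans.app a = Φ.toNatTrans.app a) : Θ = Φ :=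
  TwoCell.ext (NatTrans.ext (funext h))

/-- Whiskering on the left. -/
def whiskerLeft (R : OneCell X Y) {S T : OneCell Y Z} (Φ : S ⟶ T) : R.comp S ⟶ R.comp T where
  toNatTrans := Functor.whiskerLeft R.functor Φ.toNatTrans
  isMonoidal := NatTrans.IsMonoidal.whiskerLeft Φ.toNatTrans
  coherence v := by
    have h : (S.r v ≫ S.functor.map (R.r v)) ≫
        Φ.toNatTrans.app (R.functor.obj (X.central.F.obj v)) =
        T.r v ≫ T.functor.map (R.r v) := by
      rw [Category.assoc, Φ.toNatTrans.naturality, ← Category.assoc, Φ.coherence]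
    exact h

/-- Whiskering on the right. -/
def whiskerRight {R S : OneCell X Y} (Θ : R ⟶ S) (T : OneCell Y Z) : R.comp T ⟶ S.comp T where
  toNatTrans := Functor.whiskerRight Θ.toNatTrans T.functor
  isMonoidal := NatTrans.IsMonoidal.whiskerRight Θ.toNatTrans
  coherence v := by
    have h : (T.r v ≫ T.functor.map (R.r v)) ≫
        T.functor.map (Θ.toNatTrans.app (X.central.F.obj v)) =
        T.r v ≫ T.functor.map (S.r v) := by
      rw [Category.assoc, ← Functor.map_comp, Θ.coherence]
    exact h

/-- The invertible 2-cell with the given components between equal 1-cells. -/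
def isoOfEq {R S : OneCell X Y} (h : R = S) (τ : R.functor ⟶ S.functor)
    (σ : S.functor ⟶ R.functor) (hτ : τ = eqToHom (by rw [h])) (hσ : σ = eqToHom (by rw [h])) :
    R ≅ S where
  hom := { toNatTrans := τ
           isMonoidal := by subst h; subst hτ; exact NatTrans.IsMonoidal.id
           coherence := by subst h; simp [hτ] }
  inv := { toNatTrans := σ
           isMonoidal := by subst h; subst hσ; exact NatTrans.IsMonoidal.id
           coherence := by subst h; simp [hσ] }
  hom_inv_id := TwoCell.ext (show τ ≫ σ = 𝟙 _ by subst h; simp [hτ, hσ])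
  inv_hom_id := TwoCell.ext (show σ ≫ τ = 𝟙 _ by subst h; simp [hτ, hσ])

theorem isoOfEq_eq {R S : OneCell X Y} (h : R = S) (τ σ hτ hσ) :
    isoOfEq h τ σ hτ hσ = eqToIso h := by
  subst h
  ext1
  exact TwoCell.ext hτ

/-- The 2-category of rigid weakly tensored `V`-module tensor categories. -/
instance : Bicategory (VModTens.{w} V) where
  Hom := OneCell
  id := OneCell.id
  comp := OneCell.comp
  homCategory X Y := inferInstanceAs (Category (OneCell X Y))
  whiskerLeft R _ _ Φ := whiskerLeft R Φ
  whiskerRight Θ T := whiskerRight Θ T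
  associator R S T := isoOfEq (assoc' R S T) (𝟙 (R.functor ⋙ S.functor ⋙ T.functor))
    (𝟙 (R.functor ⋙ S.functor ⋙ T.functor)) rfl rfl
  leftUnitor R := isoOfEq (id_comp' R) (𝟙 R.functor) (𝟙 R.functor) rfl rfl
  rightUnitor R := isoOfEq (comp_id' R) (𝟙 R.functor) (𝟙 R.functor) rfl rfl
  whiskerLeft_id R S := rfl
  whiskerLeft_comp R _ _ _ θ φ := rfl
  id_whiskerLeft θ := hom_ext fun a =>
    (show θ.toNatTrans.app a = 𝟙 _ ≫ θ.toNatTrans.app a ≫ 𝟙 _ by simp)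
  comp_whiskerLeft R S _ _ θ := hom_ext fun a =>
    (show θ.toNatTrans.app (S.functor.obj (R.functor.obj a)) =
      𝟙 _ ≫ θ.toNatTrans.app _ ≫ 𝟙 _ by simp)
  id_whiskerRight R T := hom_ext fun a => T.functor.map_id _
  comp_whiskerRight θ φ T := hom_ext fun a => T.functor.map_comp _ _
  whiskerRight_id θ := hom_ext fun a =>
    (show θ.toNatTrans.app a = 𝟙 _ ≫ θ.toNatTrans.app a ≫ 𝟙 _ by simp)
  whiskerRight_comp θ S T := hom_ext fun a =>
    (show T.functor.map (S.functor.map (θ.toNatTrans.app a)) =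
        𝟙 _ ≫ T.functor.map (S.functor.map (θ.toNatTrans.app a)) ≫ 𝟙 _ by simp)
  whisker_assoc R _ _ θ T := hom_ext fun a =>
    (show T.functor.map (θ.toNatTrans.app (R.functor.obj a)) =
        𝟙 _ ≫ T.functor.map (θ.toNatTrans.app (R.functor.obj a)) ≫ 𝟙 _ by simp)
  whisker_exchange θ φ := hom_ext fun a => (φ.toNatTrans.naturality (θ.toNatTrans.app a)).symm
  pentagon R S T U := hom_ext fun a => by
    have h : U.functor.map (𝟙 (T.functor.obj
        (S.functor.obj (R.functor.obj a)))) ≫ 𝟙 _ ≫ 𝟙 _ = 𝟙 _ ≫ 𝟙 _ := by simp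
    exact h
  triangle R S := hom_ext fun a => by
    have h : 𝟙 _ ≫ 𝟙 _ = S.functor.map (𝟙 (R.functor.obj a)) := by simp
    exact h

instance : Bicategory.Strict (VModTens.{w} V) where
  id_comp := id_comp'
  comp_id := comp_id'
  assoc := assoc'
  leftUnitor_eqToIso _ := isoOfEq_eq _ _ _ _ _
  rightUnitor_eqToIso _ := isoOfEq_eq _ _ _ _ _
  associator_eqToIso _ _ _ := isoOfEq_eq _ _ _ _ _

end VModTens

section TwoFunctor

variable {V}

/-- The functor `V ⥤ Z(A)` lifting a functor `F : V ⥤ A` along the forgetful functor `Z(A) ⥤ A`,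
given half-braidings on the objects `F v` such that every `F f` commutes with them. -/
def liftCenter {A : Type w} [Category.{v} A] [MonoidalCategory A] (F : V ⥤ A)
    (hb : ∀ v, HalfBraiding (F.obj v))
    (comm : ∀ {u v : V} (f : u ⟶ v) (a : A),
      F.map f ▷ a ≫ ((hb v).β a).hom = ((hb u).β a).hom ≫ a ◁ F.map f) :
    V ⥤ Center A where
  obj v := ⟨F.obj v, hb v⟩
  map f := ⟨F.map f, comm f⟩
  map_id v := Center.ext _ _ (F.map_id v)
  map_comp f g := Center.ext _ _ (F.map_comp f g)

/-- The lift of a left adjoint `F` of `x ↦ 𝒜(𝟙 → x)` to a strongly unital, oplax, braided monoidal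
functor from `V` to the Drinfeld center of the underlying category of `𝒜`. All its data are
prescribed through mates, where a morphism `f : a ⊗ F v ⟶ b` has the mate
`v ⟶ 𝒜(a → a ⊗ F v) ⟶ 𝒜(a → b)`, the first map being `j_a ⊗ unit` followed by `tens` and the
second one composition with `f`:
* `halfBraiding_mate`: the mate of the half-braiding `e : a ⊗ F v ⟶ F v ⊗ a` (the inverse of the
  isomorphism recorded by Mathlib) is `unit ⊗ j_a` followed by `tens`;
* `η_mate`: the mate of the counit `F 𝟙 ⟶ 𝟙` is the identity element of `𝟙`;
* `δ_mate`: the mate of `F (u ⊗ v) ⟶ F u ⊗ F v` is `unit ⊗ unit` followed by `tens`. -/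
structure CentralLift {𝒜 : VMonCat.{w} V} {F : V ⥤ 𝒜.Und} (adj : F ⊣ 𝒜.trace) where
  halfBraiding (v : V) : HalfBraiding (F.obj v)
  halfBraiding_mate (a : 𝒜.Und) (v : V) :
    (λ_ v).inv ≫ (eId V a ⊗ₘ adj.unit.app v) ≫ tens a (𝟙_ 𝒜.Und) a (F.obj v) ≫
        eHomWhiskerRight V (ρ_ a).inv (a ⊗ F.obj v) ≫
          eHomWhiskerLeft V a ((halfBraiding v).β a).inv =
      (ρ_ v).inv ≫ (adj.unit.app v ⊗ₘ eId V a) ≫ tens (𝟙_ 𝒜.Und) a (F.obj v) a ≫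
        eHomWhiskerRight V (λ_ a).inv (F.obj v ⊗ a)
  comm {u v : V} (f : u ⟶ v) (a : 𝒜.Und) :
    F.map f ▷ a ≫ ((halfBraiding v).β a).hom = ((halfBraiding u).β a).hom ≫ a ◁ F.map f
  [oplax : (liftCenter F halfBraiding comm).OplaxMonoidal]
  η_mate :
    adj.unit.app (𝟙_ V) ≫
        𝒜.trace.map (Functor.OplaxMonoidal.η (liftCenter F halfBraiding comm)).f =
      eId V (𝟙_ 𝒜.Und)
  δ_mate (u v : V) :
    adj.unit.app (u ⊗ v) ≫
        𝒜.trace.map (Functor.OplaxMonoidal.δ (liftCenter F halfBraiding comm) u v).f =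
      (adj.unit.app u ⊗ₘ adj.unit.app v) ≫
        tens (𝟙_ 𝒜.Und) (𝟙_ 𝒜.Und) (F.obj u) (F.obj v) ≫
          eHomWhiskerRight V (λ_ (𝟙_ 𝒜.Und)).inv (F.obj u ⊗ F.obj v)
  isIso_η : IsIso (Functor.OplaxMonoidal.η (liftCenter F halfBraiding comm))
  braided (u v : V) :
    Functor.OplaxMonoidal.δ (liftCenter F halfBraiding comm) u v ≫
        (β_ ((liftCenter F halfBraiding comm).obj v) ((liftCenter F halfBraiding comm).obj u)).inv =
      (liftCenter F halfBraiding comm).map (β_ u v).hom ≫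
        Functor.OplaxMonoidal.δ (liftCenter F halfBraiding comm) v u

namespace CentralLift

attribute [instance] oplax

/-- The `V`-module tensor category given by the underlying category of `𝒜` and the lift of `F`. -/
def toVModTens {𝒜 : VMonCat.{w} V} {F : V ⥤ 𝒜.Und} {adj : F ⊣ 𝒜.trace} (L : CentralLift adj) :
    VModTens.{w} V where
  carrier := 𝒜.Und
  rigid := 𝒜.rigid
  central :=
    { FZ := liftCenter F L.halfBraiding L.comm
      isIso_η := L.isIso_η
      braided := L.braided }
  weaklyTensored := adj.isLeftAdjoint

end CentralLift

variable {F : ∀ 𝒜 : VMonCat.{w} V, V ⥤ 𝒜.Und} {adj : ∀ 𝒜, F 𝒜 ⊣ 𝒜.trace}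

/-- The data of a 1-cell associated with a strictly unital lax `V`-monoidal functor `R : 𝒜 ⟶ ℬ`: the
underlying lax monoidal functor with the same laxitor, and `r v : F_ℬ v ⟶ R (F_𝒜 v)`, the mate of
`v ⟶ 𝒜(𝟙 → F_𝒜 v) ⟶ ℬ(R 𝟙 → R (F_𝒜 v)) = ℬ(𝟙 → R (F_𝒜 v))`. -/
def preOneCell (L : ∀ 𝒜, CentralLift (adj 𝒜)) {𝒜 ℬ : VMonCat.{w} V} (R : 𝒜 ⟶ ℬ) :
    VModTens.PreOneCell (L 𝒜).toVModTens (L ℬ).toVModTens where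
  functor := (VMonCat.OneCell.functor R).forget
  lax := VMonCat.OneCell.lax R
  r v := ((adj ℬ).homEquiv v _).symm
    ((adj 𝒜).unit.app v ≫ vmap (VMonCat.OneCell.functor R) (𝟙_ 𝒜.Und) ((F 𝒜).obj v) ≫
      eHomWhiskerRight V (eqToHom (VMonCat.OneCell.unit_eq R)) _)

/-- The assignment on 0-cells, 1-cells and 2-cells: `𝒜` is sent to its underlying category with the
lift of `F 𝒜`, a 1-cell `R` to `preOneCell L R`, and a 2-cell `θ` to the natural transformation of
underlying functors with the same components. The arguments `h₁` and `h₂` assert that these are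
indeed 1-cells and 2-cells. -/
def underlyingData (L : ∀ 𝒜, CentralLift (adj 𝒜))
    (h₁ : ∀ {𝒜 ℬ : VMonCat.{w} V} (R : 𝒜 ⟶ ℬ), (preOneCell L R).IsOneCell)
    (h₂ : ∀ {𝒜 ℬ : VMonCat.{w} V} {R S : 𝒜 ⟶ ℬ} (θ : R ⟶ S),
      NatTrans.IsMonoidal (F₁ := (preOneCell L R).functor) (F₂ := (preOneCell L S).functor)
          (VMonCat.TwoCell.toNatTrans θ) ∧
        ∀ v, (preOneCell L R).r v ≫ VMonCat.TwoCell.app θ ((F 𝒜).obj v) =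
          (preOneCell L S).r v) :
    PrelaxFunctorStruct (VMonCat.{w} V) (VModTens.{w} V) where
  obj 𝒜 := (L 𝒜).toVModTens
  map R := ⟨preOneCell L R, h₁ R⟩
  map₂ θ :=
    { toNatTrans := VMonCat.TwoCell.toNatTrans θ
      isMonoidal := (h₂ θ).1
      coherence := (h₂ θ).2 }

/-- The 2-functor `P` is the one given by underlying categories, underlying functors and underlying
natural transformations. -/
def IsUnderlyingTwoFunctor (L : ∀ 𝒜, CentralLift (adj 𝒜))
    (P : StrictPseudofunctor (VMonCat.{w} V) (VModTens.{w} V)) : Prop :=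
  ∃ h₁ h₂, P.toPrelaxFunctorStruct = underlyingData L h₁ h₂

end TwoFunctor

section TwoEquivalence

variable {B : Type*} [Bicategory B] {C : Type*} [Bicategory C]

/-- A 2-functor is a 2-equivalence if every 0-cell of the target is equivalent to one in the image and
all functors between hom-categories are equivalences of categories. -/
def IsTwoEquivalence (P : StrictPseudofunctor B C) : Prop :=
  (∀ c : C, ∃ a : B, Nonempty (Bicategory.Equivalence (P.obj a) c)) ∧
    ∀ a b : B, (P.mapFunctor a b).IsEquivalence

/-- A sub-2-category, with some of the 0-cells and 1-cells and with all the 2-cells between these. -/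
structure SubTwoCategory (B : Type*) [Bicategory B] where
  obj : B → Prop
  hom (a b : B) : ObjectProperty (a ⟶ b)
  id_mem (a : B) : obj a → hom a a (𝟙 a)
  comp_mem {a b c : B} (f : a ⟶ b) (g : b ⟶ c) :
    hom a b f → hom b c g → hom a c (f ≫ g)

/-- The 2-functor `P` restricts to a 2-functor from the sub-2-category `S` to the sub-2-category `T`,
and this restriction is a 2-equivalence. -/
structure RestrictsToTwoEquivalence (P : StrictPseudofunctor B C) (S : SubTwoCategory B)
    (T : SubTwoCategory C) : Prop where
  obj_mem (a : B) : S.obj a → T.obj (P.obj a)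
  hom_mem {a b : B} (f : a ⟶ b) : S.hom a b f → T.hom _ _ (P.map f)
  essSurj (c : C) : T.obj c → ∃ a : B, S.obj a ∧
    ∃ e : Bicategory.Equivalence (P.obj a) c, T.hom _ _ e.hom ∧ T.hom _ _ e.inv
  isEquivalence (a b : B) : S.obj a → S.obj b →
    ((T.hom (P.obj a) (P.obj b)).lift ((S.hom a b).ι ⋙ P.mapFunctor a b)
      fun f => hom_mem f.obj f.property).IsEquivalence

end TwoEquivalence

section Sub

/-- A monoidal category is strict if its associators and unitors are identities. -/
def IsStrictMonoidal (A : Type*) [Category A] [MonoidalCategory A] : Prop :=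
  (∀ a b c : A, ∃ h, (α_ a b c).hom = eqToHom h) ∧
    (∀ a : A, ∃ h, (λ_ a).hom = eqToHom h) ∧ ∀ a : A, ∃ h, (ρ_ a).hom = eqToHom h

theorem VMonCat.isIso_μ_id (𝒜 : VMonCat.{w} V) (a b : 𝒜.Und) :
    IsIso (VMonCat.OneCell.μ (𝟙 𝒜) a b) :=
  inferInstanceAs (IsIso (𝟙 (a ⊗ b)))

theorem VMonCat.isIso_μ_comp {𝒜 ℬ 𝒞 : VMonCat.{w} V} (R : 𝒜 ⟶ ℬ) (S : ℬ ⟶ 𝒞)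
    (hR : ∀ a b, IsIso (VMonCat.OneCell.μ R a b)) (hS : ∀ a b, IsIso (VMonCat.OneCell.μ S a b))
    (a b : 𝒜.Und) : IsIso (VMonCat.OneCell.μ (R ≫ S) a b) := by
  have := hR a b
  have := hS ((VMonCat.OneCell.functor R).forget.obj a) ((VMonCat.OneCell.functor R).forget.obj b)
  exact inferInstanceAs (IsIso (VMonCat.OneCell.μ S _ _ ≫
    (VMonCat.OneCell.functor S).forget.map (VMonCat.OneCell.μ R a b)))

theorem VModTens.isIso_μ_id (X : VModTens.{w} V) (a b : X.carrier) :
    IsIso (Functor.LaxMonoidal.μ (VModTens.OneCell.toPreOneCell (𝟙 X)).functor a b) :=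
  inferInstanceAs (IsIso (𝟙 (a ⊗ b)))

theorem VModTens.isIso_μ_comp {X Y Z : VModTens.{w} V} (R : X ⟶ Y) (S : Y ⟶ Z)
    (hR : ∀ a b, IsIso (Functor.LaxMonoidal.μ (VModTens.OneCell.toPreOneCell R).functor a b))
    (hS : ∀ a b, IsIso (Functor.LaxMonoidal.μ (VModTens.OneCell.toPreOneCell S).functor a b))
    (a b : X.carrier) :
    IsIso (Functor.LaxMonoidal.μ (VModTens.OneCell.toPreOneCell (R ≫ S)).functor a b) := by
  have := hR a b
  have := hS ((VModTens.OneCell.toPreOneCell R).functor.obj a)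
    ((VModTens.OneCell.toPreOneCell R).functor.obj b)
  exact inferInstanceAs (IsIso
    (Functor.LaxMonoidal.μ (VModTens.OneCell.toPreOneCell S).functor _ _ ≫
      (VModTens.OneCell.toPreOneCell S).functor.map
        (Functor.LaxMonoidal.μ (VModTens.OneCell.toPreOneCell R).functor a b)))

/-- All 0-cells and the strong (invertible laxitor) 1-cells. -/
def VMonCat.strong : SubTwoCategory (VMonCat.{w} V) where
  obj _ := True
  hom _ _ R := ∀ a b, IsIso (VMonCat.OneCell.μ R a b)
  id_mem 𝒜 _ := VMonCat.isIso_μ_id V 𝒜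
  comp_mem R S := VMonCat.isIso_μ_comp V R S

/-- All 0-cells and the strong (invertible laxitor) 1-cells. -/
def VModTens.strong : SubTwoCategory (VModTens.{w} V) where
  obj _ := True
  hom _ _ R := ∀ a b, IsIso (Functor.LaxMonoidal.μ (VModTens.OneCell.toPreOneCell R).functor a b)
  id_mem X _ := VModTens.isIso_μ_id V X
  comp_mem R S := VModTens.isIso_μ_comp V R S

/-- The strict `V`-monoidal categories and all 1-cells between them. -/
def VMonCat.strict : SubTwoCategory (VMonCat.{w} V) where
  obj 𝒜 := IsStrictMonoidal 𝒜.Und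
  hom _ _ _ := True
  id_mem _ _ := trivial
  comp_mem _ _ _ _ := trivial

/-- The `V`-module tensor categories with strict underlying monoidal category, and all 1-cells. -/
def VModTens.strict : SubTwoCategory (VModTens.{w} V) where
  obj X := IsStrictMonoidal X.carrier
  hom _ _ _ := True
  id_mem _ _ := trivial
  comp_mem _ _ _ _ := trivial

/-- The strict `V`-monoidal categories and the strong 1-cells between them. -/
def VMonCat.strictStrong : SubTwoCategory (VMonCat.{w} V) where
  obj 𝒜 := IsStrictMonoidal 𝒜.Und
  hom _ _ R := ∀ a b, IsIso (VMonCat.OneCell.μ R a b)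
  id_mem 𝒜 _ := VMonCat.isIso_μ_id V 𝒜
  comp_mem R S := VMonCat.isIso_μ_comp V R S

/-- The strict 0-cells and the strong 1-cells between them. -/
def VModTens.strictStrong : SubTwoCategory (VModTens.{w} V) where
  obj X := IsStrictMonoidal X.carrier
  hom _ _ R := ∀ a b, IsIso (Functor.LaxMonoidal.μ (VModTens.OneCell.toPreOneCell R).functor a b)
  id_mem X _ := VModTens.isIso_μ_id V X
  comp_mem R S := VModTens.isIso_μ_comp V R S

end Sub

end BraidedEnriched

open BraidedEnriched

set_option linter.unusedSectionVars false

/-! The theorem is a dictionary between `v`-graded morphisms `v ⟶ 𝒜(a → b)` and ordinary morphisms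
`a ⊗ F v ⟶ b` of the underlying category. For `a = 𝟙` it is the adjunction `F ⊣ 𝒜(𝟙 → -)`. For
general `a` a left dual `ᘁa` turns both sides into the case of `𝟙` and `ᘁa ⊗ b`, so passing to the
mate is a bijection (`mate_bijective`).

In this dictionary composition splits `F (u ⊗ v)` by the oplaxitor (`mate_gcomp_mate`), the identity
element is the counit (`eId_eq_mate`), tensoring on the left is plain whiskering (`mate_comp_wL`),
and tensoring on the right by `c` must first move `c` past `F v`, which is the half-braiding
(`mate_comp_wR`). Hence the axioms match: associativity of composition is coassociativity of the
oplaxitor, and the braided interchange makes `F` braided. To isolate the braiding, `tens` is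
replaced by its two one-sided actions `wL` and `wR` (`WhiskerEnriched`). The two presentations carry
the same information, and the braiding occurs only in the exchange law for `wL` against `wR`.
Invertibility of the half-braidings is automatic from right duals (`isIso_of_lax_halfBraiding`).

For 1-cells, the action of `R` on hom-objects is determined by `r` (`LaxEnrichment.mate_comp_vm`),
and the coherence conditions on `r` are what is needed for the same formula to define a `V`-functor
compatible with the laxitor (`LaxEnrichment.ofComparison`). For monoidal transformations, naturality
on hom-objects is equivalent to compatibility with `r` (`LaxEnrichment.comparison_of_vnatural`,
`LaxEnrichment.vnatural_of_comparison`). So the functors on hom-categories are fully faithful, and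
even surjective on 1-cells (`map_liftOneCell`).

For a 0-cell `(A, F)` of the target, let the hom-object from `a` to `b` represent `v ↦ (a ⊗ F v ⟶
b)`; it exists by left duals and the right adjoint of `F`. Reading the dictionary backwards makes
`A` enriched and `V`-monoidal, and the central structure computed from this enrichment is the given
one (`CentralAction.halfBraid_adjunction`, `CentralAction.oplaxitor_adjunction`,
`CentralAction.opcounit_adjunction`). The resulting 0-cell is isomorphic to the original through
1-cells with identity laxitors, which gives the strong and strict versions as well. -/

namespace BraidedEnriched

/-! ### Calculus of graded morphisms in an enriched category -/

section GradedComposition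

variable {V : Type u} [Category.{v} V] [MonoidalCategory V]
  {A : Type w} [Category.{v} A] [EnrichedOrdinaryCategory V A]

/-- The composite of a `u`-graded and a `v`-graded morphism. -/
def gcomp {u v : V} {a b c : A} (f : u ⟶ (a ⟶[V] b)) (g : v ⟶ (b ⟶[V] c)) :
    u ⊗ v ⟶ (a ⟶[V] c) :=
  (f ⊗ₘ g) ≫ eComp V a b c

infixr:82 " ⊚ " => gcomp

variable {u u' v v' w : V} {a b c d : A}

/-- Composition is the universal graded composite. This reduces identities about `eComp` to
identities about graded morphisms. -/
theorem eComp_eq_gcomp (a b c : A) : eComp V a b c = 𝟙 (a ⟶[V] b) ⊚ 𝟙 (b ⟶[V] c) := by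
  simp [gcomp]

theorem gcomp_assoc (f : u ⟶ (a ⟶[V] b)) (g : v ⟶ (b ⟶[V] c)) (h : w ⟶ (c ⟶[V] d)) :
    (f ⊚ g) ⊚ h = (α_ u v w).hom ≫ f ⊚ (g ⊚ h) := by
  have := e_assoc' V a b c d
  simp only [gcomp, MonoidalCategory.tensorHom_def, comp_whiskerRight, MonoidalCategory.whiskerLeft_comp,
    Category.assoc]
  rw [← whisker_exchange_assoc, ← this]
  simp

theorem gcomp_assoc_inv (f : u ⟶ (a ⟶[V] b)) (g : v ⟶ (b ⟶[V] c)) (h : w ⟶ (c ⟶[V] d)) :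
    f ⊚ (g ⊚ h) = (α_ u v w).inv ≫ (f ⊚ g) ⊚ h := by
  rw [gcomp_assoc, Iso.inv_hom_id_assoc]

theorem comp_gcomp (k : u' ⟶ u) (f : u ⟶ (a ⟶[V] b)) (g : v ⟶ (b ⟶[V] c)) :
    (k ≫ f) ⊚ g = k ▷ v ≫ f ⊚ g := by
  simp [gcomp, MonoidalCategory.tensorHom_def]

theorem gcomp_comp (f : u ⟶ (a ⟶[V] b)) (k : v' ⟶ v) (g : v ⟶ (b ⟶[V] c)) :
    f ⊚ (k ≫ g) = u ◁ k ≫ f ⊚ g := by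
  simp [gcomp, MonoidalCategory.tensorHom_def']

theorem comp_gcomp_comp (k : u' ⟶ u) (f : u ⟶ (a ⟶[V] b)) (l : v' ⟶ v) (g : v ⟶ (b ⟶[V] c)) :
    (k ≫ f) ⊚ (l ≫ g) = (k ⊗ₘ l) ≫ f ⊚ g := by
  simp [gcomp]

theorem eHomEquiv_gcomp (h : a ⟶ b) (f : u ⟶ (b ⟶[V] c)) :
    eHomEquiv V h ⊚ f = (λ_ u).hom ≫ f ≫ eHomWhiskerRight V h c := by
  simp [gcomp, eHomWhiskerRight, MonoidalCategory.tensorHom_def']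

theorem gcomp_eHomEquiv (f : u ⟶ (a ⟶[V] b)) (h : b ⟶ c) :
    f ⊚ eHomEquiv V h = (ρ_ u).hom ≫ f ≫ eHomWhiskerLeft V a h := by
  simp [gcomp, eHomWhiskerLeft, MonoidalCategory.tensorHom_def]

theorem comp_eHomWhiskerRight (h : a ⟶ b) (f : u ⟶ (b ⟶[V] c)) :
    f ≫ eHomWhiskerRight V h c = (λ_ u).inv ≫ eHomEquiv V h ⊚ f := by
  rw [eHomEquiv_gcomp, Iso.inv_hom_id_assoc]

theorem comp_eHomWhiskerLeft (f : u ⟶ (a ⟶[V] b)) (h : b ⟶ c) :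
    f ≫ eHomWhiskerLeft V a h = (ρ_ u).inv ≫ f ⊚ eHomEquiv V h := by
  rw [gcomp_eHomEquiv, Iso.inv_hom_id_assoc]

theorem eId_gcomp (f : u ⟶ (a ⟶[V] b)) : eId V a ⊚ f = (λ_ u).hom ≫ f := by
  rw [← eHomEquiv_id, eHomEquiv_gcomp, eHomWhiskerRight_id, Category.comp_id]

theorem gcomp_eId (f : u ⟶ (a ⟶[V] b)) : f ⊚ eId V b = (ρ_ u).hom ≫ f := by
  rw [← eHomEquiv_id, gcomp_eHomEquiv, eHomWhiskerLeft_id, Category.comp_id]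

theorem eHomEquiv_comp_post (f : a ⟶ b) (g : b ⟶ c) :
    eHomEquiv V (f ≫ g) = eHomEquiv V f ≫ eHomWhiskerLeft V a g := by
  rw [eHomEquiv_comp, comp_eHomWhiskerLeft, unitors_inv_equal, gcomp]

theorem eHomEquiv_comp_pre (f : a ⟶ b) (g : b ⟶ c) :
    eHomEquiv V (f ≫ g) = eHomEquiv V g ≫ eHomWhiskerRight V f c := by
  rw [eHomEquiv_comp, comp_eHomWhiskerRight, gcomp]

theorem gcomp_post (f : u ⟶ (a ⟶[V] b)) (g : v ⟶ (b ⟶[V] c)) (h : c ⟶ d) :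
    (f ⊚ g) ≫ eHomWhiskerLeft V a h = f ⊚ (g ≫ eHomWhiskerLeft V b h) := by
  simp [gcomp, eComp_eHomWhiskerLeft, MonoidalCategory.tensorHom_def]

theorem gcomp_pre (h : d ⟶ a) (f : u ⟶ (a ⟶[V] b)) (g : v ⟶ (b ⟶[V] c)) :
    (f ⊚ g) ≫ eHomWhiskerRight V h c = (f ≫ eHomWhiskerRight V h b) ⊚ g := by
  simp [gcomp, eComp_eHomWhiskerRight, MonoidalCategory.tensorHom_def']

/-- Associativity of composition with the ordinary morphism `h` as a middle factor of degree `𝟙_ V`: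
it can be absorbed on either side. -/
theorem gcomp_mid (f : u ⟶ (a ⟶[V] b)) (h : b ⟶ c) (g : v ⟶ (c ⟶[V] d)) :
    (f ≫ eHomWhiskerLeft V a h) ⊚ g = f ⊚ (g ≫ eHomWhiskerRight V h d) := by
  rw [comp_eHomWhiskerLeft, comp_gcomp, gcomp_assoc, comp_eHomWhiskerRight, gcomp_comp]
  simp

end GradedComposition

/-! ### One-sided tensor actions on hom-objects -/

section Whisker

variable (V : Type u) [Category.{v} V] [MonoidalCategory V] [BraidedCategory V]

/-- The tensor product of a `V`-monoidal category, presented through the morphisms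
`wL c : 𝒜(a → b) ⟶ 𝒜(c ⊗ a → c ⊗ b)` and `wR c : 𝒜(a → b) ⟶ 𝒜(a ⊗ c → b ⊗ c)`. -/
class WhiskerEnriched (A : Type w) [Category.{v} A] [MonoidalCategory A]
    [EnrichedOrdinaryCategory V A] where
  wL (c a b : A) : (a ⟶[V] b) ⟶ ((c ⊗ a : A) ⟶[V] (c ⊗ b))
  wR (a b c : A) : (a ⟶[V] b) ⟶ ((a ⊗ c : A) ⟶[V] (b ⊗ c))
  eHomEquiv_wL (c : A) {a b : A} (f : a ⟶ b) :
    eHomEquiv V f ≫ wL c a b = eHomEquiv V (c ◁ f)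
  eHomEquiv_wR {a b : A} (f : a ⟶ b) (c : A) :
    eHomEquiv V f ≫ wR a b c = eHomEquiv V (f ▷ c)
  eComp_wL (d a b c : A) : eComp V a b c ≫ wL d a c = wL d a b ⊚ wL d b c
  eComp_wR (d a b c : A) : eComp V a b c ≫ wR a c d = wR a b d ⊚ wR b c d
  wL_gcomp_wR (a b c d : A) :
    wL a c d ⊚ wR a b d = (β_ (c ⟶[V] d) (a ⟶[V] b)).hom ≫ wR a b c ⊚ wL b c d
  wL_wL (a b c d : A) :
    wL b c d ≫ wL a _ _ ≫ eHomWhiskerRight V (α_ a b c).hom _ =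
      wL (a ⊗ b) c d ≫ eHomWhiskerLeft V _ (α_ a b d).hom
  wL_wR (a b c d : A) :
    wR b c d ≫ wL a _ _ ≫ eHomWhiskerRight V (α_ a b d).hom _ =
      wL a b c ≫ wR _ _ d ≫ eHomWhiskerLeft V _ (α_ a c d).hom
  wR_wR (a b c d : A) :
    wR a b (c ⊗ d) ≫ eHomWhiskerRight V (α_ a c d).hom _ =
      wR a b c ≫ wR _ _ d ≫ eHomWhiskerLeft V _ (α_ b c d).hom
  wL_unit (a b : A) :
    wL (𝟙_ A) a b ≫ eHomWhiskerLeft V _ (λ_ b).hom = eHomWhiskerRight V (λ_ a).hom b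
  wR_unit (a b : A) :
    wR a b (𝟙_ A) ≫ eHomWhiskerLeft V _ (ρ_ b).hom = eHomWhiskerRight V (ρ_ a).hom b

end Whisker

/-! ### From the two-sided tensor product to the one-sided actions -/

section FromTensor

variable {V : Type u} [Category.{v} V] [MonoidalCategory V] [BraidedCategory V]
  {C : Type w} [EnrichedCategory V C] [MonoidalCategory (ForgetEnrichment V C)]

section

variable [VMonoidal V C]

/-- The tensor product of graded morphisms. -/
def gtens {u v : V} {a b c d : ForgetEnrichment V C} (f : u ⟶ (a ⟶[V] c)) (g : v ⟶ (b ⟶[V] d)) :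
    u ⊗ v ⟶ ((a ⊗ b : ForgetEnrichment V C) ⟶[V] (c ⊗ d)) :=
  (f ⊗ₘ g) ≫ VMonoidal.tens a b c d

theorem gtens_gcomp_gtens {u v u' v' : V} {a b c d e f : ForgetEnrichment V C}
    (h : u ⟶ (a ⟶[V] b)) (i : v ⟶ (d ⟶[V] e)) (j : u' ⟶ (b ⟶[V] c)) (k : v' ⟶ (e ⟶[V] f)) :
    gtens h i ⊚ gtens j k = tensorμ u v u' v' ≫ gtens (h ⊚ j) (i ⊚ k) := by
  have := VMonoidal.interchange (V := V) (C := C) a b c d e f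
  simp only [gtens, gcomp, ← tensorHom_comp_tensorHom, Category.assoc] at this ⊢
  rw [this, tensorμ_natural_assoc]

theorem gtens_eHomEquiv {a b c d : ForgetEnrichment V C} (f : a ⟶ c) (g : b ⟶ d) :
    gtens (eHomEquiv V f) (eHomEquiv V g) = (λ_ (𝟙_ V)).hom ≫ eHomEquiv V (f ⊗ₘ g) := by
  rw [VMonoidal.eHomEquiv_tensorHom, Iso.hom_inv_id_assoc, gtens]

theorem comp_gtens {u u' v : V} {a b c d : ForgetEnrichment V C} (k : u' ⟶ u)
    (f : u ⟶ (a ⟶[V] c)) (g : v ⟶ (b ⟶[V] d)) : gtens (k ≫ f) g = k ▷ v ≫ gtens f g := by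
  simp [gtens, MonoidalCategory.tensorHom_def]

theorem gtens_comp {u v' v : V} {a b c d : ForgetEnrichment V C} (f : u ⟶ (a ⟶[V] c))
    (k : v' ⟶ v) (g : v ⟶ (b ⟶[V] d)) : gtens f (k ≫ g) = u ◁ k ≫ gtens f g := by
  simp [gtens, MonoidalCategory.tensorHom_def']

/-- The braiding inside `tensorμ` acts on the two middle factors and is trivial when these are
units. Together with `tensorμ_unit_outer` this explains why only one of the two factorizations of `f
⊗ g` sees the braiding. -/
theorem tensorμ_unit_inner (u v : V) :
    tensorμ u (𝟙_ V) (𝟙_ V) v ≫ ((ρ_ u).hom ⊗ₘ (λ_ v).hom) = ((ρ_ u).hom ⊗ₘ (λ_ v).hom) := by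
  simp only [tensorμ, braiding_tensorUnit_left]
  monoidal

/-- With units in the outer slots nothing but the braiding of the middle factors is left. -/
theorem tensorμ_unit_outer (u v : V) :
    tensorμ (𝟙_ V) v u (𝟙_ V) ≫ ((λ_ u).hom ⊗ₘ (ρ_ v).hom) =
      ((λ_ v).hom ⊗ₘ (ρ_ u).hom) ≫ (β_ v u).hom := by
  simp only [tensorμ, MonoidalCategory.tensorHom_def, Category.assoc]
  rw [← cancel_epi ((λ_ v).inv ⊗ₘ (ρ_ u).inv)]
  simp
  monoidal

variable {u v : V} {a b c d : ForgetEnrichment V C}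

variable (V) in
/-- Left tensoring with an object, on hom-objects. -/
def tensWL (c a b : ForgetEnrichment V C) :
    (a ⟶[V] b) ⟶ ((c ⊗ a : ForgetEnrichment V C) ⟶[V] (c ⊗ b)) :=
  (λ_ _).inv ≫ eId V c ▷ _ ≫ VMonoidal.tens c a c b

variable (V) in
/-- Right tensoring with an object, on hom-objects. -/
def tensWR (a b c : ForgetEnrichment V C) :
    (a ⟶[V] b) ⟶ ((a ⊗ c : ForgetEnrichment V C) ⟶[V] (b ⊗ c)) :=
  (ρ_ _).inv ≫ _ ◁ eId V c ≫ VMonoidal.tens a c b c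

theorem comp_tensWL (f : u ⟶ (a ⟶[V] b)) :
    f ≫ tensWL V c a b = (λ_ u).inv ≫ gtens (eId V c) f := by
  simp [tensWL, gtens, MonoidalCategory.tensorHom_def']

theorem comp_tensWR (f : u ⟶ (a ⟶[V] b)) :
    f ≫ tensWR V a b c = (ρ_ u).inv ≫ gtens f (eId V c) := by
  simp [tensWR, gtens, MonoidalCategory.tensorHom_def]

theorem gtens_eId_eId (a b : ForgetEnrichment V C) :
    gtens (eId V a) (eId V b) = (λ_ (𝟙_ V)).hom ≫ eId V (a ⊗ b) := by
  rw [← eHomEquiv_id, ← eHomEquiv_id, gtens_eHomEquiv, id_tensorHom_id, eHomEquiv_id]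

/-- Interchange for `(f ⊗ j) ⊚ (j ⊗ g)`: the middle factors are identity elements, of degree `𝟙_ V`,
so no braiding survives. -/
theorem gtens_eq (f : u ⟶ (a ⟶[V] b)) (g : v ⟶ (c ⟶[V] d)) :
    gtens f g = (f ≫ tensWR V a b c) ⊚ (g ≫ tensWL V b c d) := by
  rw [comp_tensWR, comp_tensWL, comp_gcomp_comp, gtens_gcomp_gtens, gcomp_eId, eId_gcomp,
    comp_gtens, gtens_comp, ← MonoidalCategory.tensorHom_def_assoc]
  rw [(reassoc_of% tensorμ_unit_inner u v)]
  simp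

/-- In the opposite order `(j ⊗ g) ⊚ (f ⊗ j)` the middle factors are `g` and `f`, so interchange
contributes their full braiding. -/
theorem braiding_gtens (f : u ⟶ (a ⟶[V] b)) (g : v ⟶ (c ⟶[V] d)) :
    (β_ v u).hom ≫ gtens f g = (g ≫ tensWL V a c d) ⊚ (f ≫ tensWR V a b d) := by
  rw [comp_tensWR, comp_tensWL, comp_gcomp_comp, gtens_gcomp_gtens, gcomp_eId, eId_gcomp,
    comp_gtens, gtens_comp, ← MonoidalCategory.tensorHom_def_assoc]
  rw [(reassoc_of% tensorμ_unit_outer u v)]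
  rw [tensorHom_comp_tensorHom_assoc, Iso.inv_hom_id, Iso.inv_hom_id, id_tensorHom_id,
    Category.id_comp]

theorem gcomp_tensWL (f : u ⟶ (a ⟶[V] b)) (g : v ⟶ (b ⟶[V] c)) :
    (f ⊚ g) ≫ tensWL V d a c = (f ≫ tensWL V d a b) ⊚ (g ≫ tensWL V d b c) := by
  have h := leftUnitor_monoidal u v
  rw [comp_tensWL, comp_tensWL, comp_tensWL, comp_gcomp_comp, gtens_gcomp_gtens, eId_gcomp,
    comp_gtens, ← cancel_epi ((λ_ u).hom ⊗ₘ (λ_ v).hom), tensorHom_comp_tensorHom_assoc, h]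
  simp only [Iso.hom_inv_id, id_tensorHom_id, Category.id_comp, Category.assoc,
    Iso.hom_inv_id_assoc]

theorem gcomp_tensWR (f : u ⟶ (a ⟶[V] b)) (g : v ⟶ (b ⟶[V] c)) :
    (f ⊚ g) ≫ tensWR V a c d = (f ≫ tensWR V a b d) ⊚ (g ≫ tensWR V b c d) := by
  have h := rightUnitor_monoidal u v
  rw [comp_tensWR, comp_tensWR, comp_tensWR, comp_gcomp_comp, gtens_gcomp_gtens, eId_gcomp,
    gtens_comp, ← cancel_epi ((ρ_ u).hom ⊗ₘ (ρ_ v).hom), tensorHom_comp_tensorHom_assoc, h]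
  simp only [Iso.hom_inv_id, id_tensorHom_id, Category.id_comp, Category.assoc,
    Iso.hom_inv_id_assoc]

theorem gtens_gtens {w : V} {e f : ForgetEnrichment V C} (x : u ⟶ (a ⟶[V] d))
    (y : v ⟶ (b ⟶[V] e)) (z : w ⟶ (c ⟶[V] f)) :
    gtens (gtens x y) z ≫ eHomWhiskerLeft V _ (α_ d e f).hom =
      (α_ u v w).hom ≫ gtens x (gtens y z) ≫ eHomWhiskerRight V (α_ a b c).hom _ := by
  have h := VMonoidal.associator_vnatural (V := V) a b c d e f
  have h₁ : gtens (gtens x y) z = ((x ⊗ₘ y) ⊗ₘ z) ≫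
      VMonoidal.tens a b d e ▷ _ ≫ VMonoidal.tens _ _ _ _ := by
    simp [gtens, MonoidalCategory.tensorHom_def']
  have h₂ : gtens x (gtens y z) = (x ⊗ₘ (y ⊗ₘ z)) ≫
      _ ◁ VMonoidal.tens b c e f ≫ VMonoidal.tens _ _ _ _ := by
    simp [gtens, MonoidalCategory.tensorHom_def]
  rw [h₁, h₂, Category.assoc, Category.assoc, h, associator_naturality_assoc, Category.assoc,
    Category.assoc]

/-- The exchange law compares the two factorizations `gtens_eq` and `braiding_gtens`. The three
associativity laws are `gtens_gtens` with identity elements in two of the three slots. -/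
instance : WhiskerEnriched V (ForgetEnrichment V C) where
  wL := tensWL V
  wR := tensWR V
  eHomEquiv_wL c a b f := by
    rw [comp_tensWL, ← eHomEquiv_id, gtens_eHomEquiv, Iso.inv_hom_id_assoc, id_tensorHom]
  eHomEquiv_wR f c := by
    rw [comp_tensWR, ← eHomEquiv_id, gtens_eHomEquiv, ← unitors_inv_equal, Iso.inv_hom_id_assoc,
      tensorHom_id]
  eComp_wL d a b c := by
    rw [eComp_eq_gcomp, gcomp_tensWL, Category.id_comp, Category.id_comp]
  eComp_wR d a b c := by
    rw [eComp_eq_gcomp, gcomp_tensWR, Category.id_comp, Category.id_comp]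
  wL_gcomp_wR a b c d := by
    have h₁ := braiding_gtens (𝟙 (a ⟶[V] b)) (𝟙 (c ⟶[V] d))
    have h₂ := gtens_eq (𝟙 (a ⟶[V] b)) (𝟙 (c ⟶[V] d))
    rw [Category.id_comp, Category.id_comp] at h₁ h₂
    rw [← h₂, h₁]
  wL_wL a b c d := by
    have h : tensWL V b c d ≫ tensWL V a _ _ = (λ_ _).inv ≫ 𝟙_ V ◁ (λ_ _).inv ≫
        gtens (eId V a) (gtens (eId V b) (𝟙 (c ⟶[V] d))) := by
      rw [← gtens_comp, ← comp_tensWL, ← comp_tensWL, Category.id_comp]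
    have h' : tensWL V (a ⊗ b) c d = (λ_ _).inv ≫ (λ_ _).inv ▷ _ ≫
        gtens (gtens (eId V a) (eId V b)) (𝟙 (c ⟶[V] d)) := by
      rw [← comp_gtens, gtens_eId_eId, Iso.inv_hom_id_assoc, ← comp_tensWL, Category.id_comp]
    rw [reassoc_of% h, h', Category.assoc, Category.assoc, gtens_gtens]
    simp
  wL_wR a b c d := by
    have h : tensWR V b c d ≫ tensWL V a _ _ = (λ_ _).inv ≫ 𝟙_ V ◁ (ρ_ _).inv ≫
        gtens (eId V a) (gtens (𝟙 (b ⟶[V] c)) (eId V d)) := by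
      rw [← gtens_comp, ← comp_tensWR, ← comp_tensWL, Category.id_comp]
    have h' : tensWL V a b c ≫ tensWR V _ _ d = (ρ_ _).inv ≫ (λ_ _).inv ▷ _ ≫
        gtens (gtens (eId V a) (𝟙 (b ⟶[V] c))) (eId V d) := by
      rw [← comp_gtens, ← comp_tensWL, ← comp_tensWR, Category.id_comp]
    rw [reassoc_of% h, reassoc_of% h', gtens_gtens]
    simp
  wR_wR a b c d := by
    have h : tensWR V a b c ≫ tensWR V _ _ d = (ρ_ _).inv ≫ (ρ_ _).inv ▷ _ ≫
        gtens (gtens (𝟙 (a ⟶[V] b)) (eId V c)) (eId V d) := by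
      rw [← comp_gtens, ← comp_tensWR, ← comp_tensWR, Category.id_comp]
    have h' : tensWR V a b (c ⊗ d) = (ρ_ _).inv ≫ _ ◁ (λ_ _).inv ≫
        gtens (𝟙 (a ⟶[V] b)) (gtens (eId V c) (eId V d)) := by
      rw [← gtens_comp, gtens_eId_eId, Iso.inv_hom_id_assoc, ← comp_tensWR, Category.id_comp]
    have k : (ρ_ ((a ⟶[V] b) ⊗ 𝟙_ V)).inv ≫ (α_ (a ⟶[V] b) (𝟙_ V) (𝟙_ V)).hom =
        (a ⟶[V] b) ◁ (λ_ (𝟙_ V)).inv := by monoidal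
    rw [reassoc_of% h, h', gtens_gtens]
    simp [reassoc_of% k]
  wL_unit a b := by
    have h := VMonoidal.leftUnitor_vnatural (V := V) a b
    simp only [tensWL, Category.assoc]
    exact h
  wR_unit a b := by
    have h := VMonoidal.rightUnitor_vnatural (V := V) a b
    simp only [tensWR, Category.assoc]
    exact h

end

end FromTensor

/-! ### Naturality of the one-sided actions, and the way back to `tens` -/

namespace WhiskerEnriched

section Lemmas

variable {V : Type u} [Category.{v} V] [MonoidalCategory V] [BraidedCategory V]
  {A : Type w} [Category.{v} A] [MonoidalCategory A] [EnrichedOrdinaryCategory V A]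
  [WhiskerEnriched V A] {u v : V} {a b c d e : A}

theorem gcomp_comp_wL (d : A) (f : u ⟶ (a ⟶[V] b)) (g : v ⟶ (b ⟶[V] c)) :
    (f ⊚ g) ≫ wL d a c = (f ≫ wL d a b) ⊚ (g ≫ wL d b c) := by
  rw [gcomp, Category.assoc, eComp_wL, comp_gcomp_comp]

theorem gcomp_comp_wR (d : A) (f : u ⟶ (a ⟶[V] b)) (g : v ⟶ (b ⟶[V] c)) :
    (f ⊚ g) ≫ wR a c d = (f ≫ wR a b d) ⊚ (g ≫ wR b c d) := by
  rw [gcomp, Category.assoc, eComp_wR, comp_gcomp_comp]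

theorem comp_wL_gcomp_comp_wR (f : u ⟶ (a ⟶[V] b)) (g : v ⟶ (c ⟶[V] d)) :
    (f ≫ wL c a b) ⊚ (g ≫ wR c d b) = (β_ u v).hom ≫ (g ≫ wR c d a) ⊚ (f ≫ wL d a b) := by
  rw [comp_gcomp_comp, wL_gcomp_wR, BraidedCategory.braiding_naturality_assoc, comp_gcomp_comp]

theorem wL_post (c : A) (a : A) (g : b ⟶ d) :
    wL c a b ≫ eHomWhiskerLeft V _ (c ◁ g) = eHomWhiskerLeft V a g ≫ wL c a d := by
  rw [← Category.id_comp (eHomWhiskerLeft V a g), comp_eHomWhiskerLeft, comp_eHomWhiskerLeft,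
    Category.assoc, gcomp_comp_wL, eHomEquiv_wL, Category.id_comp]

theorem wL_post_assoc (c : A) (a : A) (g : b ⟶ d) {z : V} (k' : _ ⟶ z) :
    wL c a b ≫ eHomWhiskerLeft V _ (c ◁ g) ≫ k' =
      eHomWhiskerLeft V a g ≫ wL c a d ≫ k' :=
  (reassoc_of% wL_post c a g) k'

theorem wL_pre (c : A) (g : d ⟶ a) (b : A) :
    wL c a b ≫ eHomWhiskerRight V (c ◁ g) _ = eHomWhiskerRight V g b ≫ wL c d b := by
  rw [← Category.id_comp (eHomWhiskerRight V g b), comp_eHomWhiskerRight, comp_eHomWhiskerRight,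
    Category.assoc, gcomp_comp_wL, eHomEquiv_wL, Category.id_comp]

theorem wL_pre_assoc (c : A) (g : d ⟶ a) (b : A) {z : V} (k' : _ ⟶ z) :
    wL c a b ≫ eHomWhiskerRight V (c ◁ g) _ ≫ k' =
      eHomWhiskerRight V g b ≫ wL c d b ≫ k' :=
  (reassoc_of% wL_pre c g b) k'

theorem wR_post (c : A) (a : A) (g : b ⟶ d) :
    wR a b c ≫ eHomWhiskerLeft V _ (g ▷ c) = eHomWhiskerLeft V a g ≫ wR a d c := by
  rw [← Category.id_comp (eHomWhiskerLeft V a g), comp_eHomWhiskerLeft, comp_eHomWhiskerLeft,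
    Category.assoc, gcomp_comp_wR, eHomEquiv_wR, Category.id_comp]

theorem wR_post_assoc (c : A) (a : A) (g : b ⟶ d) {z : V} (k' : _ ⟶ z) :
    wR a b c ≫ eHomWhiskerLeft V _ (g ▷ c) ≫ k' =
      eHomWhiskerLeft V a g ≫ wR a d c ≫ k' :=
  (reassoc_of% wR_post c a g) k'

theorem wR_pre (c : A) (g : d ⟶ a) (b : A) :
    wR a b c ≫ eHomWhiskerRight V (g ▷ c) _ = eHomWhiskerRight V g b ≫ wR d b c := by
  rw [← Category.id_comp (eHomWhiskerRight V g b), comp_eHomWhiskerRight, comp_eHomWhiskerRight,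
    Category.assoc, gcomp_comp_wR, eHomEquiv_wR, Category.id_comp]

theorem wR_pre_assoc (c : A) (g : d ⟶ a) (b : A) {z : V} (k' : _ ⟶ z) :
    wR a b c ≫ eHomWhiskerRight V (g ▷ c) _ ≫ k' =
      eHomWhiskerRight V g b ≫ wR d b c ≫ k' :=
  (reassoc_of% wR_pre c g b) k'

/-- The exchange law for an ordinary morphism `h`: its degree is `𝟙_ V`, so the braiding disappears.
The same applies to `wR_exchange`. -/
theorem wL_exchange (h : c ⟶ d) (a b : A) :
    wL c a b ≫ eHomWhiskerLeft V _ (h ▷ b) = wL d a b ≫ eHomWhiskerRight V (h ▷ a) _ := by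
  have := comp_wL_gcomp_comp_wR (𝟙 (a ⟶[V] b)) (eHomEquiv V h)
  rw [comp_eHomWhiskerLeft, comp_eHomWhiskerRight, ← cancel_epi (ρ_ _).hom]
  rw [eHomEquiv_wR, eHomEquiv_wR, Category.id_comp, Category.id_comp] at this
  rw [Iso.hom_inv_id_assoc, this]
  simp

theorem wL_exchange_assoc (h : c ⟶ d) (a b : A) {z : V} (k' : _ ⟶ z) :
    wL c a b ≫ eHomWhiskerLeft V _ (h ▷ b) ≫ k' =
      wL d a b ≫ eHomWhiskerRight V (h ▷ a) _ ≫ k' :=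
  (reassoc_of% wL_exchange h a b) k'

theorem wR_exchange (h : c ⟶ d) (a b : A) :
    wR a b c ≫ eHomWhiskerLeft V _ (b ◁ h) = wR a b d ≫ eHomWhiskerRight V (a ◁ h) _ := by
  have := comp_wL_gcomp_comp_wR (eHomEquiv V h) (𝟙 (a ⟶[V] b))
  rw [comp_eHomWhiskerLeft, comp_eHomWhiskerRight, ← cancel_epi (λ_ _).hom]
  rw [eHomEquiv_wL, eHomEquiv_wL, Category.id_comp, Category.id_comp] at this
  rw [Iso.hom_inv_id_assoc, this]
  simp

theorem wR_exchange_assoc (h : c ⟶ d) (a b : A) {z : V} (k' : _ ⟶ z) :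
    wR a b c ≫ eHomWhiskerLeft V _ (b ◁ h) ≫ k' =
      wR a b d ≫ eHomWhiskerRight V (a ◁ h) _ ≫ k' :=
  (reassoc_of% wR_exchange h a b) k'

end Lemmas

section ToTensor

variable {V : Type u} [Category.{v} V] [MonoidalCategory V] [BraidedCategory V]
  {C : Type w} [EnrichedCategory V C] [MonoidalCategory (ForgetEnrichment V C)]
  [WhiskerEnriched V (ForgetEnrichment V C)]

/-- The `V`-monoidal structure with `tens := wR` followed by `wL`. -/
@[reducible]
def toVMonoidal : VMonoidal V C where
  tens a b c d := wR a c b ⊚ wL c b d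
  eHomEquiv_tensorHom {a b c d} f g := by
    rw [← comp_gcomp_comp, eHomEquiv_wR, eHomEquiv_wL, gcomp_eHomEquiv,
      ← eHomEquiv_comp_post, ← MonoidalCategory.tensorHom_def, ← unitors_equal,
      Iso.inv_hom_id_assoc]
  interchange a b c d e f := by
    -- Of the four factors only the middle pair `wL b d e`, `wR b c d` stands in the wrong order.
    -- Exchanging it produces exactly the one braiding contained in `tensorμ`.
    change (wR a b d ⊚ wL b d e) ⊚ (wR b c e ⊚ wL c e f) = _
    rw [← comp_gcomp_comp, eComp_wR, eComp_wL, gcomp_assoc, gcomp_assoc_inv (wL b d e), wL_gcomp_wR,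
      comp_gcomp, gcomp_assoc, gcomp_assoc, gcomp_comp, gcomp_comp, gcomp_comp,
      gcomp_assoc_inv (wR a b d) (wR b c d)]
    simp [tensorμ]
  associator_vnatural a b c d e f := by
    -- The associator travels from the last factor to the first: `wL_wL`, `wL_wR` and `wR_wR` carry
    -- it through one factor each, and `gcomp_mid` hands it to the preceding one.
    rw [gcomp_post, ← comp_gcomp, gcomp_comp_wR, ← wL_wL, ← Category.assoc (wL e c f), ← gcomp_mid,
      gcomp_post, Category.assoc, ← wL_wR, ← Category.assoc (wR b e c), ← gcomp_mid, Category.assoc,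
      ← wR_wR,
      gcomp_assoc, gcomp_pre, ← gcomp_comp, gcomp_comp_wL]
  leftUnitor_vnatural a b := by
    rw [gcomp_post, ← comp_gcomp, wL_unit, ← eHomEquiv_id, eHomEquiv_wR, eHomEquiv_gcomp]
    simp
  rightUnitor_vnatural a b := by
    rw [gcomp_post, ← gcomp_comp, ← eHomEquiv_id, reassoc_of% eHomEquiv_wL, ← eHomEquiv_comp_post,
      gcomp_eHomEquiv]
    simp [wR_unit]

end ToTensor

end WhiskerEnriched

end BraidedEnriched

namespace BraidedEnriched

/-! ### Mates, and the central structure they define -/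

section Mates

open WhiskerEnriched

variable {V : Type u} [Category.{v} V] [MonoidalCategory V] [BraidedCategory V]
  {A : Type w} [Category.{v} A] [MonoidalCategory A] [EnrichedOrdinaryCategory V A]
  [WhiskerEnriched V A] {F : V ⥤ A} (adj : F ⊣ eCoyoneda V (𝟙_ A))

variable {u' v' w' : V} {a b c d : A}

/-- The unit of `F ⊣ 𝒜(𝟙 → -)`. -/
def gunit (v : V) : v ⟶ (𝟙_ A ⟶[V] F.obj v) := adj.unit.app v

/-- The morphism corresponding under the adjunction to `f : F v ⟶ b`. -/
def mateOne {v : V} {b : A} (f : F.obj v ⟶ b) : v ⟶ (𝟙_ A ⟶[V] b) :=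
  gunit adj v ≫ eHomWhiskerLeft V (𝟙_ A) f

/-- The mate of `f : a ⊗ F v ⟶ b`. -/
def mate {v : V} {a b : A} (f : a ⊗ F.obj v ⟶ b) : v ⟶ (a ⟶[V] b) :=
  gunit adj v ≫ wL a _ _ ≫ eHomWhiskerRight V (ρ_ a).inv _ ≫ eHomWhiskerLeft V a f

theorem mateOne_bijective (v : V) (b : A) :
    Function.Bijective (mateOne adj (v := v) (b := b)) :=
  (adj.homEquiv v b).bijective

theorem mateOne_injective {v : V} {b : A} {f g : F.obj v ⟶ b}
    (h : mateOne adj f = mateOne adj g) : f = g :=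
  (mateOne_bijective adj v b).1 h

/-- The inverse of `mateOne`. -/
def unmateOne {v : V} {b : A} (x : v ⟶ (𝟙_ A ⟶[V] b)) : F.obj v ⟶ b :=
  (adj.homEquiv v b).symm x

@[simp]
theorem mateOne_unmateOne {v : V} {b : A} (x : v ⟶ (𝟙_ A ⟶[V] b)) :
    mateOne adj (unmateOne adj x) = x :=
  (adj.homEquiv v b).apply_symm_apply x

theorem mateOne_id (v : V) : mateOne adj (𝟙 (F.obj v)) = gunit adj v := by simp [mateOne]

theorem mateOne_comp {v : V} {b c : A} (f : F.obj v ⟶ b) (g : b ⟶ c) :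
    mateOne adj (f ≫ g) = mateOne adj f ≫ eHomWhiskerLeft V _ g := by
  simp [mateOne]

theorem gunit_naturality (h : u' ⟶ v') :
    h ≫ gunit adj v' = gunit adj u' ≫ eHomWhiskerLeft V _ (F.map h) :=
  adj.unit.naturality h

theorem mateOne_map_comp (h : u' ⟶ v') (f : F.obj v' ⟶ b) :
    mateOne adj (F.map h ≫ f) = h ≫ mateOne adj f := by
  rw [mateOne, mateOne, ← Category.assoc h, gunit_naturality, eHomWhiskerLeft_comp, Category.assoc]

theorem wL_wL' (a b c d : A) :
    wL b c d ≫ wL a _ _ = wL (V := V) (a ⊗ b) c d ≫ eHomWhiskerLeft V _ (α_ a b d).hom ≫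
      eHomWhiskerRight V (α_ a b c).inv _ := by
  rw [← reassoc_of% wL_wL (V := V), ← eHomWhiskerRight_comp]
  simp

theorem wR_wL' (a b c d : A) :
    wR b c d ≫ wL a _ _ = wL (V := V) a b c ≫ wR _ _ d ≫ eHomWhiskerLeft V _ (α_ a c d).hom ≫
      eHomWhiskerRight V (α_ a b d).inv _ := by
  rw [← reassoc_of% wL_wR (V := V), ← eHomWhiskerRight_comp]
  simp

theorem wL_unit' (a b : A) :
    wL (V := V) (𝟙_ A) a b = eHomWhiskerRight V (λ_ a).hom b ≫ eHomWhiskerLeft V _ (λ_ b).inv := by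
  rw [← wL_unit, Category.assoc, ← eHomWhiskerLeft_comp]
  simp

theorem mate_eq_mateOne {v : V} (f : 𝟙_ A ⊗ F.obj v ⟶ b) :
    mate adj f = mateOne adj ((λ_ _).inv ≫ f) := by
  rw [mate, mateOne, wL_unit', eHomWhiskerLeft_comp, Category.assoc, eHom_whisker_exchange_assoc,
    ← eHomWhiskerRight_comp_assoc, unitors_inv_equal.symm, Iso.inv_hom_id]
  simp

theorem mate_comp {v : V} (f : a ⊗ F.obj v ⟶ b) (g : b ⟶ c) :
    mate adj (f ≫ g) = mate adj f ≫ eHomWhiskerLeft V a g := by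
  simp [mate]

theorem mate_whiskerLeft_map_comp (h : u' ⟶ v') (f : a ⊗ F.obj v' ⟶ b) :
    mate adj (a ◁ F.map h ≫ f) = h ≫ mate adj f := by
  rw [mate, mate, ← Category.assoc h, gunit_naturality, eHomWhiskerLeft_comp, Category.assoc,
    ← wL_post_assoc, eHom_whisker_exchange_assoc]

/-- Naturality of the mate in the source object; it rests on `wL_exchange`. -/
theorem mate_whiskerRight_comp {v : V} (k : a ⟶ b) (f : b ⊗ F.obj v ⟶ c) :
    mate adj (k ▷ F.obj v ≫ f) = mate adj f ≫ eHomWhiskerRight V k _ := by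
  rw [mate, mate, eHomWhiskerLeft_comp, ← eHom_whisker_exchange_assoc, wL_exchange_assoc,
    ← eHomWhiskerRight_comp_assoc, ← rightUnitor_inv_naturality]
  simp [eHom_whisker_exchange]

/-- Left whiskerings compose by `wL_wL'`, so whiskering a mate is the mate of the whiskered morphism
up to the associator. -/
theorem mate_comp_wL {v : V} (c : A) (f : a ⊗ F.obj v ⟶ b) :
    mate adj f ≫ wL c a b = mate adj ((α_ c a _).hom ≫ c ◁ f) := by
  simp only [mate, Category.assoc, eHomWhiskerLeft_comp]
  rw [← wL_post, ← wL_pre_assoc, reassoc_of% wL_wL' (V := V), ← eHomWhiskerRight_comp_assoc,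
    eHom_whisker_exchange_assoc]
  simp

/-- The mate of `a ⊗ F v ⟶ b`, composed with the coevaluation of a left dual of `a`. -/
def dualize [HasLeftDual a] {v : V} (x : v ⟶ (a ⟶[V] b)) : v ⟶ (𝟙_ A ⟶[V] ((ᘁa) ⊗ b : A)) :=
  x ≫ wL (ᘁa) a b ≫ eHomWhiskerRight V (η_ (ᘁa) a) _

/-- Under the duality isomorphism for `ᘁa`, taking the mate becomes the bijection of the adjunction.
Surjectivity and injectivity of `mate` are both read off from this. -/
theorem dualize_mate [HasLeftDual a] {v : V} (f : a ⊗ F.obj v ⟶ b) :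
    dualize (mate adj f) = mateOne adj (tensorLeftHomEquiv _ _ _ _ f) := by
  have h : η_ (ᘁa : A) a ≫ (ρ_ _).inv = (λ_ _).inv ≫ η_ (ᘁa : A) a ▷ _ := by
    rw [unitors_inv_equal, ← rightUnitor_inv_naturality]
  rw [dualize, ← Category.assoc, mate_comp_wL, mate, mateOne, Category.assoc, Category.assoc,
    Category.assoc, eHom_whisker_exchange, ← eHomWhiskerRight_comp_assoc, h,
    eHomWhiskerRight_comp_assoc, ← wL_exchange_assoc, wL_unit']
  simp only [Category.assoc, eHom_whisker_exchange_assoc]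
  rw [← eHomWhiskerRight_comp_assoc, Iso.inv_hom_id]
  simp [tensorLeftHomEquiv]

/-- Whiskering by `a` and evaluating `a ⊗ ᘁa` gives a left inverse of `dualize`, by a zigzag
identity. -/
theorem dualize_injective [HasLeftDual a] {v : V} {x y : v ⟶ (a ⟶[V] b)}
    (h : dualize x = dualize y) : x = y := by
  suffices H : ∀ x : v ⟶ (a ⟶[V] b), dualize x ≫ wL a _ _ ≫ eHomWhiskerLeft V _
      ((α_ _ _ _).inv ≫ ε_ (ᘁa) a ▷ b ≫ (λ_ _).hom) ≫ eHomWhiskerRight V (ρ_ a).inv _ = x by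
    rw [← H x, h, H y]
  intro x
  have z := ExactPairing.coevaluation_evaluation (ᘁa : A) a
  rw [dualize, Category.assoc, Category.assoc, ← wL_pre_assoc, reassoc_of% wL_wL' (V := V),
    ← eHomWhiskerRight_comp_assoc, eHom_whisker_exchange_assoc,
    ← eHomWhiskerLeft_comp_assoc, Iso.hom_inv_id_assoc, eHomWhiskerLeft_comp_assoc,
    ← eHom_whisker_exchange_assoc, wL_exchange_assoc, ← eHom_whisker_exchange_assoc,
    ← eHom_whisker_exchange_assoc, reassoc_of% wL_unit (V := V),
    ← eHomWhiskerRight_comp, ← eHomWhiskerRight_comp, ← eHomWhiskerRight_comp, Category.assoc,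
    Category.assoc, Category.assoc, reassoc_of% z]
  simp

variable [LeftRigidCategory A]

/-- This makes every identity between graded morphisms equivalent to one between ordinary morphisms
of `A`, and conversely. -/
theorem mate_bijective (v : V) (a b : A) :
    Function.Bijective (mate adj (v := v) (a := a) (b := b)) := by
  constructor
  · intro f g h
    have := congrArg dualize h
    rw [dualize_mate, dualize_mate] at this
    exact (tensorLeftHomEquiv _ _ _ _).injective (mateOne_injective adj this)
  · intro x
    obtain ⟨g, hg⟩ := (mateOne_bijective adj _ _).2 (dualize x)
    refine ⟨(tensorLeftHomEquiv _ _ _ _).symm g, dualize_injective ?_⟩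
    rw [dualize_mate, Equiv.apply_symm_apply, hg]

theorem mate_injective {v : V} {f g : a ⊗ F.obj v ⟶ b} (h : mate adj f = mate adj g) : f = g :=
  (mate_bijective adj v a b).1 h

/-- The inverse of `mate`. -/
noncomputable def unmate {v : V} (x : v ⟶ (a ⟶[V] b)) : a ⊗ F.obj v ⟶ b :=
  (Equiv.ofBijective _ (mate_bijective adj v a b)).symm x

@[simp]
theorem mate_unmate {v : V} (x : v ⟶ (a ⟶[V] b)) : mate adj (unmate adj x) = x :=
  (Equiv.ofBijective _ (mate_bijective adj v a b)).apply_symm_apply x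

/-- The half-braiding `a ⊗ F v ⟶ F v ⊗ a`, determined by its mate `gunit ⊗ j_a`. -/
noncomputable def halfBraid (a : A) (v : V) : a ⊗ F.obj v ⟶ F.obj v ⊗ a :=
  unmate adj (gunit adj v ≫ wR _ _ a ≫ eHomWhiskerRight V (λ_ a).inv _)

theorem mate_halfBraid (a : A) (v : V) :
    mate adj (halfBraid adj a v) = gunit adj v ≫ wR _ _ a ≫ eHomWhiskerRight V (λ_ a).inv _ :=
  mate_unmate _ _

/-- The oplaxitor `F (u ⊗ v) ⟶ F u ⊗ F v`, determined by its mate `gunit ⊗ gunit`. -/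
noncomputable def oplaxitor (u v : V) : F.obj (u ⊗ v) ⟶ F.obj u ⊗ F.obj v :=
  unmateOne adj (gunit adj u ⊚ mate adj (𝟙 (F.obj u ⊗ F.obj v)))

theorem mateOne_oplaxitor (u v : V) :
    mateOne adj (oplaxitor adj u v) = gunit adj u ⊚ mate adj (𝟙 (F.obj u ⊗ F.obj v)) :=
  mateOne_unmateOne _ _

/-- The counit `F 𝟙 ⟶ 𝟙`, whose mate is the identity element of `𝟙`. -/
noncomputable def opcounit : F.obj (𝟙_ V) ⟶ 𝟙_ A := unmateOne adj (eId V (𝟙_ A))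

theorem mateOne_opcounit : mateOne adj (opcounit adj) = eId V (𝟙_ A) := mateOne_unmateOne _ _

theorem mate_id_eq (v : V) (a : A) : mate adj (𝟙 (a ⊗ F.obj v)) =
    gunit adj v ≫ wL a _ _ ≫ eHomWhiskerRight V (ρ_ a).inv _ := by
  simp [mate]

theorem mate_eq_id {v : V} (f : a ⊗ F.obj v ⟶ b) :
    mate adj f = mate adj (𝟙 _) ≫ eHomWhiskerLeft V a f := by
  rw [← mate_comp, Category.id_comp]

theorem mate_whiskerLeft {v : V} (f : F.obj v ⟶ b) :
    mate adj (a ◁ f) = mateOne adj f ≫ wL a _ _ ≫ eHomWhiskerRight V (ρ_ a).inv _ := by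
  rw [mate_eq_id, mate_id_eq, mateOne, Category.assoc, Category.assoc, Category.assoc,
    ← wL_post_assoc, eHom_whisker_exchange]

theorem mateOne_gcomp_mate {u v : V} (f : F.obj u ⟶ a) (g : a ⊗ F.obj v ⟶ b) :
    mateOne adj f ⊚ mate adj g = mateOne adj (oplaxitor adj u v ≫ f ▷ _ ≫ g) := by
  rw [mateOne_comp, mateOne_oplaxitor, gcomp_post, ← mate_comp, Category.id_comp,
    mate_whiskerRight_comp, mateOne, gcomp_mid]

/-- Composition in terms of the oplaxitor. The universal case, with identities for `f` and `g`, is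
the defining mate of the oplaxitor whiskered by `a`; the general case follows by naturality. -/
theorem mate_gcomp_mate {u v : V} (f : a ⊗ F.obj u ⟶ b) (g : b ⊗ F.obj v ⟶ c) :
    mate adj f ⊚ mate adj g =
      mate adj (a ◁ oplaxitor adj u v ≫ (α_ _ _ _).inv ≫ f ▷ _ ≫ g) := by
  have h : mate adj (𝟙 (a ⊗ F.obj u)) ⊚ mate adj (𝟙 ((a ⊗ F.obj u) ⊗ F.obj v)) =
      mate adj (a ◁ oplaxitor adj u v ≫ (α_ _ _ _).inv) := by
    rw [mate_comp, mate_whiskerLeft, mateOne_oplaxitor, ← Category.assoc (gunit _ _ ⊚ _),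
      gcomp_comp_wL, gcomp_pre, gcomp_post, mate_comp_wL, Category.assoc, ← mate_id_eq, ← mate_comp]
    simp
  rw [← Category.assoc (α_ _ _ _).inv, ← Category.assoc, ← Category.assoc, Category.assoc _ _ g,
    mate_comp _ _ (f ▷ _ ≫ g), ← h, gcomp_post,
    ← mate_comp, Category.id_comp, mate_whiskerRight_comp, mate_eq_id adj f, gcomp_mid]

/-- The half-braiding is defined as the morphism whose mate is the unit tensored on the right.
Whiskering this definition by `a` on the left, and commuting `wL` with `wR`, settles the case of the
identity; `wR_post` gives general `f`. -/
theorem mate_comp_wR {v : V} (f : a ⊗ F.obj v ⟶ b) (c : A) :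
    mate adj f ≫ wR a b c =
      mate adj ((α_ _ _ _).hom ≫ a ◁ halfBraid adj c v ≫ (α_ _ _ _).inv ≫ f ▷ c) := by
  have h := mate_comp_wL adj a (halfBraid adj c v)
  rw [mate_halfBraid, Category.assoc, Category.assoc, ← wL_pre, reassoc_of% wR_wL' (V := V),
    ← eHomWhiskerRight_comp] at h
  have e : (α_ _ _ _).hom ≫ a ◁ halfBraid adj c v ≫ (α_ _ _ _).inv ≫ f ▷ c =
    (((α_ _ _ _).hom ≫ a ◁ halfBraid adj c v) ≫ (α_ _ _ _).inv) ≫ f ▷ c := by simp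
  rw [e, mate_comp, mate_comp, ← h, mate_eq_id, Category.assoc, ← wR_post,
    mate_id_eq, Category.assoc, Category.assoc, ← wR_pre_assoc]
  simp only [Category.assoc]
  rw [← eHom_whisker_exchange_assoc, ← eHomWhiskerLeft_comp_assoc]
  simp

/-- The counit has mate the identity element of `𝟙`, and whiskering by `a` carries it to the
identity of `a`, up to unitors. -/
theorem eId_eq_mate (a : A) : eId V a = mate adj (a ◁ opcounit adj ≫ (ρ_ a).hom) := by
  rw [mate_comp, mate_whiskerLeft, mateOne_opcounit, ← eHomEquiv_id, ← eHomEquiv_id, Category.assoc,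
    Category.assoc, reassoc_of% eHomEquiv_wL, ← eHom_whisker_exchange, ← Category.assoc (eHomEquiv V _),
    ← eHomEquiv_comp_post,
    ← eHomEquiv_comp_pre]
  simp

theorem eHomEquiv_eq_mate (f : a ⟶ b) :
    eHomEquiv V f = mate adj (a ◁ opcounit adj ≫ (ρ_ a).hom ≫ f) := by
  rw [← Category.assoc, mate_comp, ← eId_eq_mate, ← eHomEquiv_id, ← eHomEquiv_comp_post,
    Category.id_comp]

theorem halfBraid_naturality_left (k : a ⟶ b) (v : V) :
    k ▷ F.obj v ≫ halfBraid adj b v = halfBraid adj a v ≫ F.obj v ◁ k := by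
  apply mate_injective adj
  rw [mate_whiskerRight_comp, mate_comp, mate_halfBraid, mate_halfBraid, Category.assoc,
    Category.assoc, Category.assoc, Category.assoc, ← eHom_whisker_exchange, wR_exchange_assoc,
    ← eHomWhiskerRight_comp, ← eHomWhiskerRight_comp, leftUnitor_inv_naturality]

theorem halfBraid_naturality_right (a : A) (h : u' ⟶ v') :
    a ◁ F.map h ≫ halfBraid adj a v' = halfBraid adj a u' ≫ F.map h ▷ a := by
  apply mate_injective adj
  rw [mate_whiskerLeft_map_comp, mate_comp, mate_halfBraid, mate_halfBraid, Category.assoc,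
    Category.assoc, ← eHom_whisker_exchange, wR_post_assoc, ← Category.assoc h, gunit_naturality,
    Category.assoc]

/-- On mates this is `wR_wR`: tensoring with `a ⊗ b` is tensoring with `a` and then with `b`. -/
theorem halfBraid_tensor (a b : A) (v : V) :
    halfBraid adj (a ⊗ b) v = (α_ _ _ _).hom ≫ a ◁ halfBraid adj b v ≫ (α_ _ _ _).inv ≫
      halfBraid adj a v ▷ b ≫ (α_ _ _ _).hom := by
  apply mate_injective adj
  have e : (α_ _ _ _).hom ≫ a ◁ halfBraid adj b v ≫ (α_ _ _ _).inv ≫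
      halfBraid adj a v ▷ b ≫ (α_ _ _ _).hom = ((α_ _ _ _).hom ≫ a ◁ halfBraid adj b v ≫
      (α_ _ _ _).inv ≫ halfBraid adj a v ▷ b) ≫ (α_ _ _ _).hom := by simp
  rw [e, mate_comp, ← mate_comp_wR, mate_halfBraid, mate_halfBraid, Category.assoc, Category.assoc,
    Category.assoc, ← wR_pre_assoc, ← eHom_whisker_exchange,
    ← reassoc_of% wR_wR (V := V), ← eHomWhiskerRight_comp]
  simp

theorem wR_unit' (a b : A) :
    wR (V := V) a b (𝟙_ A) = eHomWhiskerRight V (ρ_ a).hom b ≫ eHomWhiskerLeft V _ (ρ_ b).inv := by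
  rw [← wR_unit, Category.assoc, ← eHomWhiskerLeft_comp]
  simp

theorem halfBraid_unit (v : V) :
    halfBraid adj (𝟙_ A) v = (λ_ _).hom ≫ (ρ_ _).inv := by
  apply mate_injective adj
  rw [mate_halfBraid, mate_eq_mateOne, mateOne, wR_unit', Iso.inv_hom_id_assoc, Category.assoc,
    eHom_whisker_exchange, ← eHomWhiskerRight_comp_assoc, ← unitors_equal, Iso.inv_hom_id]
  simp

theorem mate_halfBraid_comp {v : V} (f : F.obj v ⟶ b) (a : A) :
    mate adj (halfBraid adj a v ≫ f ▷ a) =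
      mateOne adj f ≫ wR _ _ a ≫ eHomWhiskerRight V (λ_ a).inv _ := by
  rw [mate_comp, mate_halfBraid, mateOne, Category.assoc, Category.assoc, Category.assoc,
    ← eHom_whisker_exchange, wR_post_assoc]

theorem gunit_gcomp_mate {u v : V} (g : F.obj u ⊗ F.obj v ⟶ b) :
    gunit adj u ⊚ mate adj g = mateOne adj (oplaxitor adj u v ≫ g) := by
  rw [← mateOne_id, mateOne_gcomp_mate, id_whiskerRight, Category.id_comp]

theorem oplaxitor_naturality_left {u u' : V} (f : u ⟶ u') (v : V) :
    oplaxitor adj u v ≫ F.map f ▷ F.obj v = F.map (f ▷ v) ≫ oplaxitor adj u' v := by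
  apply mateOne_injective adj
  rw [← Category.comp_id (_ ▷ F.obj v), ← mateOne_gcomp_mate, mateOne_map_comp, mateOne_oplaxitor,
    ← comp_gcomp, gunit_naturality, mateOne]

theorem oplaxitor_naturality_right (u : V) {v v' : V} (f : v ⟶ v') :
    oplaxitor adj u v ≫ F.obj u ◁ F.map f = F.map (u ◁ f) ≫ oplaxitor adj u v' := by
  apply mateOne_injective adj
  rw [← Category.comp_id (F.obj u ◁ _), ← gunit_gcomp_mate, mateOne_map_comp, mateOne_oplaxitor,
    ← gcomp_comp, mate_whiskerLeft_map_comp]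

/-- On mates the two sides are the two bracketings of one triple graded composite. -/
theorem oplaxitor_associativity (u v w : V) :
    oplaxitor adj (u ⊗ v) w ≫ oplaxitor adj u v ▷ F.obj w ≫ (α_ _ _ _).hom =
      F.map (α_ u v w).hom ≫ oplaxitor adj u (v ⊗ w) ≫ F.obj u ◁ oplaxitor adj v w := by
  apply mateOne_injective adj
  rw [← mateOne_gcomp_mate, mateOne_map_comp, ← gunit_gcomp_mate, mateOne_oplaxitor, gcomp_assoc]
  congr 2
  rw [mate_gcomp_mate]
  simp

theorem oplaxitor_left_unitality (v : V) :
    (λ_ (F.obj v)).inv =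
      F.map (λ_ v).inv ≫ oplaxitor adj (𝟙_ V) v ≫ opcounit adj ▷ F.obj v := by
  apply mateOne_injective adj
  rw [← Category.comp_id (opcounit adj ▷ _), mateOne_map_comp, ← mateOne_gcomp_mate,
    mateOne_opcounit, eId_gcomp, Iso.inv_hom_id_assoc, mate_eq_mateOne, Category.comp_id]

theorem oplaxitor_right_unitality (v : V) :
    (ρ_ (F.obj v)).inv =
      F.map (ρ_ v).inv ≫ oplaxitor adj v (𝟙_ V) ≫ F.obj v ◁ opcounit adj := by
  apply mateOne_injective adj
  have h : mate adj (F.obj v ◁ opcounit adj) = eHomEquiv V (ρ_ (F.obj v)).inv := by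
    rw [eHomEquiv_eq_mate adj]
    simp
  rw [mateOne_map_comp, ← gunit_gcomp_mate, h, gcomp_eHomEquiv, Iso.inv_hom_id_assoc, mateOne]

/-- Morphisms `𝟙_ V ⟶ 𝒜(𝟙 → b)` are at once morphisms `F 𝟙 ⟶ b` and morphisms `𝟙 ⟶ b`, so `F 𝟙 ≅ 𝟙`.
The inverse is the morphism named by the unit of the adjunction at `𝟙_ V`. -/
theorem isIso_opcounit : IsIso (opcounit adj) := by
  refine ⟨(eHomEquiv V).symm (gunit adj (𝟙_ V)), ?_, ?_⟩
  · apply mateOne_injective adj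
    rw [mateOne_comp, mateOne_opcounit, ← eHomEquiv_id, ← eHomEquiv_comp_post, Category.id_comp,
      Equiv.apply_symm_apply, mateOne_id]
  · apply (eHomEquiv V).injective
    rw [eHomEquiv_comp_post, Equiv.apply_symm_apply, eHomEquiv_id]
    exact mateOne_opcounit adj

/-- Compatibility of `wR` with composition, expressed through mates. It says that the oplaxitor is a
morphism of the center. -/
theorem halfBraid_oplaxitor (a : A) (u v : V) :
    halfBraid adj a (u ⊗ v) ≫ oplaxitor adj u v ▷ a =
      a ◁ oplaxitor adj u v ≫ (α_ _ _ _).inv ≫ halfBraid adj a u ▷ F.obj v ≫ (α_ _ _ _).hom ≫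
        F.obj u ◁ halfBraid adj a v ≫ (α_ _ _ _).inv := by
  apply mate_injective adj
  rw [mate_halfBraid_comp, ← mate_gcomp_mate, mateOne_oplaxitor, ← Category.assoc, gcomp_comp_wR,
    gcomp_pre, Category.assoc, ← mate_halfBraid, mate_comp_wR]
  simp

theorem halfBraid_opcounit (a : A) :
    halfBraid adj a (𝟙_ V) ≫ opcounit adj ▷ a = a ◁ opcounit adj ≫ (ρ_ a).hom ≫ (λ_ a).inv := by
  apply mate_injective adj
  rw [mate_halfBraid_comp, ← eHomEquiv_eq_mate, mateOne_opcounit, ← eHomEquiv_id,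
    reassoc_of% eHomEquiv_wR, ← eHomEquiv_comp_pre]
  simp

/-- Up to unitors, the unit is its own whiskering by `𝟙`. In this form, and in its mirror image
below, the exchange law applies to it. -/
theorem gunit_post_leftUnitor_inv (u : V) : gunit adj u ≫ eHomWhiskerLeft V _ (λ_ _).inv =
      (gunit adj u ≫ wL (𝟙_ A) _ _) ≫ eHomWhiskerRight V (λ_ _).inv _ := by
  rw [wL_unit', Category.assoc, Category.assoc, eHom_whisker_exchange,
    ← eHomWhiskerRight_comp_assoc]
  simp

theorem gunit_post_rightUnitor_inv (v : V) : gunit adj v ≫ eHomWhiskerLeft V _ (ρ_ _).inv =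
      (gunit adj v ≫ wR _ _ (𝟙_ A)) ≫ eHomWhiskerRight V (λ_ _).inv _ := by
  rw [wR_unit', Category.assoc, Category.assoc, eHom_whisker_exchange,
    ← eHomWhiskerRight_comp_assoc, unitors_inv_equal]
  simp

/-- Braidedness of the lift: the two sides are the mates of the two orders of tensoring the units at
`u` and `v`, which differ by the braiding according to the exchange law. -/
theorem oplaxitor_halfBraid (u v : V) :
    oplaxitor adj u v ≫ halfBraid adj (F.obj u) v =
      F.map (β_ u v).hom ≫ oplaxitor adj v u := by
  apply mateOne_injective adj
  rw [← gunit_gcomp_mate, mate_halfBraid, mateOne_map_comp, mateOne_oplaxitor, ← Category.assoc,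
    ← gcomp_mid, gunit_post_leftUnitor_inv, ← gcomp_pre, comp_wL_gcomp_comp_wR, Category.assoc,
    gcomp_pre, ← gunit_post_rightUnitor_inv, gcomp_mid,
    mate_id_eq, Category.assoc]

end Mates

/-! ### Half-braidings are invertible in the presence of right duals -/

section LaxHalfBraiding

variable {A : Type w} [Category.{v} A] [MonoidalCategory A]

/-- A monoidal natural family `e a : a ⊗ x ⟶ x ⊗ a` is invertible at the objects with a right dual. -/
theorem isIso_of_lax_halfBraiding {x : A} (e : ∀ a : A, a ⊗ x ⟶ x ⊗ a)
    (naturality : ∀ {a b : A} (k : a ⟶ b), k ▷ x ≫ e b = e a ≫ x ◁ k)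
    (tensor : ∀ a b : A, e (a ⊗ b) =
      (α_ _ _ _).hom ≫ a ◁ e b ≫ (α_ _ _ _).inv ≫ e a ▷ b ≫ (α_ _ _ _).hom)
    (unit : e (𝟙_ A) = (λ_ _).hom ≫ (ρ_ _).inv) (a : A) [HasRightDual a] : IsIso (e a) := by
  -- The inverse is the crossing with `aᘁ` bent around: create `a ⊗ aᘁ` on the left, cross `x` with
  -- `aᘁ`, and cancel `aᘁ ⊗ a` on the right. In each composite `tensor` merges the two crossings
  -- into one with `aᘁ ⊗ a` or `a ⊗ aᘁ`, naturality pulls the evaluation or coevaluation through it,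
  -- and a zigzag remains.
  refine ⟨𝟙 _ ⊗≫ η_ a aᘁ ▷ (x ⊗ a) ⊗≫ a ◁ e aᘁ ▷ a ⊗≫ (a ⊗ x) ◁ ε_ a aᘁ ⊗≫ 𝟙 _, ?_, ?_⟩
  · have z := ExactPairing.evaluation_coevaluation a aᘁ
    calc
      _ = 𝟙 _ ⊗≫ (𝟙_ A ◁ e a ≫ η_ a aᘁ ▷ (x ⊗ a)) ⊗≫ a ◁ e aᘁ ▷ a ⊗≫
          (a ⊗ x) ◁ ε_ a aᘁ ⊗≫ 𝟙 _ := by monoidal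
      _ = 𝟙 _ ⊗≫ η_ a aᘁ ▷ (a ⊗ x) ⊗≫ a ◁ ((α_ _ _ _).hom ≫ aᘁ ◁ e a ≫ (α_ _ _ _).inv ≫
          e aᘁ ▷ a ≫ (α_ _ _ _).hom) ⊗≫ a ◁ x ◁ ε_ a aᘁ ⊗≫ 𝟙 _ := by
        rw [whisker_exchange]; monoidal
      _ = 𝟙 _ ⊗≫ η_ a aᘁ ▷ (a ⊗ x) ⊗≫ a ◁ (e (aᘁ ⊗ a) ≫ x ◁ ε_ a aᘁ) ⊗≫ 𝟙 _ := by
        rw [← tensor]; monoidal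
      _ = 𝟙 _ ⊗≫ (η_ a aᘁ ▷ a ≫ (α_ _ _ _).hom ≫ a ◁ ε_ a aᘁ) ▷ x ⊗≫ 𝟙 _ := by
        rw [← naturality, unit]; monoidal
      _ = _ := by rw [z]; monoidal
  · have z := ExactPairing.evaluation_coevaluation a aᘁ
    calc
      _ = 𝟙 _ ⊗≫ η_ a aᘁ ▷ (x ⊗ a) ⊗≫ a ◁ e aᘁ ▷ a ⊗≫
          ((a ⊗ x) ◁ ε_ a aᘁ ≫ e a ▷ 𝟙_ A) ⊗≫ 𝟙 _ := by monoidal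
      _ = 𝟙 _ ⊗≫ η_ a aᘁ ▷ (x ⊗ a) ⊗≫ ((α_ _ _ _).hom ≫ a ◁ e aᘁ ≫ (α_ _ _ _).inv ≫
          e a ▷ aᘁ ≫ (α_ _ _ _).hom) ▷ a ⊗≫ (x ⊗ a) ◁ ε_ a aᘁ ⊗≫ 𝟙 _ := by
        rw [whisker_exchange]; monoidal
      _ = 𝟙 _ ⊗≫ (η_ a aᘁ ▷ x ≫ e (a ⊗ aᘁ)) ▷ a ⊗≫ (x ⊗ a) ◁ ε_ a aᘁ ⊗≫ 𝟙 _ := by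
        rw [← tensor]; monoidal
      _ = 𝟙 _ ⊗≫ x ◁ (η_ a aᘁ ▷ a ≫ (α_ _ _ _).hom ≫ a ◁ ε_ a aᘁ) ⊗≫ 𝟙 _ := by
        rw [naturality, unit]; monoidal
      _ = _ := by rw [z]; monoidal

end LaxHalfBraiding

end BraidedEnriched

namespace BraidedEnriched

/-! ### `V`-functor structures on a lax monoidal functor versus comparison maps -/

section LaxEnrichment

open WhiskerEnriched Functor.LaxMonoidal

variable {V : Type u} [Category.{v} V] [MonoidalCategory V] [BraidedCategory V]
  {A : Type w} [Category.{v} A] [MonoidalCategory A] [EnrichedOrdinaryCategory V A]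
  [WhiskerEnriched V A] {B : Type w} [Category.{v} B] [MonoidalCategory B]
  [EnrichedOrdinaryCategory V B] [WhiskerEnriched V B]

variable (V) in
/-- An enrichment of a lax monoidal functor `R`, compatible with the laxitors of `R`. -/
structure LaxEnrichment (R : A ⥤ B) [R.LaxMonoidal] where
  vm (a b : A) : (a ⟶[V] b) ⟶ (R.obj a ⟶[V] R.obj b)
  eHomEquiv_vm {a b : A} (f : a ⟶ b) : eHomEquiv V f ≫ vm a b = eHomEquiv V (R.map f)
  eComp_vm (a b c : A) : eComp V a b c ≫ vm a c = vm a b ⊚ vm b c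
  wL_μ (c a b : A) : vm a b ≫ wL (R.obj c) _ _ ≫ eHomWhiskerLeft V _ (μ R c b) =
    wL c a b ≫ vm _ _ ≫ eHomWhiskerRight V (μ R c a) _
  wR_μ (a b c : A) : vm a b ≫ wR _ _ (R.obj c) ≫ eHomWhiskerLeft V _ (μ R b c) =
    wR a b c ≫ vm _ _ ≫ eHomWhiskerRight V (μ R a c) _

variable {R S : A ⥤ B} [R.LaxMonoidal] [S.LaxMonoidal] {a b c : A} {u v : V}

namespace LaxEnrichment

section

variable (E : LaxEnrichment V R)

theorem gcomp_comp_vm (f : u ⟶ (a ⟶[V] b)) (g : v ⟶ (b ⟶[V] c)) :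
    (f ⊚ g) ≫ E.vm a c = (f ≫ E.vm a b) ⊚ (g ≫ E.vm b c) := by
  rw [gcomp, Category.assoc, E.eComp_vm, comp_gcomp_comp]

/-- Naturality of the laxitor in both variables at once, assembled from its naturality in each
variable. This is the form required of a 1-cell. -/
theorem gcomp_comp_vm_pre_μ (a b c d : A) :
    (wR a c b ⊚ wL c b d) ≫ E.vm _ _ ≫ eHomWhiskerRight V (μ R a b) _ =
      (E.vm a c ≫ wR _ _ _) ⊚ (E.vm b d ≫ wL _ _ _) ≫ eHomWhiskerLeft V _ (μ R c d) := by
  rw [← Category.assoc, gcomp_comp_vm, gcomp_pre, Category.assoc, ← E.wR_μ, ← Category.assoc,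
    gcomp_mid, Category.assoc, ← E.wL_μ, ← Category.assoc, gcomp_post, Category.assoc]

theorem vm_post (a : A) (g : b ⟶ c) :
    E.vm a b ≫ eHomWhiskerLeft V _ (R.map g) = eHomWhiskerLeft V a g ≫ E.vm a c := by
  rw [← Category.id_comp (eHomWhiskerLeft V a g), comp_eHomWhiskerLeft, comp_eHomWhiskerLeft,
    Category.assoc, gcomp_comp_vm, eHomEquiv_vm, Category.id_comp]

theorem vm_post_assoc (a : A) (g : b ⟶ c) {z : V} (k' : _ ⟶ z) :
    E.vm a b ≫ eHomWhiskerLeft V _ (R.map g) ≫ k' =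
      eHomWhiskerLeft V a g ≫ E.vm a c ≫ k' :=
  (reassoc_of% E.vm_post a g) k'

theorem vm_pre (g : c ⟶ a) (b : A) :
    E.vm a b ≫ eHomWhiskerRight V (R.map g) _ = eHomWhiskerRight V g b ≫ E.vm c b := by
  rw [← Category.id_comp (eHomWhiskerRight V g b), comp_eHomWhiskerRight, comp_eHomWhiskerRight,
    Category.assoc, gcomp_comp_vm, eHomEquiv_vm, Category.id_comp]

theorem vm_pre_assoc (g : c ⟶ a) (b : A) {z : V} (k' : _ ⟶ z) :
    E.vm a b ≫ eHomWhiskerRight V (R.map g) _ ≫ k' =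
      eHomWhiskerRight V g b ≫ E.vm c b ≫ k' :=
  (reassoc_of% E.vm_pre g b) k'

end

variable {F : V ⥤ A} {G : V ⥤ B} (adjA : F ⊣ eCoyoneda V (𝟙_ A)) (adjB : G ⊣ eCoyoneda V (𝟙_ B))

/-- The transformation `G v ⟶ R (F v)` induced by an enrichment of `R`. -/
def comparison (E : LaxEnrichment V R) (v : V) : G.obj v ⟶ R.obj (F.obj v) :=
  unmateOne adjB (gunit adjA v ≫ E.vm _ _ ≫ eHomWhiskerRight V (ε R) _)

section

variable (E : LaxEnrichment V R)

theorem mateOne_comparison (v : V) : mateOne adjB (E.comparison adjA adjB v) =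
    gunit adjA v ≫ E.vm _ _ ≫ eHomWhiskerRight V (ε R) _ :=
  mateOne_unmateOne _ _

theorem mateOne_comparison_comp (f : F.obj v ⟶ b) :
    mateOne adjB (E.comparison adjA adjB v ≫ R.map f) =
      mateOne adjA f ≫ E.vm _ _ ≫ eHomWhiskerRight V (ε R) _ := by
  rw [mateOne_comp, mateOne_comparison, Category.assoc, Category.assoc, ← eHom_whisker_exchange,
    vm_post_assoc, mateOne, Category.assoc]

variable [LeftRigidCategory A] [LeftRigidCategory B]

/-- The action on hom-objects is determined by the comparison, since every graded morphism is a
mate. The proof moves `wL` across `vm` by `wL_μ` and absorbs the unit of `R` by the lax unit law. -/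
theorem mate_comp_vm (f : a ⊗ F.obj v ⟶ b) :
    mate adjA f ≫ E.vm a b =
      mate adjB (R.obj a ◁ E.comparison adjA adjB v ≫ μ R a _ ≫ R.map f) := by
  have h : (ρ_ (R.obj a)).inv ≫ R.obj a ◁ ε R ≫ μ R a _ = R.map (ρ_ a).inv := by simp
  rw [mate_comp, mate_whiskerLeft, mateOne_comparison, Category.assoc, Category.assoc,
    Category.assoc, eHomWhiskerLeft_comp, Category.assoc, ← wL_pre_assoc,
    ← eHomWhiskerRight_comp_assoc, ← eHom_whisker_exchange_assoc, reassoc_of% E.wL_μ,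
    ← eHomWhiskerRight_comp_assoc, Category.assoc, h, vm_pre_assoc, vm_post, mate]
  simp only [Category.assoc]

theorem comparison_naturality (f : u ⟶ v) :
    G.map f ≫ E.comparison adjA adjB v = E.comparison adjA adjB u ≫ R.map (F.map f) := by
  apply mateOne_injective adjB
  rw [mateOne_map_comp, mateOne_comparison, mateOne_comparison_comp, ← Category.assoc,
    gunit_naturality, mateOne]

theorem comparison_unit :
    E.comparison adjA adjB (𝟙_ V) ≫ R.map (opcounit adjA) = opcounit adjB ≫ ε R := by
  apply mateOne_injective adjB
  rw [mateOne_comparison_comp, mateOne_comp, mateOne_opcounit, mateOne_opcounit, ← eHomEquiv_id,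
    ← eHomEquiv_id, reassoc_of% E.eHomEquiv_vm, ← eHomEquiv_comp_post, ← eHomEquiv_comp_pre]
  simp

/-- On mates, this is `wR_μ` applied to the unit of the adjunction. -/
theorem comparison_halfBraid (a : A) (v : V) :
    halfBraid adjB (R.obj a) v ≫ E.comparison adjA adjB v ▷ R.obj a ≫ μ R _ a =
      R.obj a ◁ E.comparison adjA adjB v ≫ μ R a _ ≫ R.map (halfBraid adjA a v) := by
  apply mate_injective adjB
  have h : (λ_ (R.obj a)).inv ≫ ε R ▷ R.obj a ≫ μ R _ a = R.map (λ_ a).inv := by simp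
  rw [← mate_comp_vm, mate_halfBraid, ← Category.assoc, mate_comp, mate_halfBraid_comp,
    mateOne_comparison, Category.assoc, Category.assoc, Category.assoc, Category.assoc,
    ← wR_pre_assoc,
    ← eHomWhiskerRight_comp_assoc, ← eHom_whisker_exchange, reassoc_of% E.wR_μ,
    ← eHomWhiskerRight_comp, Category.assoc, h, vm_pre]
  simp only [Category.assoc]

/-- On mates, this says that `vm` preserves the graded composite defining the oplaxitor. -/
theorem comparison_oplaxitor (u v : V) :
    E.comparison adjA adjB (u ⊗ v) ≫ R.map (oplaxitor adjA u v) =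
      oplaxitor adjB u v ≫ (E.comparison adjA adjB u ⊗ₘ E.comparison adjA adjB v) ≫ μ R _ _ := by
  apply mateOne_injective adjB
  rw [mateOne_comparison_comp, mateOne_oplaxitor, ← Category.assoc, gcomp_comp_vm, gcomp_pre,
    Category.assoc, ← mateOne_comparison adjA adjB, mate_comp_vm adjA adjB, mateOne_gcomp_mate]
  simp [MonoidalCategory.tensorHom_def]

/-- The naturality square from `𝟙` to `F v`, evaluated at the unit of the adjunction; unitality of
`Θ` removes its component at `𝟙`. -/
theorem comparison_of_vnatural (E' : LaxEnrichment V S) (Θ : R ⟶ S) [NatTrans.IsMonoidal Θ]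
    (h : ∀ a b, E.vm a b ≫ eHomWhiskerLeft V _ (Θ.app b) =
      E'.vm a b ≫ eHomWhiskerRight V (Θ.app a) _) (v : V) :
    E.comparison adjA adjB v ≫ Θ.app (F.obj v) = E'.comparison adjA adjB v := by
  apply mateOne_injective adjB
  rw [mateOne_comp, mateOne_comparison, mateOne_comparison, Category.assoc, Category.assoc,
    ← eHom_whisker_exchange, reassoc_of% h, ← eHomWhiskerRight_comp, NatTrans.IsMonoidal.unit]

/-- It suffices to test on the identity of the hom-object, which is the mate of an evaluation map.
There `mate_comp_vm` makes both sides explicit, and monoidality of `Θ` moves it past the laxitor. -/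
theorem vnatural_of_comparison (E' : LaxEnrichment V S) (Θ : R ⟶ S) [NatTrans.IsMonoidal Θ]
    (h : ∀ v, E.comparison adjA adjB v ≫ Θ.app (F.obj v) = E'.comparison adjA adjB v) (a b : A) :
    E.vm a b ≫ eHomWhiskerLeft V _ (Θ.app b) = E'.vm a b ≫ eHomWhiskerRight V (Θ.app a) _ := by
  rw [← Category.id_comp (E.vm a b), ← Category.id_comp (E'.vm a b),
    ← mate_unmate adjA (𝟙 (a ⟶[V] b)), mate_comp_vm adjA adjB, mate_comp_vm adjA adjB,
    ← mate_whiskerRight_comp, ← mate_comp, ← h]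
  simp only [Category.assoc, Θ.naturality, NatTrans.IsMonoidal.tensor_assoc]
  simp [MonoidalCategory.tensorHom_def, whisker_exchange_assoc]

end

section OfComparison

variable [LeftRigidCategory A] [LeftRigidCategory B]
  (r : ∀ v, G.obj v ⟶ R.obj (F.obj v))

/-- The action on hom-objects determined by a transformation `G v ⟶ R (F v)`. -/
noncomputable def vmOf (a b : A) : (a ⟶[V] b) ⟶ (R.obj a ⟶[V] R.obj b) :=
  mate adjB (R.obj a ◁ r _ ≫ μ R a _ ≫ R.map (unmate adjA (𝟙 (a ⟶[V] b))))

variable {r} (r_natural : ∀ {u v : V} (f : u ⟶ v), G.map f ≫ r v = r u ≫ R.map (F.map f))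

theorem mate_comp_vmOf (r_natural : ∀ {u v : V} (f : u ⟶ v),
      G.map f ≫ r v = r u ≫ R.map (F.map f)) (f : a ⊗ F.obj v ⟶ b) :
    mate adjA f ≫ vmOf adjA adjB r a b = mate adjB (R.obj a ◁ r v ≫ μ R a _ ≫ R.map f) := by
  -- Yoneda: every `f` factors through the universal evaluation `unmate adjA (𝟙 _)`, from which
  -- `vmOf` was defined.
  have h : f = a ◁ F.map (mate adjA f) ≫ unmate adjA (𝟙 (a ⟶[V] b)) := by
    apply mate_injective adjA
    rw [mate_whiskerLeft_map_comp, mate_unmate, Category.comp_id]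
  conv_rhs => rw [h]
  rw [vmOf, ← mate_whiskerLeft_map_comp, ← MonoidalCategory.whiskerLeft_comp_assoc, r_natural]
  simp

/-- The enrichment of `R` determined by a transformation `G v ⟶ R (F v)` with the coherence
conditions of a 1-cell. -/
noncomputable def ofComparison (r_unit : r (𝟙_ V) ≫ R.map (opcounit adjA) = opcounit adjB ≫ ε R)
    (r_halfBraid : ∀ (a : A) (v : V), halfBraid adjB (R.obj a) v ≫ r v ▷ R.obj a ≫ μ R _ a =
      R.obj a ◁ r v ≫ μ R a _ ≫ R.map (halfBraid adjA a v))
    (r_oplaxitor : ∀ u v : V, r (u ⊗ v) ≫ R.map (oplaxitor adjA u v) =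
      oplaxitor adjB u v ≫ (r u ⊗ₘ r v) ≫ μ R _ _) : LaxEnrichment V R where
  vm := vmOf adjA adjB r
  eHomEquiv_vm {a b} f := by
    rw [eHomEquiv_eq_mate adjA, eHomEquiv_eq_mate adjB, mate_comp_vmOf adjA adjB r_natural]
    simp only [Functor.map_comp, ← μ_natural_right_assoc,
      ← MonoidalCategory.whiskerLeft_comp_assoc, r_unit]
    simp
  eComp_vm a b c := by
    -- Both identities of hom-objects are written as mates of evaluations, which turns the claim
    -- into an equation in `B`; there `r_oplaxitor` is the input.
    rw [eComp_eq_gcomp, ← Category.id_comp (vmOf adjA adjB r a b),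
      ← Category.id_comp (vmOf adjA adjB r b c), ← mate_unmate adjA (𝟙 (a ⟶[V] b)),
      ← mate_unmate adjA (𝟙 (b ⟶[V] c)), mate_gcomp_mate, mate_comp_vmOf adjA adjB r_natural,
      mate_comp_vmOf adjA adjB r_natural, mate_comp_vmOf adjA adjB r_natural, mate_gcomp_mate]
    simp only [Functor.map_comp, ← μ_natural_right_assoc,
      ← MonoidalCategory.whiskerLeft_comp_assoc, r_oplaxitor]
    simp [MonoidalCategory.tensorHom_def]
    rw [← whisker_exchange_assoc, ← whisker_exchange_assoc, μ_natural_left_assoc]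
    simp
  wL_μ c a b := by
    rw [← Category.id_comp (vmOf adjA adjB r a b), ← Category.assoc (wL c a b),
      ← Category.id_comp (wL c a b), ← mate_unmate adjA (𝟙 (a ⟶[V] b)), mate_comp_wL,
      mate_comp_vmOf adjA adjB r_natural,
      mate_comp_vmOf adjA adjB r_natural, ← mate_whiskerRight_comp, ← Category.assoc,
      mate_comp_wL, ← mate_comp]
    simp
    -- Left whiskering involves no half-braiding, so associativity of the laxitor suffices here.
    rw [← whisker_exchange_assoc, associativity_assoc]
    simp
  wR_μ a b c := by
    rw [← Category.id_comp (vmOf adjA adjB r a b), ← Category.assoc (wR a b c),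
      ← Category.id_comp (wR a b c), ← mate_unmate adjA (𝟙 (a ⟶[V] b)), mate_comp_wR,
      mate_comp_vmOf adjA adjB r_natural,
      mate_comp_vmOf adjA adjB r_natural, ← mate_whiskerRight_comp, ← Category.assoc,
      mate_comp_wR, ← mate_comp]
    simp
    -- Right whiskering moves `c` past `F v` in `A` and `R c` past `G v` in `B`; `r_halfBraid`
    -- reconciles the two crossings.
    have h := congrArg (R.obj a ◁ ·) (r_halfBraid c (a ⟶[V] b))
    simp only [MonoidalCategory.whiskerLeft_comp] at h
    rw [← whisker_exchange_assoc, associativity_assoc, ← μ_natural_right_assoc,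
      ← associativity_inv_assoc, reassoc_of% h]
    simp

/-- The unit of the adjunction is the mate of the left unitor, so the formula for `vmOf` at `𝟙`
returns `r` by left unitality of the laxitor. -/
theorem comparison_ofComparison (r_unit r_halfBraid r_oplaxitor) (v : V) :
    (ofComparison adjA adjB r_natural r_unit r_halfBraid r_oplaxitor).comparison adjA adjB v =
      r v := by
  apply mateOne_injective adjB
  have h : gunit adjA v = mate adjA (λ_ _).hom := by
    rw [mate_eq_mateOne, Iso.inv_hom_id, mateOne_id]
  rw [mateOne_comparison, h, ← Category.assoc]
  change (_ ≫ vmOf adjA adjB r _ _) ≫ _ = _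
  rw [mate_comp_vmOf adjA adjB r_natural, ← mate_whiskerRight_comp, mate_eq_mateOne]
  congr 1
  rw [← whisker_exchange_assoc, ← left_unitality]
  simp

end OfComparison

end LaxEnrichment

end LaxEnrichment

end BraidedEnriched

/-! ### The lift of the left adjoint to the Drinfeld center -/

namespace BraidedEnriched

/-- The inverse braiding is the one whose components are the half-braidings `a ⊗ x ⟶ x ⊗ a`. -/
theorem center_braiding_inv_f {A : Type w} [Category.{v} A] [MonoidalCategory A] (X Y : Center A) :
    Center.Hom.f (β_ X Y).inv = (X.2.β Y.1).inv := by
  have h : (X.2.β Y.1).hom ≫ Center.Hom.f (β_ X Y).inv = 𝟙 _ :=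
    congrArg Center.Hom.f (β_ X Y).hom_inv_id
  exact (Iso.eq_inv_comp _).2 h |>.trans (Category.comp_id _)

section CentralFunctor

open WhiskerEnriched

variable {V : Type u} [Category.{v} V] [MonoidalCategory V] [BraidedCategory V]
  {A : Type w} [Category.{v} A] [MonoidalCategory A] [EnrichedOrdinaryCategory V A]
  [WhiskerEnriched V A] {F : V ⥤ A} (adj : F ⊣ eCoyoneda V (𝟙_ A)) [RigidCategory A]

/-- Right duals enter here: a family of maps obtained only from mates becomes an actual
half-braiding. -/
instance (a : A) (v : V) : IsIso (halfBraid adj a v) :=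
  isIso_of_lax_halfBraiding (fun a => halfBraid adj a v)
    (fun k => halfBraid_naturality_left adj k v) (fun a b => halfBraid_tensor adj a b v)
    (halfBraid_unit adj v) a

/-- The half-braiding on `F v`. -/
noncomputable def centralHalfBraiding (v : V) : HalfBraiding (F.obj v) where
  β a := (asIso (halfBraid adj a v)).symm
  monoidal a b := by
    rw [← cancel_epi (asIso (halfBraid adj (a ⊗ b) v)).hom, Iso.symm_hom, Iso.hom_inv_id,
      asIso_hom, halfBraid_tensor]
    simp
  naturality f := by
    simp only [Iso.symm_hom, asIso_inv, IsIso.eq_inv_comp, ← Category.assoc, IsIso.comp_inv_eq]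
    exact (halfBraid_naturality_left adj f v).symm

theorem centralHalfBraiding_comm {u v : V} (f : u ⟶ v) (a : A) :
    F.map f ▷ a ≫ ((centralHalfBraiding adj v).β a).hom =
      ((centralHalfBraiding adj u).β a).hom ≫ a ◁ F.map f := by
  simp only [centralHalfBraiding, Iso.symm_hom, asIso_inv, IsIso.eq_inv_comp, ← Category.assoc,
    IsIso.comp_inv_eq]
  exact (halfBraid_naturality_right adj a f).symm

/-- The lift of `F` to the center. -/
noncomputable abbrev centralFunctor : V ⥤ Center A :=
  liftCenter F (centralHalfBraiding adj) (centralHalfBraiding_comm adj)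

/-- The counit of the lift of `F` to the center. -/
noncomputable def centralCounit : (centralFunctor adj).obj (𝟙_ V) ⟶ 𝟙_ (Center A) where
  f := opcounit adj
  comm a := by
    have h := halfBraid_opcounit adj a
    have h' : opcounit adj ▷ a ≫ (λ_ a).hom ≫ (ρ_ a).inv =
        inv (halfBraid adj a _) ≫ a ◁ opcounit adj := by
      rw [IsIso.eq_inv_comp, reassoc_of% h]
      simp
    exact h'

/-- The oplaxitor of the lift of `F` to the center. -/
noncomputable def centralOplaxitor (u v : V) : (centralFunctor adj).obj (u ⊗ v) ⟶
    (centralFunctor adj).obj u ⊗ (centralFunctor adj).obj v where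
  f := oplaxitor adj u v
  comm a := by
    have h := halfBraid_oplaxitor adj a u v
    have h' : oplaxitor adj u v ▷ a ≫ (α_ _ _ _).hom ≫ F.obj u ◁ inv (halfBraid adj a v) ≫
        (α_ _ _ _).inv ≫ inv (halfBraid adj a u) ▷ F.obj v ≫ (α_ _ _ _).hom =
          inv (halfBraid adj a _) ≫ a ◁ oplaxitor adj u v := by
      rw [IsIso.eq_inv_comp, reassoc_of% h]
      simp
    exact h'

noncomputable instance : (centralFunctor adj).OplaxMonoidal where
  η := centralCounit adj
  δ := centralOplaxitor adj
  δ_natural_left f v := Center.ext _ _ (oplaxitor_naturality_left adj f v)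
  δ_natural_right u f := Center.ext _ _ (oplaxitor_naturality_right adj u f)
  oplax_associativity u v w := Center.ext _ _ (oplaxitor_associativity adj u v w)
  oplax_left_unitality v := by
    refine Center.ext _ _ ?_
    rw [Center.leftUnitor_inv_f]
    exact oplaxitor_left_unitality adj v
  oplax_right_unitality v := by
    refine Center.ext _ _ ?_
    rw [Center.rightUnitor_inv_f]
    exact oplaxitor_right_unitality adj v

end CentralFunctor

namespace VMonCat

open WhiskerEnriched

variable {V : Type u} [Category.{v} V] [MonoidalCategory V] [BraidedCategory V]

noncomputable instance (𝒜 : VMonCat.{w} V) : RigidCategory 𝒜.Und := 𝒜.rigid.some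

/-- The lift to the center of a left adjoint of `x ↦ 𝒜(𝟙 → x)`. -/
noncomputable def centralLift (𝒜 : VMonCat.{w} V) {F : V ⥤ 𝒜.Und} (adj : F ⊣ 𝒜.trace) :
    CentralLift adj where
  halfBraiding := centralHalfBraiding adj
  halfBraiding_mate a v := by
    have h := mate_halfBraid adj a v
    have h₁ : gunit adj v ≫ wR _ _ a = (ρ_ v).inv ≫ gtens (gunit adj v) (eId V a) :=
      comp_tensWR _
    have h₂ : gunit adj v ≫ wL a _ _ = (λ_ v).inv ≫ gtens (eId V a) (gunit adj v) :=
      comp_tensWL _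
    rw [reassoc_of% h₁, mate, reassoc_of% h₂] at h
    simp only [gtens, Category.assoc] at h
    exact h
  comm := centralHalfBraiding_comm adj
  oplax := inferInstanceAs (centralFunctor adj).OplaxMonoidal
  η_mate := mateOne_opcounit adj
  δ_mate u v := by
    have h := mateOne_oplaxitor adj u v
    have h₁ := gtens_eq (gunit adj u) (gunit adj v)
    -- The unitor is moved onto the unit at `u`, which becomes a right whiskering by `𝟙`. The
    -- composite is then `wR` followed by `wL`, which `gtens_eq` identifies with `tens`.
    rw [mateOne, mate_id_eq, ← Category.assoc (gunit adj v), ← gcomp_mid,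
      gunit_post_rightUnitor_inv, ← gcomp_pre] at h
    refine h.trans ?_
    refine (congrArg (· ≫ _) h₁.symm).trans ?_
    simp only [gtens, Category.assoc]
    rfl
  isIso_η := by
    have : IsIso (Center.Hom.f (centralCounit adj)) := isIso_opcounit adj
    exact Center.isIso_of_f_isIso (centralCounit adj)
  braided u v := Center.ext _ _ <| by
    rw [Center.comp_f, center_braiding_inv_f]
    exact oplaxitor_halfBraid adj u v

end VMonCat

end BraidedEnriched

/-! ### The strict 2-functor -/

namespace BraidedEnriched

open WhiskerEnriched

variable {V : Type u} [Category.{v} V] [MonoidalCategory V] [BraidedCategory V]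

/-- Strict preservation of identities and composites needs equalities of functors. Objects agree by
definition, so only morphisms have to be compared. -/
theorem forget_id (C : Type w) [EnrichedCategory V C] :
    (EnrichedFunctor.id V C).forget = 𝟭 (ForgetEnrichment V C) :=
  CategoryTheory.Functor.hext (fun _ => rfl) fun _ _ f => heq_of_eq (forget_id_map f)

theorem forget_comp {C D E : Type w} [EnrichedCategory V C] [EnrichedCategory V D]
    [EnrichedCategory V E] (R : EnrichedFunctor V C D) (S : EnrichedFunctor V D E) :
    (R.comp V S).forget = R.forget ⋙ S.forget :=
  CategoryTheory.Functor.hext (fun _ => rfl) fun _ _ f => heq_of_eq (forget_comp_map R S f)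

namespace VMonCat

variable {𝒜 ℬ : VMonCat.{w} V}

theorem wL_eq (c a b : 𝒜.Und) : wL (V := V) c a b = tensWL V c a b := rfl

theorem wR_eq (a b c : 𝒜.Und) : wR (V := V) a b c = tensWR V a b c := rfl

/-- The enrichment of the underlying lax monoidal functor of a 1-cell. -/
def OneCell.enrichment (R : OneCell 𝒜 ℬ) :
    letI := R.lax
    LaxEnrichment V R.functor.forget :=
  letI := R.lax
  { vm := vmap R.functor
    eHomEquiv_vm := fun f => (eHomEquiv_forget_map R.functor f).symm
    eComp_vm := fun a b c => eComp_vmap R.functor a b c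
    wL_μ := fun c a b => by
      -- Naturality of the laxitor in both variables, specialized to an identity element in one of
      -- them.
      have h : eId V c ≫ vmap R.functor c c = eId V (R.functor.forget.obj c) := R.functor.map_id c
      have h' : vmap R.functor a b ≫ tensWL V (R.functor.forget.obj c) _ _ ≫
          eHomWhiskerLeft V _ (R.μ c b) =
          tensWL V c a b ≫ vmap R.functor _ _ ≫ eHomWhiskerRight V (R.μ c a) _ := by
        rw [tensWL, tensWL, Category.assoc, Category.assoc, Category.assoc, Category.assoc,
          R.μ_vnatural, MonoidalCategory.tensorHom_def_assoc, ← comp_whiskerRight_assoc, h,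
          ← whisker_exchange_assoc, leftUnitor_inv_naturality_assoc]
      exact h'
    wR_μ := fun a b c => by
      have h : eId V c ≫ vmap R.functor c c = eId V (R.functor.forget.obj c) := R.functor.map_id c
      have h' : vmap R.functor a b ≫ tensWR V _ _ (R.functor.forget.obj c) ≫
          eHomWhiskerLeft V _ (R.μ b c) =
          tensWR V a b c ≫ vmap R.functor _ _ ≫ eHomWhiskerRight V (R.μ a c) _ := by
        rw [tensWR, tensWR, Category.assoc, Category.assoc, Category.assoc, Category.assoc,
          R.μ_vnatural, MonoidalCategory.tensorHom_def'_assoc,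
          ← MonoidalCategory.whiskerLeft_comp_assoc, h, whisker_exchange_assoc,
          rightUnitor_inv_naturality_assoc]
      exact h' }

/-- The `V`-functor given by an enrichment of a lax monoidal functor. -/
def enrichedFunctor {R : 𝒜.Und ⥤ ℬ.Und} [R.LaxMonoidal] (E : LaxEnrichment V R) :
    EnrichedFunctor V 𝒜.carrier ℬ.carrier where
  obj := R.obj
  map := E.vm
  map_id a := by
    have := E.eHomEquiv_vm (𝟙 (ForgetEnrichment.of V a))
    rwa [CategoryTheory.Functor.map_id, eHomEquiv_id, eHomEquiv_id] at this
  map_comp a b c := E.eComp_vm a b c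

theorem enrichedFunctor_forget_map {R : 𝒜.Und ⥤ ℬ.Und} [R.LaxMonoidal] (E : LaxEnrichment V R)
    {a b : 𝒜.Und} (f : a ⟶ b) : (enrichedFunctor E).forget.map f = R.map f :=
  (eHomEquiv V).injective (E.eHomEquiv_vm f)

/-- The 1-cell given by an enrichment of a strictly unital lax monoidal functor. -/
def OneCell.ofEnrichment {R : 𝒜.Und ⥤ ℬ.Und} [R.LaxMonoidal] (E : LaxEnrichment V R)
    (h : 𝟙_ ℬ.Und = R.obj (𝟙_ 𝒜.Und)) (hε : Functor.LaxMonoidal.ε R = eqToHom h) :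
    OneCell 𝒜 ℬ where
  functor := enrichedFunctor E
  μ := Functor.LaxMonoidal.μ R
  unit_eq := h
  μ_vnatural a b c d := by
    have h₁ := gtens_eq (𝟙 (a ⟶[V] c)) (𝟙 (b ⟶[V] d))
    have h₂ := gtens_eq (E.vm a c) (E.vm b d)
    have h₃ := E.gcomp_comp_vm_pre_μ a b c d
    rw [gtens, id_tensorHom_id, Category.id_comp, Category.id_comp, Category.id_comp] at h₁
    rw [wR_eq, wL_eq, wR_eq, wL_eq, ← h₁, ← h₂, gtens, Category.assoc] at h₃
    exact h₃
  associativity a b c := by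
    rw [enrichedFunctor_forget_map]
    exact Functor.LaxMonoidal.associativity R a b c
  left_unitality a := by
    rw [enrichedFunctor_forget_map]
    refine (Functor.LaxMonoidal.left_unitality R a).trans ?_
    rw [hε]
    rfl
  right_unitality a := by
    rw [enrichedFunctor_forget_map]
    refine (Functor.LaxMonoidal.right_unitality R a).trans ?_
    rw [hε]
    rfl

end VMonCat

section

variable {F : ∀ 𝒜 : VMonCat.{w} V, V ⥤ 𝒜.Und} {adj : ∀ 𝒜, F 𝒜 ⊣ 𝒜.trace}

/-- The prescribed `r` is by definition the comparison of `VMonCat.OneCell.enrichment`, so its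
coherence laws are those already proved for comparisons. -/
theorem isOneCell_preOneCell {𝒜 ℬ : VMonCat.{w} V} (R : 𝒜 ⟶ ℬ) :
    (preOneCell (fun 𝒜 => 𝒜.centralLift (adj 𝒜)) R).IsOneCell :=
  letI := VMonCat.OneCell.lax R
  { strictly_unital := ⟨VMonCat.OneCell.unit_eq R, rfl⟩
    r_natural := fun f =>
      (VMonCat.OneCell.enrichment R).comparison_naturality (adj 𝒜) (adj ℬ) f
    r_unit := (VMonCat.OneCell.enrichment R).comparison_unit (adj 𝒜) (adj ℬ)
    half_braiding_coherence := fun a v =>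
      (VMonCat.OneCell.enrichment R).comparison_halfBraid (adj 𝒜) (adj ℬ) a v
    action_coherence := fun u v =>
      (VMonCat.OneCell.enrichment R).comparison_oplaxitor (adj 𝒜) (adj ℬ) u v }

theorem isTwoCell_toNatTrans {𝒜 ℬ : VMonCat.{w} V} {R S : 𝒜 ⟶ ℬ} (θ : R ⟶ S) :
    NatTrans.IsMonoidal
        (F₁ := (preOneCell (fun 𝒜 => 𝒜.centralLift (adj 𝒜)) R).functor)
        (F₂ := (preOneCell (fun 𝒜 => 𝒜.centralLift (adj 𝒜)) S).functor)
        (VMonCat.TwoCell.toNatTrans θ) ∧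
      ∀ v, (preOneCell (fun 𝒜 => 𝒜.centralLift (adj 𝒜)) R).r v ≫
          VMonCat.TwoCell.app θ ((F 𝒜).obj v) =
        (preOneCell (fun 𝒜 => 𝒜.centralLift (adj 𝒜)) S).r v := by
  let := VMonCat.OneCell.lax R
  let := VMonCat.OneCell.lax S
  have : NatTrans.IsMonoidal (VMonCat.TwoCell.toNatTrans θ) :=
    ⟨VMonCat.TwoCell.unit θ, fun a b => VMonCat.TwoCell.tensor θ a b⟩
  exact ⟨this, (VMonCat.OneCell.enrichment R).comparison_of_vnatural (adj 𝒜) (adj ℬ)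
    (VMonCat.OneCell.enrichment S) (VMonCat.TwoCell.toNatTrans θ) (VMonCat.TwoCell.vnatural θ)⟩

/-- The prelax functor given by underlying categories, functors and transformations. -/
noncomputable def underlyingPrelaxFunctor (adj : ∀ 𝒜 : VMonCat.{w} V, F 𝒜 ⊣ 𝒜.trace) :
    PrelaxFunctor (VMonCat.{w} V) (VModTens.{w} V) where
  toPrelaxFunctorStruct := underlyingData (fun 𝒜 => 𝒜.centralLift (adj 𝒜)) isOneCell_preOneCell
    isTwoCell_toNatTrans
  map₂_id _ := rfl
  map₂_comp _ _ := rfl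

theorem PreOneCell_ext {X Y : VModTens.{w} V} {R S : VModTens.PreOneCell X Y}
    (h : R.functor = S.functor) (hε : HEq (Functor.LaxMonoidal.ε R.functor)
      (Functor.LaxMonoidal.ε S.functor))
    (hμ : ∀ a b, HEq (Functor.LaxMonoidal.μ R.functor a b) (Functor.LaxMonoidal.μ S.functor a b))
    (hr : ∀ v, HEq (R.r v) (S.r v)) : R = S := by
  obtain ⟨R, r⟩ := R
  obtain ⟨S, r'⟩ := S
  obtain rfl : R = S := h
  exact VModTens.OneCell.preext _ _ (eq_of_heq hε) (fun a b => eq_of_heq (hμ a b))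
    fun v => eq_of_heq (hr v)

/-- The unit maps need no hypothesis: strict unitality forces both to be transports along equalities
of objects. -/
theorem OneCell_ext {X Y : VModTens.{w} V} {R S : X ⟶ Y}
    (h : (VModTens.OneCell.toPreOneCell R).functor = (VModTens.OneCell.toPreOneCell S).functor)
    (hμ : ∀ a b, HEq (Functor.LaxMonoidal.μ (VModTens.OneCell.toPreOneCell R).functor a b)
      (Functor.LaxMonoidal.μ (VModTens.OneCell.toPreOneCell S).functor a b))
    (hr : ∀ v, HEq ((VModTens.OneCell.toPreOneCell R).r v)
      ((VModTens.OneCell.toPreOneCell S).r v)) : R = S := by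
  refine VModTens.OneCell.ext' (PreOneCell_ext h ?_ hμ hr)
  obtain ⟨hR, eR⟩ := (VModTens.OneCell.isOneCell R).strictly_unital
  obtain ⟨hS, eS⟩ := (VModTens.OneCell.isOneCell S).strictly_unital
  rw [eR, eS]
  have : ∀ {a b c : Y.carrier} (h : a = b) (h' : a = c), b = c → HEq (eqToHom h) (eqToHom h') := by
    rintro a b c rfl rfl -
    rfl
  exact this hR hS (by rw [h])

/-- For the whiskering axioms of a strict 2-functor, whose correction 2-cells come from equalities
of 1-cells and so vanish on components. -/
theorem eq_eqToHom_comp_comp_app {X Y : VModTens.{w} V} {R R' S S' : X ⟶ Y} (h : R = R')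
    (k : S' = S) (Θ : R' ⟶ S') (a : X.carrier)
    (f : (VModTens.OneCell.toPreOneCell R).functor.obj a ⟶
      (VModTens.OneCell.toPreOneCell S).functor.obj a)
    (hf : HEq f ((VModTens.TwoCell.toNatTrans Θ).app a)) :
    f = (VModTens.TwoCell.toNatTrans (eqToHom h ≫ Θ ≫ eqToHom k)).app a := by
  subst h k
  rw [eqToHom_refl, eqToHom_refl, Category.id_comp, Category.comp_id]
  exact eq_of_heq hf

theorem mateOne_preOneCell_r {𝒜 ℬ : VMonCat.{w} V} (R : 𝒜 ⟶ ℬ) (v : V) :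
    mateOne (adj ℬ) ((preOneCell (fun 𝒜 => 𝒜.centralLift (adj 𝒜)) R).r v) =
      gunit (adj 𝒜) v ≫ vmap (VMonCat.OneCell.functor R) (𝟙_ 𝒜.Und) ((F 𝒜).obj v) ≫
      eHomWhiskerRight V (eqToHom (VMonCat.OneCell.unit_eq R)) _ :=
  letI := VMonCat.OneCell.lax R
  (VMonCat.OneCell.enrichment R).mateOne_comparison (adj 𝒜) (adj ℬ) v

/-- The only part of strictness that is not formal is the agreement of the transformations `r`; it
is checked on mates. -/
noncomputable def underlyingPreCore (adj : ∀ 𝒜 : VMonCat.{w} V, F 𝒜 ⊣ 𝒜.trace) :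
    StrictPseudofunctorPreCore (VMonCat.{w} V) (VModTens.{w} V) where
  toPrelaxFunctor := underlyingPrelaxFunctor adj
  map_id 𝒜 := by
    refine OneCell_ext ?_ (fun a b => HEq.rfl) fun v => heq_of_eq ?_
    · exact forget_id 𝒜.carrier
    · apply mateOne_injective (adj 𝒜)
      refine (mateOne_preOneCell_r (𝟙 𝒜) v).trans ?_
      have h : gunit (adj 𝒜) v ≫ 𝟙 (𝟙_ 𝒜.Und ⟶[V] (F 𝒜).obj v) ≫
          eHomWhiskerRight V (𝟙 (𝟙_ 𝒜.Und)) ((F 𝒜).obj v) =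
          mateOne (adj 𝒜) (𝟙 ((F 𝒜).obj v)) := by
        rw [mateOne_id, eHomWhiskerRight_id, Category.comp_id]
        exact Category.comp_id (gunit (adj 𝒜) v)
      exact h
  map_comp {𝒜 ℬ 𝒞} R S := by
    refine OneCell_ext ?_ (fun a b => HEq.rfl) fun v => heq_of_eq ?_
    · exact forget_comp (VMonCat.OneCell.functor R) (VMonCat.OneCell.functor S)
    · apply mateOne_injective (adj 𝒞)
      refine (mateOne_preOneCell_r (R ≫ S) v).trans (Eq.symm ?_)
      let := VMonCat.OneCell.lax S
      -- The mate of `s_v ≫ S (r_v)` is the mate of `r_v` with the hom-object action of `S` applied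
      -- to it.
      refine ((VMonCat.OneCell.enrichment S).mateOne_comparison_comp (adj ℬ) (adj 𝒞) _).trans ?_
      refine (congrArg (· ≫ _) (mateOne_preOneCell_r R v)).trans ?_
      have h : (gunit (adj 𝒜) v ≫ vmap (VMonCat.OneCell.functor R) (𝟙_ 𝒜.Und) ((F 𝒜).obj v) ≫
            eHomWhiskerRight V (eqToHom (VMonCat.OneCell.unit_eq R)) _) ≫
            vmap (VMonCat.OneCell.functor S) _ _ ≫
              eHomWhiskerRight V (eqToHom (VMonCat.OneCell.unit_eq S)) _ =
          gunit (adj 𝒜) v ≫ (vmap (VMonCat.OneCell.functor R) (𝟙_ 𝒜.Und) ((F 𝒜).obj v) ≫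
            vmap (VMonCat.OneCell.functor S) _ _) ≫
            eHomWhiskerRight V (eqToHom (VMonCat.OneCell.unit_eq S) ≫
              (VMonCat.OneCell.functor S).forget.map (eqToHom (VMonCat.OneCell.unit_eq R))) _ := by
        rw [eHomWhiskerRight_comp, Category.assoc, Category.assoc, Category.assoc,
          reassoc_of% (vmap_whiskerRight (VMonCat.OneCell.functor S))]
      rw [eqToHom_map, eqToHom_trans] at h
      exact h
  map₂_whisker_left R S S' θ :=
    VModTens.hom_ext fun a => eq_eqToHom_comp_comp_app _ _ _ a _ HEq.rfl
  map₂_whisker_right θ S :=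
    VModTens.hom_ext fun a => eq_eqToHom_comp_comp_app _ _ _ a _ HEq.rfl

/-- The 2-functor from rigid `V`-monoidal categories to `V`-module tensor categories. -/
noncomputable def underlyingTwoFunctor (adj : ∀ 𝒜 : VMonCat.{w} V, F 𝒜 ⊣ 𝒜.trace) :
    StrictPseudofunctor (VMonCat.{w} V) (VModTens.{w} V) :=
  StrictPseudofunctor.mk'' (underlyingPreCore adj)

theorem isUnderlyingTwoFunctor (adj : ∀ 𝒜 : VMonCat.{w} V, F 𝒜 ⊣ 𝒜.trace) :
    IsUnderlyingTwoFunctor (fun 𝒜 => 𝒜.centralLift (adj 𝒜)) (underlyingTwoFunctor adj) :=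
  ⟨isOneCell_preOneCell, isTwoCell_toNatTrans, rfl⟩

end

end BraidedEnriched

/-! ### Equivalence on hom-categories -/

namespace BraidedEnriched

open WhiskerEnriched

variable {V : Type u} [Category.{v} V] [MonoidalCategory V] [BraidedCategory V]
  {F : ∀ 𝒜 : VMonCat.{w} V, V ⥤ 𝒜.Und} (adj : ∀ 𝒜, F 𝒜 ⊣ 𝒜.trace)

variable {𝒜 ℬ : VMonCat.{w} V}
  (T : (underlyingTwoFunctor adj).obj 𝒜 ⟶ (underlyingTwoFunctor adj).obj ℬ)

/-- The functor underlying a 1-cell between underlying `V`-module tensor categories. -/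
def oneCellFunctor : 𝒜.Und ⥤ ℬ.Und := (VModTens.OneCell.toPreOneCell T).functor

instance : (oneCellFunctor adj T).LaxMonoidal := (VModTens.OneCell.toPreOneCell T).lax

/-- The enrichment of the functor underlying a 1-cell of `V`-module tensor categories. -/
noncomputable def enrichmentOfOneCell : LaxEnrichment V (oneCellFunctor adj T) :=
  LaxEnrichment.ofComparison (adj 𝒜) (adj ℬ) (r := (VModTens.OneCell.toPreOneCell T).r)
    (VModTens.OneCell.isOneCell T).r_natural
    (VModTens.OneCell.isOneCell T).r_unit
    (VModTens.OneCell.isOneCell T).half_braiding_coherence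
    (VModTens.OneCell.isOneCell T).action_coherence

theorem enrichmentOfOneCell_comparison (v : V) :
    (enrichmentOfOneCell adj T).comparison (adj 𝒜) (adj ℬ) v =
      (VModTens.OneCell.toPreOneCell T).r v :=
  LaxEnrichment.comparison_ofComparison (R := oneCellFunctor adj T) (adj 𝒜) (adj ℬ)
    (VModTens.OneCell.isOneCell T).r_natural _ _ _ v

theorem oneCellFunctor_strictly_unital : ∃ h : 𝟙_ ℬ.Und = (oneCellFunctor adj T).obj (𝟙_ 𝒜.Und),
    Functor.LaxMonoidal.ε (oneCellFunctor adj T) = eqToHom h :=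
  (VModTens.OneCell.isOneCell T).strictly_unital

/-- The 1-cell of `V`-monoidal categories corresponding to a 1-cell of `V`-module tensor
categories. -/
noncomputable def liftOneCell : 𝒜 ⟶ ℬ :=
  VMonCat.OneCell.ofEnrichment (enrichmentOfOneCell adj T)
    (oneCellFunctor_strictly_unital adj T).choose
    (oneCellFunctor_strictly_unital adj T).choose_spec

/-- An equality rather than an isomorphism, so any property of 1-cells passes to the lift without an
invariance hypothesis. -/
theorem map_liftOneCell : (underlyingTwoFunctor adj).map (liftOneCell adj T) = T := by
  refine OneCell_ext ?_ (fun a b => HEq.rfl) fun v => ?_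
  · exact CategoryTheory.Functor.hext (fun _ => rfl) fun a b f => heq_of_eq
      (VMonCat.enrichedFunctor_forget_map (enrichmentOfOneCell adj T) f)
  · suffices h : (preOneCell (fun 𝒜 => 𝒜.centralLift (adj 𝒜)) (liftOneCell adj T)).r v =
        (VModTens.OneCell.toPreOneCell T).r v from heq_of_eq h
    apply mateOne_injective (adj ℬ)
    refine (mateOne_preOneCell_r (liftOneCell adj T) v).trans ?_
    have h := (enrichmentOfOneCell adj T).mateOne_comparison (adj 𝒜) (adj ℬ) v
    rw [enrichmentOfOneCell_comparison,
      (oneCellFunctor_strictly_unital adj T).choose_spec] at h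
    exact h.symm

instance faithful_mapFunctor (𝒜 ℬ : VMonCat.{w} V) :
    ((underlyingTwoFunctor adj).mapFunctor 𝒜 ℬ).Faithful where
  map_injective {_ _ _ _} h := VMonCat.hom_ext fun a =>
    congrArg (fun Θ => (VModTens.TwoCell.toNatTrans Θ).app a) h

/-- Naturality at the level of hom-objects is the only missing condition, and
`vnatural_of_comparison` derives it from compatibility with `r`. -/
instance full_mapFunctor (𝒜 ℬ : VMonCat.{w} V) :
    ((underlyingTwoFunctor adj).mapFunctor 𝒜 ℬ).Full where
  map_surjective {R S} Θ := by
    let := VMonCat.OneCell.lax R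
    let := VMonCat.OneCell.lax S
    let τ : (VMonCat.OneCell.functor R).forget ⟶ (VMonCat.OneCell.functor S).forget :=
      VModTens.TwoCell.toNatTrans Θ
    have : NatTrans.IsMonoidal τ := VModTens.TwoCell.isMonoidal Θ
    exact ⟨{
      app := τ.app
      vnatural := (VMonCat.OneCell.enrichment R).vnatural_of_comparison (adj 𝒜) (adj ℬ)
        (VMonCat.OneCell.enrichment S) τ (VModTens.TwoCell.coherence Θ)
      tensor := fun a b => NatTrans.IsMonoidal.tensor (τ := τ) a b
      unit := NatTrans.IsMonoidal.unit (τ := τ) }, rfl⟩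

instance isEquivalence_mapFunctor (𝒜 ℬ : VMonCat.{w} V) :
    ((underlyingTwoFunctor adj).mapFunctor 𝒜 ℬ).IsEquivalence where
  essSurj := ⟨fun T => ⟨liftOneCell adj T, ⟨eqToIso (map_liftOneCell adj T)⟩⟩⟩

/-- Full faithfulness is inherited by full subcategories. For essential surjectivity, the lift of a
1-cell in `T` lies in `S` because its image is that very 1-cell. -/
theorem isEquivalence_lift_mapFunctor (S : ObjectProperty (𝒜 ⟶ ℬ))
    (T : ObjectProperty ((underlyingTwoFunctor adj).obj 𝒜 ⟶ (underlyingTwoFunctor adj).obj ℬ))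
    (h : ∀ R : 𝒜 ⟶ ℬ, S R ↔ T ((underlyingTwoFunctor adj).map R)) (h') :
    (T.lift (S.ι ⋙ (underlyingTwoFunctor adj).mapFunctor 𝒜 ℬ) h').IsEquivalence where
  essSurj := ⟨fun R => ⟨⟨liftOneCell adj R.obj, (h _).2 (by
      rw [map_liftOneCell]; exact R.property)⟩,
    ⟨T.isoMk (eqToIso (map_liftOneCell adj R.obj))⟩⟩⟩

end BraidedEnriched

/-! ### Enrichment and `V`-monoidal structure from a central functor -/

namespace BraidedEnriched

/-- An oplax braided central functor `F : V ⥤ A`, spelled out in terms of `A`, such that all the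
functors `v ↦ a ⊗ F v` have right adjoints. -/
class CentralAction (V : Type u) [Category.{v} V] [MonoidalCategory V] [BraidedCategory V]
    (A : Type w) [Category.{v} A] [MonoidalCategory A] where
  F : V ⥤ A
  e (a : A) (v : V) : a ⊗ F.obj v ⟶ F.obj v ⊗ a
  δ (u v : V) : F.obj (u ⊗ v) ⟶ F.obj u ⊗ F.obj v
  η : F.obj (𝟙_ V) ⟶ 𝟙_ A
  isIso_η : IsIso η
  e_naturality_left {a b : A} (k : a ⟶ b) (v : V) : k ▷ F.obj v ≫ e b v = e a v ≫ F.obj v ◁ k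
  e_naturality_right (a : A) {u v : V} (h : u ⟶ v) : a ◁ F.map h ≫ e a v = e a u ≫ F.map h ▷ a
  e_tensor (a b : A) (v : V) : e (a ⊗ b) v =
    (α_ _ _ _).hom ≫ a ◁ e b v ≫ (α_ _ _ _).inv ≫ e a v ▷ b ≫ (α_ _ _ _).hom
  e_unit (v : V) : e (𝟙_ A) v = (λ_ _).hom ≫ (ρ_ _).inv
  e_δ (a : A) (u v : V) : e a (u ⊗ v) ≫ δ u v ▷ a =
    a ◁ δ u v ≫ (α_ _ _ _).inv ≫ e a u ▷ F.obj v ≫ (α_ _ _ _).hom ≫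
      F.obj u ◁ e a v ≫ (α_ _ _ _).inv
  e_η (a : A) : e a (𝟙_ V) ≫ η ▷ a = a ◁ η ≫ (ρ_ a).hom ≫ (λ_ a).inv
  δ_naturality_left {u u' : V} (f : u ⟶ u') (v : V) :
    δ u v ≫ F.map f ▷ F.obj v = F.map (f ▷ v) ≫ δ u' v
  δ_naturality_right (u : V) {v v' : V} (f : v ⟶ v') :
    δ u v ≫ F.obj u ◁ F.map f = F.map (u ◁ f) ≫ δ u v'
  δ_associativity (u v w : V) :
    δ (u ⊗ v) w ≫ δ u v ▷ F.obj w ≫ (α_ _ _ _).hom =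
      F.map (α_ u v w).hom ≫ δ u (v ⊗ w) ≫ F.obj u ◁ δ v w
  δ_left_unitality (v : V) : (λ_ (F.obj v)).inv = F.map (λ_ v).inv ≫ δ (𝟙_ V) v ≫ η ▷ F.obj v
  δ_right_unitality (v : V) : (ρ_ (F.obj v)).inv = F.map (ρ_ v).inv ≫ δ v (𝟙_ V) ≫ F.obj v ◁ η
  δ_braiding (u v : V) : δ u v ≫ e (F.obj u) v = F.map (β_ u v).hom ≫ δ v u
  homObj (a b : A) : V
  curry {a b : A} {v : V} : (a ⊗ F.obj v ⟶ b) ≃ (v ⟶ homObj a b)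
  curry_map_comp {a b : A} {u v : V} (h : u ⟶ v) (f : a ⊗ F.obj v ⟶ b) :
    curry (a ◁ F.map h ≫ f) = h ≫ curry f

namespace CentralAction

variable {V : Type u} [Category.{v} V] [MonoidalCategory V] [BraidedCategory V]
  {A : Type w} [Category.{v} A] [MonoidalCategory A] [CentralAction V A]

local notation "𝐅" => (F (V := V) (A := A))

variable (V) in
/-- The evaluation morphism. -/
def ev (a b : A) : a ⊗ (F (V := V) (A := A)).obj (homObj a b) ⟶ b := curry.symm (𝟙 (homObj a b))

variable {a b c d : A} {u v u' v' : V}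

@[simp]
theorem curry_ev (a b : A) : curry (ev V a b) = 𝟙 (homObj a b) := curry.apply_symm_apply _

theorem whiskerLeft_map_curry_ev (f : a ⊗ (𝐅).obj v ⟶ b) : a ◁ (𝐅).map (curry f) ≫ ev V a b = f := by
  apply curry.injective
  rw [curry_map_comp, curry_ev, Category.comp_id]

/-- The composition of morphisms `a ⊗ F u ⟶ b` and `b ⊗ F v ⟶ c`. -/
def gradedComp (f : a ⊗ (𝐅).obj u ⟶ b) (g : b ⊗ (𝐅).obj v ⟶ c) : a ⊗ (𝐅).obj (u ⊗ v) ⟶ c :=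
  a ◁ δ u v ≫ (α_ _ _ _).inv ≫ f ▷ (𝐅).obj v ≫ g

theorem gradedComp_map (h : u' ⟶ u) (f : a ⊗ (𝐅).obj u ⟶ b) (k : v' ⟶ v)
    (g : b ⊗ (𝐅).obj v ⟶ c) :
    gradedComp (a ◁ (𝐅).map h ≫ f) (b ◁ (𝐅).map k ≫ g) =
      a ◁ (𝐅).map (h ⊗ₘ k) ≫ gradedComp f g := by
  simp only [gradedComp, MonoidalCategory.tensorHom_def, Functor.map_comp,
    MonoidalCategory.whiskerLeft_comp, Category.assoc, comp_whiskerRight]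
  rw [← MonoidalCategory.whiskerLeft_comp_assoc a (F.map (u ◁ k)), ← δ_naturality_right,
    MonoidalCategory.whiskerLeft_comp_assoc, ← MonoidalCategory.whiskerLeft_comp_assoc a (F.map _),
    ← δ_naturality_left, MonoidalCategory.whiskerLeft_comp_assoc, ← whisker_exchange_assoc]
  simp

/-- This is coassociativity of `δ`, whiskered by `a`. -/
theorem gradedComp_assoc {w' : V} (f : a ⊗ (𝐅).obj u ⟶ b) (g : b ⊗ (𝐅).obj v ⟶ c)
    (k : c ⊗ (𝐅).obj w' ⟶ d) :
    gradedComp (gradedComp f g) k =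
      a ◁ (𝐅).map (α_ u v w').hom ≫ gradedComp f (gradedComp g k) := by
  have h := congrArg (a ◁ ·) (δ_associativity (A := A) u v w')
  simp only [MonoidalCategory.whiskerLeft_comp] at h
  simp only [gradedComp, Category.assoc, comp_whiskerRight]
  rw [← whisker_exchange_assoc, ← associator_inv_naturality_right_assoc, ← reassoc_of% h]
  simp

theorem gradedComp_unit_left (f : a ⊗ (𝐅).obj v ⟶ b) :
    a ◁ (𝐅).map (λ_ v).inv ≫ gradedComp (a ◁ η ≫ (ρ_ a).hom) f = f := by
  have h := congrArg (a ◁ ·) (δ_left_unitality (A := A) v)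
  simp only [MonoidalCategory.whiskerLeft_comp] at h
  simp only [gradedComp, comp_whiskerRight, Category.assoc, whisker_assoc, Iso.inv_hom_id_assoc]
  rw [← reassoc_of% h]
  simp

theorem gradedComp_unit_right (f : a ⊗ (𝐅).obj v ⟶ b) (g : b ⟶ c) :
    a ◁ (𝐅).map (ρ_ v).inv ≫ gradedComp f (b ◁ η ≫ (ρ_ b).hom ≫ g) = f ≫ g := by
  have h := congrArg (a ◁ ·) (δ_right_unitality (A := A) v)
  simp only [MonoidalCategory.whiskerLeft_comp] at h
  simp only [gradedComp]
  rw [← whisker_exchange_assoc, ← associator_inv_naturality_right_assoc, ← reassoc_of% h]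
  simp

instance : IsIso (η : (𝐅).obj (𝟙_ V) ⟶ 𝟙_ A) := isIso_η

/-- The isomorphism `a ⊗ F 𝟙 ≅ a`. -/
noncomputable def unitIso (a : A) : a ⊗ (𝐅).obj (𝟙_ V) ≅ a :=
  whiskerLeftIso a (asIso η) ≪≫ ρ_ a

theorem unitIso_hom (a : A) : (unitIso (V := V) a).hom = a ◁ η ≫ (ρ_ a).hom := rfl

/-- Composition of hom-objects. -/
def homComp (a b c : A) : (homObj a b ⊗ homObj b c : V) ⟶ homObj a c :=
  curry (gradedComp (ev V a b) (ev V b c))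

/-- By the universal property of the evaluation maps, composition of hom-objects is `gradedComp` on
uncurried morphisms. -/
theorem curry_tensorHom_homComp (f : a ⊗ (𝐅).obj u ⟶ b) (g : b ⊗ (𝐅).obj v ⟶ c) :
    (curry f ⊗ₘ curry g) ≫ homComp a b c = curry (gradedComp f g) := by
  rw [homComp, ← curry_map_comp, ← gradedComp_map, whiskerLeft_map_curry_ev,
    whiskerLeft_map_curry_ev]

/-- The enrichment of `A` in `V`. -/
noncomputable instance : EnrichedOrdinaryCategory V A where
  Hom a b := homObj a b
  id a := curry (a ◁ η ≫ (ρ_ a).hom)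
  comp a b c := homComp a b c
  id_comp a b := by
    -- Identities of hom-objects are curried evaluations, so each category axiom becomes the
    -- corresponding law for `gradedComp`.
    rw [← tensorHom_id, ← curry_ev, curry_tensorHom_homComp, ← curry_map_comp,
      gradedComp_unit_left]
  comp_id a b := by
    have h := gradedComp_unit_right (ev V a b) (𝟙 b)
    rw [Category.comp_id, Category.comp_id] at h
    rw [← id_tensorHom, ← curry_ev, curry_tensorHom_homComp, ← curry_map_comp, h]
  assoc a b c d := by
    rw [← tensorHom_id, ← id_tensorHom, ← curry_ev, ← curry_ev, homComp, curry_tensorHom_homComp,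
      homComp, curry_tensorHom_homComp, ← curry_map_comp, gradedComp_assoc,
      ← MonoidalCategory.whiskerLeft_comp_assoc, ← Functor.map_comp,
      Iso.inv_hom_id]
    simp
  homEquiv {a b} :=
    -- Invertibility of `η` is used here: `a ⊗ F 𝟙 ≅ a`, so graded morphisms of degree `𝟙_ V` are
    -- ordinary morphisms.
    { toFun f := curry (a ◁ η ≫ (ρ_ a).hom ≫ f)
      invFun x := (unitIso a).inv ≫ curry.symm x
      left_inv f := by
        simp [Iso.inv_comp_eq, unitIso_hom]
      right_inv x := by
        have h := (unitIso a).hom_inv_id_assoc (curry.symm x)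
        rw [unitIso_hom, Category.assoc] at h
        exact (congrArg curry h).trans (curry.apply_symm_apply x) }
  homEquiv_id a := congrArg (fun f => curry (a ◁ η ≫ f)) (Category.comp_id _)
  homEquiv_comp {a b c} f g := by
    change curry (a ◁ η ≫ (ρ_ a).hom ≫ f ≫ g) = (λ_ _).inv ≫
      (curry (a ◁ η ≫ (ρ_ a).hom ≫ f) ⊗ₘ curry (b ◁ η ≫ (ρ_ b).hom ≫ g)) ≫ homComp a b c
    have h := gradedComp_unit_right (V := V) (a ◁ η ≫ (ρ_ a).hom ≫ f) g
    rw [curry_tensorHom_homComp, ← curry_map_comp, unitors_inv_equal, h]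
    simp

/-- The graded morphism corresponding to `f : a ⊗ F v ⟶ b`. -/
noncomputable def eCurry (f : a ⊗ (𝐅).obj v ⟶ b) : v ⟶ (a ⟶[V] b) := curry f

theorem eCurry_map_comp (h : u ⟶ v) (f : a ⊗ (𝐅).obj v ⟶ b) :
    eCurry (a ◁ (𝐅).map h ≫ f) = h ≫ eCurry f := curry_map_comp h f

variable (V) in
/-- The evaluation morphism, in terms of the hom-objects of `A`. -/
noncomputable def eEv (a b : A) : a ⊗ (𝐅).obj (a ⟶[V] b) ⟶ b := ev V a b

variable (V) in
theorem eCurry_eEv (a b : A) : eCurry (eEv V a b) = 𝟙 (a ⟶[V] b) := curry_ev a b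

theorem whiskerLeft_map_eCurry_eEv (f : a ⊗ (𝐅).obj v ⟶ b) :
    a ◁ (𝐅).map (eCurry f) ≫ eEv V a b = f := whiskerLeft_map_curry_ev f

theorem eCurry_gcomp_eCurry (f : a ⊗ (𝐅).obj u ⟶ b) (g : b ⊗ (𝐅).obj v ⟶ c) :
    eCurry f ⊚ eCurry g = eCurry (gradedComp f g) :=
  curry_tensorHom_homComp f g

theorem eComp_eq_eCurry (a b c : A) :
    eComp V a b c = eCurry (gradedComp (eEv V a b) (eEv V b c)) := rfl

theorem eHomEquiv_eq_eCurry (f : a ⟶ b) :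
    eHomEquiv V f = eCurry (a ◁ η ≫ (ρ_ a).hom ≫ f) := rfl

theorem eId_eq_eCurry (a : A) : eId V a = eCurry (a ◁ η ≫ (ρ_ a).hom) := rfl

theorem eCurry_post (f : a ⊗ (𝐅).obj v ⟶ b) (g : b ⟶ c) :
    eCurry f ≫ eHomWhiskerLeft V a g = eCurry (f ≫ g) := by
  rw [comp_eHomWhiskerLeft, eHomEquiv_eq_eCurry, eCurry_gcomp_eCurry, ← eCurry_map_comp,
    gradedComp_unit_right]

theorem eCurry_pre (k : a ⟶ b) (f : b ⊗ (𝐅).obj v ⟶ c) :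
    eCurry f ≫ eHomWhiskerRight V k c = eCurry (k ▷ (𝐅).obj v ≫ f) := by
  have h := gradedComp_unit_left (k ▷ (𝐅).obj v ≫ f)
  rw [comp_eHomWhiskerRight, eHomEquiv_eq_eCurry, eCurry_gcomp_eCurry, ← eCurry_map_comp]
  refine congrArg _ (Eq.trans ?_ h)
  simp [gradedComp]

theorem eCurry_pre_assoc (k : a ⟶ b) (f : b ⊗ (𝐅).obj v ⟶ c) {z : V} (k' : _ ⟶ z) :
    eCurry f ≫ eHomWhiskerRight V k c ≫ k' =
      eCurry (k ▷ (𝐅).obj v ≫ f) ≫ k' :=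
  (reassoc_of% eCurry_pre k f) k'

/-- The action of `c ⊗ -` on hom-objects. -/
noncomputable def whiskL (c a b : A) : (a ⟶[V] b) ⟶ ((c ⊗ a : A) ⟶[V] (c ⊗ b)) :=
  eCurry ((α_ _ _ _).hom ≫ c ◁ eEv V a b)

/-- The action of `- ⊗ c` on hom-objects. -/
noncomputable def whiskR (a b c : A) : (a ⟶[V] b) ⟶ ((a ⊗ c : A) ⟶[V] (b ⊗ c)) :=
  eCurry ((α_ _ _ _).hom ≫ a ◁ e c _ ≫ (α_ _ _ _).inv ≫ eEv V a b ▷ c)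

theorem whiskL_eq (c a b : A) :
    whiskL (V := V) c a b = eCurry ((α_ _ _ _).hom ≫ c ◁ eEv V a b) := rfl

theorem whiskR_eq (a b c : A) : whiskR (V := V) a b c =
    eCurry ((α_ _ _ _).hom ≫ a ◁ e c _ ≫ (α_ _ _ _).inv ≫ eEv V a b ▷ c) := rfl

theorem eCurry_whiskL (c : A) (f : a ⊗ (𝐅).obj v ⟶ b) :
    eCurry f ≫ whiskL c a b = eCurry ((α_ _ _ _).hom ≫ c ◁ f) := by
  rw [whiskL, ← eCurry_map_comp, associator_naturality_right_assoc,
    ← MonoidalCategory.whiskerLeft_comp, whiskerLeft_map_eCurry_eEv]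

theorem eCurry_whiskL_assoc (c : A) (f : a ⊗ (𝐅).obj v ⟶ b) {z : V} (k' : _ ⟶ z) :
    eCurry f ≫ whiskL c a b ≫ k' =
      eCurry ((α_ _ _ _).hom ≫ c ◁ f) ≫ k' :=
  (reassoc_of% eCurry_whiskL c f) k'

theorem eCurry_whiskR (f : a ⊗ (𝐅).obj v ⟶ b) (c : A) :
    eCurry f ≫ whiskR a b c =
      eCurry ((α_ _ _ _).hom ≫ a ◁ e c v ≫ (α_ _ _ _).inv ≫ f ▷ c) := by
  have h : (a ⊗ c) ◁ (𝐅).map (eCurry f) ≫ (α_ _ _ _).hom ≫ a ◁ e c _ ≫ (α_ _ _ _).inv ≫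
      eEv V a b ▷ c = (α_ _ _ _).hom ≫ a ◁ e c v ≫ (α_ _ _ _).inv ≫
        (a ◁ (𝐅).map (eCurry f) ≫ eEv V a b) ▷ c := by
    rw [associator_naturality_right_assoc, ← MonoidalCategory.whiskerLeft_comp_assoc,
      e_naturality_right]
    simp
  rw [whiskR, ← eCurry_map_comp, h, whiskerLeft_map_eCurry_eEv]

theorem eCurry_whiskR_assoc (f : a ⊗ (𝐅).obj v ⟶ b) (c : A) {z : V} (k' : _ ⟶ z) :
    eCurry f ≫ whiskR a b c ≫ k' =
      eCurry ((α_ _ _ _).hom ≫ a ◁ e c v ≫ (α_ _ _ _).inv ≫ f ▷ c) ≫ k' :=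
  (reassoc_of% eCurry_whiskR f c) k'

/-- Moving `d` past `F (u ⊗ v)` and then splitting agrees with splitting and moving `d` past the two
factors in turn, which is `e_δ`. -/
theorem gradedComp_whiskerRight (f : a ⊗ (𝐅).obj u ⟶ b) (g : b ⊗ (𝐅).obj v ⟶ c) (d : A) :
    gradedComp ((α_ _ _ _).hom ≫ a ◁ e d u ≫ (α_ _ _ _).inv ≫ f ▷ d)
      ((α_ _ _ _).hom ≫ b ◁ e d v ≫ (α_ _ _ _).inv ≫ g ▷ d) =
    (α_ _ _ _).hom ≫ a ◁ e d (u ⊗ v) ≫ (α_ _ _ _).inv ≫ gradedComp f g ▷ d := by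
  simp only [gradedComp]
  calc
    _ = (a ⊗ d) ◁ δ u v ⊗≫ a ◁ e d u ▷ (𝐅).obj v ⊗≫
          (f ▷ (d ⊗ (𝐅).obj v) ≫ b ◁ e d v) ⊗≫ g ▷ d := by monoidal
    _ = 𝟙 _ ⊗≫ a ◁ (d ◁ δ u v ≫ (α_ _ _ _).inv ≫ e d u ▷ (𝐅).obj v ≫ (α_ _ _ _).hom ≫
          (𝐅).obj u ◁ e d v ≫ (α_ _ _ _).inv) ⊗≫ f ▷ (𝐅).obj v ▷ d ⊗≫ g ▷ d := by
      rw [← whisker_exchange]; monoidal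
    _ = _ := by rw [← e_δ]; monoidal

/-- Pulling `g` through the half-braiding leaves a crossing with `c ⊗ F v`. It splits into the
crossing with `c` and the crossing of `F v` with `F u`, and the latter is `F` of the braiding
because `F` is braided. -/
theorem gradedComp_exchange (f : a ⊗ (𝐅).obj u ⟶ b) (g : c ⊗ (𝐅).obj v ⟶ d) :
    gradedComp ((α_ _ _ _).hom ≫ a ◁ g)
      ((α_ _ _ _).hom ≫ a ◁ e d u ≫ (α_ _ _ _).inv ≫ f ▷ d) =
    (a ⊗ c) ◁ (𝐅).map (β_ v u).hom ≫
      gradedComp ((α_ _ _ _).hom ≫ a ◁ e c u ≫ (α_ _ _ _).inv ≫ f ▷ c)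
        ((α_ _ _ _).hom ≫ b ◁ g) := by
  simp only [gradedComp]
  calc
    _ = (a ⊗ c) ◁ δ v u ⊗≫ a ◁ (g ▷ (𝐅).obj u ≫ e d u) ⊗≫ f ▷ d := by monoidal
    _ = (a ⊗ c) ◁ (δ v u ≫ e ((𝐅).obj v) u) ⊗≫ a ◁ e c u ▷ (𝐅).obj v ⊗≫
          ((a ⊗ (𝐅).obj u) ◁ g ≫ f ▷ d) := by
      rw [e_naturality_left, e_tensor]; monoidal
    _ = _ := by rw [whisker_exchange, δ_braiding]; monoidal

/-- Each axiom on the right-hand action uses one axiom of the half-braiding: `eHomEquiv_wR` uses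
`e_η`, `eComp_wR` uses `e_δ`, `wR_wR` uses `e_tensor` and `wR_unit` uses `e_unit`. The braided axiom
`δ_braiding` is needed only for the exchange law. -/
noncomputable instance : WhiskerEnriched V A where
  wL := whiskL
  wR := whiskR
  eHomEquiv_wL c a b f := by
    rw [eHomEquiv_eq_eCurry, eCurry_whiskL, eHomEquiv_eq_eCurry]
    simp
  eHomEquiv_wR {a b} f c := by
    have h := congrArg (a ◁ ·) (e_η (V := V) c)
    simp only [MonoidalCategory.whiskerLeft_comp] at h
    rw [eHomEquiv_eq_eCurry, eCurry_whiskR, eHomEquiv_eq_eCurry]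
    simp only [comp_whiskerRight, ← associator_inv_naturality_middle_assoc, reassoc_of% h]
    simp
  eComp_wL d a b c := by
    rw [whiskL_eq d a b, whiskL_eq d b c, eCurry_gcomp_eCurry, eComp_eq_eCurry, eCurry_whiskL]
    simp [gradedComp]
  eComp_wR d a b c := by
    rw [whiskR_eq a b d, whiskR_eq b c d, eCurry_gcomp_eCurry, eComp_eq_eCurry, eCurry_whiskR,
      gradedComp_whiskerRight]
  wL_gcomp_wR a b c d := by
    rw [whiskL, whiskL, whiskR, whiskR, eCurry_gcomp_eCurry, eCurry_gcomp_eCurry,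
      ← eCurry_map_comp, gradedComp_exchange]
  wL_wL a b c d := by
    rw [whiskL_eq b c d, whiskL_eq (a ⊗ b) c d, eCurry_whiskL_assoc, eCurry_pre, eCurry_post]
    simp
  wL_wR a b c d := by
    rw [whiskL_eq a b c, whiskR_eq b c d, eCurry_whiskL_assoc, eCurry_whiskR_assoc,
      eCurry_pre, eCurry_post]
    simp
  wR_wR a b c d := by
    rw [whiskR_eq a b (c ⊗ d), whiskR_eq a b c, eCurry_whiskR_assoc, eCurry_pre, eCurry_post, e_tensor]
    simp
  wL_unit a b := by
    rw [whiskL, eCurry_post, ← Category.id_comp (eHomWhiskerRight V _ b), ← eCurry_eEv, eCurry_pre]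
    simp
  wR_unit a b := by
    rw [whiskR, eCurry_post, ← Category.id_comp (eHomWhiskerRight V _ b), ← eCurry_eEv, eCurry_pre,
      e_unit]
    simp

open WhiskerEnriched

variable {a b c d : A} {u v u' v' : V}

/-- Morphisms `F v ⟶ b` correspond to `v`-graded morphisms `𝟙 ⟶ b`. -/
noncomputable def unitEquiv (v : V) (b : A) :
    ((𝐅).obj v ⟶ b) ≃ (v ⟶ (eCoyoneda V (𝟙_ A)).obj b) where
  toFun f := eCurry ((λ_ _).hom ≫ f)
  invFun x := (λ_ _).inv ≫ curry.symm x
  left_inv _ :=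
    (congrArg ((λ_ _).inv ≫ ·) (curry.symm_apply_apply _)).trans (Iso.inv_hom_id_assoc _ _)
  right_inv x :=
    (congrArg curry (Iso.hom_inv_id_assoc _ _)).trans (curry.apply_symm_apply x)

theorem unitEquiv_map_comp (h : u ⟶ v) (f : (𝐅).obj v ⟶ b) :
    unitEquiv u b ((𝐅).map h ≫ f) = h ≫ unitEquiv v b f := by
  have h' := eCurry_map_comp h ((λ_ _).hom ≫ f)
  rw [leftUnitor_naturality_assoc] at h'
  exact h'

theorem unitEquiv_comp (f : (𝐅).obj v ⟶ b) (g : b ⟶ c) :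
    unitEquiv v c (f ≫ g) = unitEquiv v b f ≫ (eCoyoneda V (𝟙_ A)).map g := by
  have h := eCurry_post ((λ_ _).hom ≫ f) g
  rw [Category.assoc] at h
  exact h.symm

variable (V A) in
/-- The functor `F` is left adjoint to `x ↦ 𝒜(𝟙 → x)`. -/
noncomputable def adjunction : 𝐅 ⊣ eCoyoneda V (𝟙_ A) :=
  Adjunction.mkOfHomEquiv
    { homEquiv := unitEquiv
      homEquiv_naturality_left_symm {u v b} f g := by
        apply (unitEquiv u b).injective
        rw [Equiv.apply_symm_apply, unitEquiv_map_comp, Equiv.apply_symm_apply]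
      homEquiv_naturality_right {v b c} f g := unitEquiv_comp f g }

theorem gunit_adjunction (v : V) : gunit (adjunction V A) v = eCurry (λ_ ((𝐅).obj v)).hom := by
  have h : gunit (adjunction V A) v = unitEquiv v _ (𝟙 ((𝐅).obj v)) := by
    rw [gunit, ← Adjunction.homEquiv_id, adjunction, Adjunction.mkOfHomEquiv_homEquiv]
  exact h.trans (congrArg eCurry (Category.comp_id _))

theorem mateOne_adjunction (f : (𝐅).obj v ⟶ b) :
    mateOne (adjunction V A) f = eCurry ((λ_ _).hom ≫ f) := by
  rw [mateOne, gunit_adjunction, eCurry_post]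

/-- For the enrichment just built the mate is the given currying. Hence the morphisms that the mates
prescribe are the original `e`, `η` and `δ`, as the next results verify. -/
theorem mate_adjunction (f : a ⊗ (𝐅).obj v ⟶ b) : mate (adjunction V A) f = eCurry f := by
  have h' : eCurry (λ_ ((𝐅).obj v)).hom ≫ wL a _ _ =
      eCurry ((α_ _ _ _).hom ≫ a ◁ (λ_ _).hom) := eCurry_whiskL a _
  rw [mate, gunit_adjunction, reassoc_of% h', eCurry_pre_assoc, eCurry_post]
  simp

variable [LeftRigidCategory A]

theorem halfBraid_adjunction (a : A) (v : V) : halfBraid (adjunction V A) a v = e a v := by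
  apply mate_injective (adjunction V A)
  have h' : eCurry (λ_ ((𝐅).obj v)).hom ≫ wR _ _ a =
      eCurry ((α_ _ _ _).hom ≫ 𝟙_ A ◁ e a v ≫ (α_ _ _ _).inv ≫ (λ_ _).hom ▷ a) := eCurry_whiskR _ a
  rw [mate_halfBraid, mate_adjunction, gunit_adjunction, reassoc_of% h', eCurry_pre]
  simp

theorem opcounit_adjunction : opcounit (adjunction V A) = η := by
  apply mateOne_injective (adjunction V A)
  rw [mateOne_opcounit, mateOne_adjunction, eId_eq_eCurry, ← unitors_equal, leftUnitor_naturality]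

theorem oplaxitor_adjunction (u v : V) : oplaxitor (adjunction V A) u v = δ u v := by
  apply mateOne_injective (adjunction V A)
  rw [mateOne_oplaxitor, mateOne_adjunction, mate_adjunction, gunit_adjunction, eCurry_gcomp_eCurry]
  simp [gradedComp]

end CentralAction

/-- Multiplicativity at `𝟙 ⊗ 𝟙` and naturality for the unitor make this component idempotent up to
unitors; being invertible, it is the canonical isomorphism. -/
theorem halfBraiding_tensorUnit {A : Type w} [Category.{v} A] [MonoidalCategory A] {x : A}
    (h : HalfBraiding x) : (h.β (𝟙_ A)).hom = (ρ_ x).hom ≫ (λ_ x).inv := by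
  have h₁ := h.naturality (λ_ (𝟙_ A)).hom
  rw [h.monoidal] at h₁
  have h₂ : (x ◁ (λ_ (𝟙_ A)).hom) ≫ (h.β (𝟙_ A)).hom =
      ((α_ _ _ _).inv ≫ ((h.β (𝟙_ A)).hom ≫ (λ_ x).hom) ▷ 𝟙_ A) ≫ (h.β (𝟙_ A)).hom := by
    rw [h₁]
    monoidal
  rw [cancel_mono] at h₂
  have h₃ : (ρ_ x).hom ▷ 𝟙_ A = ((h.β (𝟙_ A)).hom ≫ (λ_ x).hom) ▷ 𝟙_ A := by
    rw [← cancel_epi (α_ _ _ _).inv, ← h₂]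
    monoidal
  rw [Iso.eq_comp_inv]
  exact ((whiskerRight_iff _ _).1 h₃).symm

theorem center_hom_comm_inv {A : Type w} [Category.{v} A] [MonoidalCategory A] {X Y : Center A}
    (f : X ⟶ Y) (a : A) : (X.2.β a).inv ≫ f.f ▷ a = a ◁ f.f ≫ (Y.2.β a).inv := by
  rw [Iso.inv_comp_eq, ← Category.assoc, Iso.eq_comp_inv]
  exact f.comm a

/-- Objects representing `v ↦ (a ⊗ F v ⟶ b)` for a functor `F` with a right adjoint and an object
`a` with a left dual. -/
def tensorLeftAdjEquiv {V : Type u} [Category.{v} V] {A : Type w} [Category.{v} A]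
    [MonoidalCategory A] {F : V ⥤ A} {G : A ⥤ V} (adj : F ⊣ G) (a b : A) [HasLeftDual a] (v : V) :
    (a ⊗ F.obj v ⟶ b) ≃ (v ⟶ G.obj (((ᘁa) : A) ⊗ b)) :=
  (tensorLeftHomEquiv (F.obj v) (ᘁa) a b).trans (adj.homEquiv v _)

theorem tensorLeftAdjEquiv_map_comp {V : Type u} [Category.{v} V] {A : Type w} [Category.{v} A]
    [MonoidalCategory A] {F : V ⥤ A} {G : A ⥤ V} (adj : F ⊣ G) (a b : A) [HasLeftDual a]
    {u v : V} (h : u ⟶ v) (f : a ⊗ F.obj v ⟶ b) :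
    tensorLeftAdjEquiv adj a b u (a ◁ F.map h ≫ f) = h ≫ tensorLeftAdjEquiv adj a b v f := by
  rw [tensorLeftAdjEquiv, tensorLeftAdjEquiv, Equiv.trans_apply, Equiv.trans_apply,
    ← adj.homEquiv_naturality_left]
  congr 1
  simp only [tensorLeftHomEquiv, Equiv.coe_fn_mk, MonoidalCategory.whiskerLeft_comp]
  rw [leftUnitor_inv_naturality_assoc, whisker_exchange_assoc,
    associator_naturality_right_assoc]

namespace CentralStructure

variable {V : Type u} [Category.{v} V] [MonoidalCategory V] [BraidedCategory V]
  {A : Type w} [Category.{v} A] [MonoidalCategory A]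

/-- A central structure whose underlying functor has a right adjoint, spelled out in terms of `A`. -/
@[reducible]
noncomputable def centralAction (X : CentralStructure V A) [LeftRigidCategory A] {G : A ⥤ V}
    (adj : X.F ⊣ G) : CentralAction V A where
  F := X.F
  e := X.e
  δ := X.δ
  η := X.η
  isIso_η := have := X.isIso_η; (Center.forget A).map_isIso (Functor.OplaxMonoidal.η X.FZ)
  e_naturality_left {a b} k v := by
    have h := (X.FZ.obj v).2.naturality k
    have h' : k ▷ (X.FZ.obj v).1 ≫ ((X.FZ.obj v).2.β b).inv =
        ((X.FZ.obj v).2.β a).inv ≫ (X.FZ.obj v).1 ◁ k := by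
      rw [Iso.comp_inv_eq, Category.assoc, h, Iso.inv_hom_id_assoc]
    exact h'
  e_naturality_right a {u v} h := (center_hom_comm_inv (X.FZ.map h) a).symm
  e_tensor a b v := by
    have h' : ((X.FZ.obj v).2.β (a ⊗ b)).inv = (α_ _ _ _).hom ≫ a ◁ ((X.FZ.obj v).2.β b).inv ≫
        (α_ _ _ _).inv ≫ ((X.FZ.obj v).2.β a).inv ▷ b ≫ (α_ _ _ _).hom := by
      rw [← cancel_epi ((X.FZ.obj v).2.β (a ⊗ b)).hom, Iso.hom_inv_id, HalfBraiding.monoidal]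
      simp
    exact h'
  e_unit v := by
    have h := halfBraiding_tensorUnit (X.FZ.obj v).2
    have h' : ((X.FZ.obj v).2.β (𝟙_ A)).inv = (λ_ _).hom ≫ (ρ_ _).inv := by
      rw [← cancel_epi ((X.FZ.obj v).2.β (𝟙_ A)).hom, Iso.hom_inv_id, h]
      simp
    exact h'
  e_δ a u v := by
    have h := center_hom_comm_inv (Functor.OplaxMonoidal.δ X.FZ u v) a
    rw [Center.tensor_β] at h
    refine h.trans ?_
    simp only [Iso.trans_inv, whiskerLeftIso_inv, whiskerRightIso_inv, Iso.symm_inv,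
      Category.assoc]
    rfl
  e_η a := by
    have h := center_hom_comm_inv (Functor.OplaxMonoidal.η X.FZ) a
    rw [Center.tensorUnit_β] at h
    exact h
  δ_naturality_left f v := congrArg Center.Hom.f (Functor.OplaxMonoidal.δ_natural_left X.FZ f v)
  δ_naturality_right u _ _ f := congrArg Center.Hom.f (Functor.OplaxMonoidal.δ_natural_right X.FZ u f)
  δ_associativity u v w := congrArg Center.Hom.f (Functor.OplaxMonoidal.associativity X.FZ u v w)
  δ_left_unitality v := by
    have h := congrArg Center.Hom.f (Functor.OplaxMonoidal.left_unitality X.FZ v)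
    rw [Center.leftUnitor_inv_f] at h
    exact h
  δ_right_unitality v := by
    have h := congrArg Center.Hom.f (Functor.OplaxMonoidal.right_unitality X.FZ v)
    rw [Center.rightUnitor_inv_f] at h
    exact h
  δ_braiding u v := by
    have h := congrArg Center.Hom.f (X.braided u v)
    rw [Center.comp_f, center_braiding_inv_f] at h
    exact h
  homObj a b := G.obj (((ᘁa) : A) ⊗ b)
  curry {a b v} := tensorLeftAdjEquiv adj a b v
  curry_map_comp {a b _ _} h f := tensorLeftAdjEquiv_map_comp adj a b h f

end CentralStructure

end BraidedEnriched

/-! ### Transport of the structure to the underlying category of the enrichment -/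

namespace BraidedEnriched

section Underlying

variable (V : Type u) [Category.{v} V] [MonoidalCategory V] [BraidedCategory V]
  (A : Type w) [Category.{v} A] [MonoidalCategory A] [EnrichedOrdinaryCategory V A]

/-- The isomorphism of categories `A ⥤ ForgetEnrichment V A`. -/
abbrev toUnd : A ⥤ ForgetEnrichment V A := ForgetEnrichment.equivInverse V A

/-- The isomorphism of categories `ForgetEnrichment V A ⥤ A`. -/
abbrev ofUnd : ForgetEnrichment V A ⥤ A := ForgetEnrichment.equivFunctor V A

variable {A}

theorem ofUnd_map_toUnd_map {a b : A} (f : a ⟶ b) : (ofUnd V A).map ((toUnd V A).map f) = f :=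
  (eHomEquiv V).symm_apply_apply f

theorem toUnd_map_ofUnd_map {a b : ForgetEnrichment V A} (f : a ⟶ b) :
    (toUnd V A).map ((ofUnd V A).map f) = f :=
  (eHomEquiv V (C := A)).apply_symm_apply f

instance : (ofUnd V A).IsEquivalence := (ForgetEnrichment.equiv V).isEquivalence_functor

variable (A)

/-- The monoidal structure is transported along an isomorphism of categories that fixes objects.
Unit and tensor products of objects thus agree definitionally with those of `A`, so both comparison
functors have identity laxitors and are strictly unital. -/
instance : MonoidalCategoryStruct (ForgetEnrichment V A) where
  tensorObj a b := (toUnd V A).obj ((ofUnd V A).obj a ⊗ (ofUnd V A).obj b)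
  whiskerLeft a _ _ f := (toUnd V A).map ((ofUnd V A).obj a ◁ (ofUnd V A).map f)
  whiskerRight f a := (toUnd V A).map ((ofUnd V A).map f ▷ (ofUnd V A).obj a)
  tensorHom f g := (toUnd V A).map ((ofUnd V A).map f ⊗ₘ (ofUnd V A).map g)
  tensorUnit := (toUnd V A).obj (𝟙_ A)
  associator a b c := (toUnd V A).mapIso (α_ ((ofUnd V A).obj a) ((ofUnd V A).obj b) ((ofUnd V A).obj c))
  leftUnitor a := (toUnd V A).mapIso (λ_ ((ofUnd V A).obj a))
  rightUnitor a := (toUnd V A).mapIso (ρ_ ((ofUnd V A).obj a))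

/-- The functor to `A` preserves the monoidal structure strictly. -/
def undInducing : Monoidal.InducingFunctorData (ofUnd V A) where
  μIso _ _ := Iso.refl _
  εIso := Iso.refl _
  whiskerLeft_eq a _ _ f := (ofUnd_map_toUnd_map V _).trans
    ((Category.id_comp _).trans (Category.comp_id _)).symm
  whiskerRight_eq f a := (ofUnd_map_toUnd_map V _).trans
    ((Category.id_comp _).trans (Category.comp_id _)).symm
  tensorHom_eq f g := (ofUnd_map_toUnd_map V _).trans
    ((Category.id_comp _).trans (Category.comp_id _)).symm
  associator_eq a b c := by
    have h (a b c : A) : (α_ a b c).hom = (((Iso.refl ((a ⊗ b) ⊗ c)).symm ≪≫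
      ((Iso.refl (a ⊗ b)).symm ⊗ᵢ .refl c)) ≪≫ α_ a b c ≪≫
        ((.refl a ⊗ᵢ Iso.refl (b ⊗ c)) ≪≫ Iso.refl (a ⊗ b ⊗ c))).hom := by simp
    exact (ofUnd_map_toUnd_map V _).trans (h _ _ _)
  leftUnitor_eq a := by
    have h (a : A) : (λ_ a).hom = (((Iso.refl (𝟙_ A ⊗ a)).symm ≪≫
      ((Iso.refl (𝟙_ A)).symm ⊗ᵢ .refl a)) ≪≫ λ_ a).hom := by simp
    exact (ofUnd_map_toUnd_map V _).trans (h _)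
  rightUnitor_eq a := by
    have h (a : A) : (ρ_ a).hom = (((Iso.refl (a ⊗ 𝟙_ A)).symm ≪≫
      (.refl a ⊗ᵢ (Iso.refl (𝟙_ A)).symm)) ≪≫ ρ_ a).hom := by simp
    exact (ofUnd_map_toUnd_map V _).trans (h _)

instance : MonoidalCategory (ForgetEnrichment V A) :=
  Monoidal.induced (ofUnd V A) (undInducing V A)

theorem nonempty_rigidCategory_und [RigidCategory A] :
    Nonempty (RigidCategory (ForgetEnrichment V A)) := by
  let : (ForgetEnrichment.equiv V (D := A)).functor.Monoidal := Monoidal.fromInducedMonoidal (ofUnd V A) (undInducing V A)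
  exact ⟨rigidCategoryOfEquivalence (ForgetEnrichment.equiv V (D := A)).toAdjunction⟩

instance : (ofUnd V A).LaxMonoidal where
  ε := 𝟙 (𝟙_ A)
  μ a b := 𝟙 ((ofUnd V A).obj a ⊗ (ofUnd V A).obj b)
  μ_natural_left f a :=
    (Category.comp_id _).trans ((ofUnd_map_toUnd_map V _).symm.trans (Category.id_comp _).symm)
  μ_natural_right a f :=
    (Category.comp_id _).trans ((ofUnd_map_toUnd_map V _).symm.trans (Category.id_comp _).symm)
  associativity a b c := by
    have h (a b c : A) : 𝟙 (a ⊗ b) ▷ c ≫ 𝟙 ((a ⊗ b) ⊗ c) ≫ (α_ a b c).hom =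
      (α_ a b c).hom ≫ a ◁ 𝟙 (b ⊗ c) ≫ 𝟙 (a ⊗ b ⊗ c) := by simp
    exact (congrArg (_ ≫ _ ≫ ·) (ofUnd_map_toUnd_map V _)).trans (h _ _ _)
  left_unitality a := by
    have h (a : A) : (λ_ a).hom = 𝟙 (𝟙_ A) ▷ a ≫ 𝟙 (𝟙_ A ⊗ a) ≫ (λ_ a).hom := by simp
    exact (h _).trans (congrArg (_ ≫ _ ≫ ·) (ofUnd_map_toUnd_map V _).symm)
  right_unitality a := by
    have h (a : A) : (ρ_ a).hom = a ◁ 𝟙 (𝟙_ A) ≫ 𝟙 (a ⊗ 𝟙_ A) ≫ (ρ_ a).hom := by simp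
    exact (h _).trans (congrArg (_ ≫ _ ≫ ·) (ofUnd_map_toUnd_map V _).symm)

instance : (toUnd V A).LaxMonoidal where
  ε := 𝟙 (𝟙_ (ForgetEnrichment V A))
  μ a b := 𝟙 ((toUnd V A).obj a ⊗ (toUnd V A).obj b)
  μ_natural_left {a b} f c := by
    have h := congrArg (fun g => (toUnd V A).map (g ▷ c)) (ofUnd_map_toUnd_map V f)
    exact (Category.comp_id _).trans (h.trans (Category.id_comp _).symm)
  μ_natural_right c f := by
    have h := congrArg (fun g => (toUnd V A).map (c ◁ g)) (ofUnd_map_toUnd_map V f)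
    exact (Category.comp_id _).trans (h.trans (Category.id_comp _).symm)
  associativity a b c := by
    have h (a b c : ForgetEnrichment V A) : 𝟙 (a ⊗ b) ▷ c ≫ 𝟙 ((a ⊗ b) ⊗ c) ≫ (α_ a b c).hom =
      (α_ a b c).hom ≫ a ◁ 𝟙 (b ⊗ c) ≫ 𝟙 (a ⊗ b ⊗ c) := by simp
    exact h _ _ _
  left_unitality a := by
    have h (a : ForgetEnrichment V A) : (λ_ a).hom = 𝟙 (𝟙_ (ForgetEnrichment V A)) ▷ a ≫
      𝟙 (𝟙_ (ForgetEnrichment V A) ⊗ a) ≫ (λ_ a).hom := by simp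
    exact h _
  right_unitality a := by
    have h (a : ForgetEnrichment V A) : (ρ_ a).hom = a ◁ 𝟙 (𝟙_ (ForgetEnrichment V A)) ≫
      𝟙 (a ⊗ 𝟙_ (ForgetEnrichment V A)) ≫ (ρ_ a).hom := by simp
    exact h _

variable [WhiskerEnriched V A]

theorem eHomEquiv_und {a b : ForgetEnrichment V A} (f : a ⟶ b) :
    eHomEquiv V f = eHomEquiv V ((ofUnd V A).map f) :=
  ((eHomEquiv V (C := A)).apply_symm_apply f).symm

theorem und_post (a : ForgetEnrichment V A) {b c : ForgetEnrichment V A} (f : b ⟶ c) :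
    eHomWhiskerLeft V a f = eHomWhiskerLeft V ((ofUnd V A).obj a) ((ofUnd V A).map f) :=
  congrArg (fun g => (ρ_ _).inv ≫ _ ◁ g ≫ eComp V _ _ _) (eHomEquiv_und V A f)

/-- The hom-objects and their composition are unchanged, and `eHomEquiv_und` matches the ordinary
morphisms, so every axiom is the one for `A`. -/
instance : WhiskerEnriched V (ForgetEnrichment V A) where
  wL a b c := WhiskerEnriched.wL (A := A) a b c
  wR a b c := WhiskerEnriched.wR (A := A) a b c
  eHomEquiv_wL c _ _ f := (congrArg (· ≫ _) (eHomEquiv_und V A f)).trans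
    (WhiskerEnriched.eHomEquiv_wL ((ofUnd V A).obj c) ((ofUnd V A).map f))
  eHomEquiv_wR f c := (congrArg (· ≫ _) (eHomEquiv_und V A f)).trans
    (WhiskerEnriched.eHomEquiv_wR ((ofUnd V A).map f) ((ofUnd V A).obj c))
  eComp_wL a b c d := WhiskerEnriched.eComp_wL (A := A) a b c d
  eComp_wR a b c d := WhiskerEnriched.eComp_wR (A := A) a b c d
  wL_gcomp_wR a b c d := WhiskerEnriched.wL_gcomp_wR (A := A) a b c d
  wL_wL a b c d := WhiskerEnriched.wL_wL (A := A) a b c d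
  wL_wR a b c d := WhiskerEnriched.wL_wR (A := A) a b c d
  wR_wR a b c d := WhiskerEnriched.wR_wR (A := A) a b c d
  wL_unit a b := WhiskerEnriched.wL_unit (A := A) a b
  wR_unit a b := WhiskerEnriched.wR_unit (A := A) a b

end Underlying

end BraidedEnriched

/-! ### The `V`-monoidal category realizing a central action -/

namespace BraidedEnriched

open WhiskerEnriched

section

variable {V : Type u} [Category.{v} V] [MonoidalCategory V] [BraidedCategory V]
  {C : Type w} [EnrichedCategory V C] [MonoidalCategory (ForgetEnrichment V C)]
  [WhiskerEnriched V (ForgetEnrichment V C)]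

/-- Closes the round trip between the two presentations: `wR` sends identity elements to identity
elements, so only `wL` survives in `tens`. -/
theorem tensWL_toVMonoidal (c a b : ForgetEnrichment V C) :
    letI : VMonoidal V C := WhiskerEnriched.toVMonoidal
    tensWL V c a b = wL c a b := by
  have h : (λ_ (a ⟶[V] b)).inv ≫ eId V c ▷ (a ⟶[V] b) ≫ wR c c a ⊚ wL c a b = wL c a b := by
    rw [← comp_gcomp, ← eHomEquiv_id, eHomEquiv_wR, eHomEquiv_gcomp]
    simp
  exact h

theorem tensWR_toVMonoidal (a b c : ForgetEnrichment V C) :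
    letI : VMonoidal V C := WhiskerEnriched.toVMonoidal
    tensWR V a b c = wR a b c := by
  have h : (ρ_ (a ⟶[V] b)).inv ≫ (a ⟶[V] b) ◁ eId V c ≫ wR a b c ⊚ wL b c c = wR a b c := by
    rw [← gcomp_comp, ← eHomEquiv_id, eHomEquiv_wL, gcomp_eHomEquiv]
    simp
  exact h

end

section Realization

variable (V : Type u) [Category.{v} V] [MonoidalCategory V] [BraidedCategory V]
  (A : Type w) [Category.{v} A] [MonoidalCategory A] [CentralAction V A]

/-- The functor is the one for `A` precomposed with the equivalence `ofUnd`. -/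
theorem und_isRightAdjoint :
    (eCoyoneda V (𝟙_ (ForgetEnrichment V A))).IsRightAdjoint := by
  have : (eCoyoneda V (𝟙_ A)).IsRightAdjoint :=
    (CentralAction.adjunction V A).isRightAdjoint
  have h : ofUnd V A ⋙ eCoyoneda V (𝟙_ A) = eCoyoneda V (𝟙_ (ForgetEnrichment V A)) :=
    CategoryTheory.Functor.hext (fun _ => rfl) fun a b f =>
      heq_of_eq (und_post V A (𝟙_ (ForgetEnrichment V A)) f).symm
  rw [← h]
  infer_instance

variable [RigidCategory A]

/-- The `V`-monoidal category given by a central action of `V` on `A`. -/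
noncomputable def realization : VMonCat.{w} V where
  carrier := A
  vmonoidal := WhiskerEnriched.toVMonoidal
  rigid := nonempty_rigidCategory_und V A
  trace_isRightAdjoint := und_isRightAdjoint V A

/-- The identity functor from the realization. -/
noncomputable def ofRealization : (realization V A).Und ⥤ A := ofUnd V A

/-- The identity functor to the realization. -/
noncomputable def toRealization : A ⥤ (realization V A).Und := toUnd V A

noncomputable instance laxOfRealization : (ofRealization V A).LaxMonoidal :=
  inferInstanceAs (ofUnd V A).LaxMonoidal

noncomputable instance laxToRealization : (toRealization V A).LaxMonoidal :=
  inferInstanceAs (toUnd V A).LaxMonoidal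

theorem ofRealization_comp_toRealization :
    ofRealization V A ⋙ toRealization V A = 𝟭 (realization V A).Und :=
  have h {a b : ForgetEnrichment V A} (f : a ⟶ b) := toUnd_map_ofUnd_map V f
  CategoryTheory.Functor.hext (fun _ => rfl) fun _ _ f => heq_of_eq (h f)

theorem toRealization_comp_ofRealization : toRealization V A ⋙ ofRealization V A = 𝟭 A :=
  CategoryTheory.Functor.hext (fun _ => rfl) fun _ _ f => heq_of_eq (ofUnd_map_toUnd_map V f)

/-- The enrichment of `ofRealization`. -/
noncomputable def ofRealizationEnrichment : LaxEnrichment V (ofRealization V A) where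
  vm a b := 𝟙 (a ⟶[V] b)
  eHomEquiv_vm := by
    have h {a b : ForgetEnrichment V A} (f : a ⟶ b) :
      eHomEquiv V f ≫ 𝟙 _ = eHomEquiv V ((ofUnd V A).map f) :=
      (Category.comp_id _).trans (eHomEquiv_und V A f)
    exact fun {a b} f => h (a := a) (b := b) f
  eComp_vm a b c := by
    have h : eComp V a b c ≫ 𝟙 _ = 𝟙 (a ⟶[V] b) ⊚ 𝟙 (b ⟶[V] c) := by
      rw [Category.comp_id, eComp_eq_gcomp]
    exact h
  wL_μ c a b := by
    have h (c a b : A) : 𝟙 (a ⟶[V] b) ≫ wL c a b ≫ eHomWhiskerLeft V _ (𝟙 (c ⊗ b)) =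
      wL c a b ≫ 𝟙 _ ≫ eHomWhiskerRight V (𝟙 (c ⊗ a)) _ := by simp
    have h' (c a b : ForgetEnrichment V A) := tensWL_toVMonoidal (V := V) c a b
    exact (h _ _ _).trans (congrArg (· ≫ _) (h' c a b).symm)
  wR_μ a b c := by
    have h (a b c : A) : 𝟙 (a ⟶[V] b) ≫ wR a b c ≫ eHomWhiskerLeft V _ (𝟙 (b ⊗ c)) =
      wR a b c ≫ 𝟙 _ ≫ eHomWhiskerRight V (𝟙 (a ⊗ c)) _ := by simp
    have h' (a b c : ForgetEnrichment V A) := tensWR_toVMonoidal (V := V) a b c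
    exact (h _ _ _).trans (congrArg (· ≫ _) (h' a b c).symm)

/-- The enrichment of `toRealization`. -/
noncomputable def toRealizationEnrichment : LaxEnrichment V (toRealization V A) where
  vm a b := 𝟙 (a ⟶[V] b)
  eHomEquiv_vm f := Category.comp_id _
  eComp_vm a b c := by
    have h : eComp V a b c ≫ 𝟙 _ = 𝟙 (a ⟶[V] b) ⊚ 𝟙 (b ⟶[V] c) := by
      rw [Category.comp_id, eComp_eq_gcomp]
    exact h
  wL_μ c a b := by
    have h (c a b : (realization V A).Und) :
      𝟙 (a ⟶[V] b) ≫ wL c a b ≫ eHomWhiskerLeft V _ (𝟙 (c ⊗ b)) =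
      wL c a b ≫ 𝟙 _ ≫ eHomWhiskerRight V (𝟙 (c ⊗ a)) _ := by simp
    have h' (c a b : ForgetEnrichment V A) := tensWL_toVMonoidal (V := V) c a b
    exact (h _ _ _).trans (congrArg (· ≫ _) (h' c a b))
  wR_μ a b c := by
    have h (a b c : (realization V A).Und) :
      𝟙 (a ⟶[V] b) ≫ wR a b c ≫ eHomWhiskerLeft V _ (𝟙 (b ⊗ c)) =
      wR a b c ≫ 𝟙 _ ≫ eHomWhiskerRight V (𝟙 (a ⊗ c)) _ := by simp
    have h' (a b c : ForgetEnrichment V A) := tensWR_toVMonoidal (V := V) a b c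
    exact (h _ _ _).trans (congrArg (· ≫ _) (h' a b c))

variable {V A} {F : V ⥤ (realization V A).Und} (adj : F ⊣ (realization V A).trace)

/-- Both enrichments act as identities on hom-objects, so the composite comparison has the same mate
as the identity, namely the unit of the adjunction. -/
theorem comparison_ofRealization_comp (v : V) :
    (toRealizationEnrichment V A).comparison (CentralAction.adjunction V A) adj v ≫
      (toRealization V A).map
        ((ofRealizationEnrichment V A).comparison adj (CentralAction.adjunction V A) v) =
      𝟙 (F.obj v) := by
  apply mateOne_injective adj
  have h₁ (x : A) : eHomWhiskerRight V (𝟙 (𝟙_ A)) x = 𝟙 _ := eHomWhiskerRight_id _ _ _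
  have h₂ (x : (realization V A).Und) :
    eHomWhiskerRight V (𝟙 (𝟙_ (realization V A).Und)) x = 𝟙 _ := eHomWhiskerRight_id _ _ _
  have h {x y : V} (g : x ⟶ y) (f f' : y ⟶ y) (hf : f = 𝟙 y) (hf' : f' = 𝟙 y) :
    (g ≫ 𝟙 y ≫ f) ≫ 𝟙 y ≫ f' = g := by simp [hf, hf']
  refine ((LaxEnrichment.mateOne_comparison_comp ..).trans ?_).trans (mateOne_id adj v).symm
  refine (congrArg (· ≫ _) (LaxEnrichment.mateOne_comparison ..)).trans ?_
  exact h _ _ _ (h₁ _) (h₂ _)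

theorem comparison_toRealization_comp (v : V) :
    (ofRealizationEnrichment V A).comparison adj (CentralAction.adjunction V A) v ≫
      (ofRealization V A).map
        ((toRealizationEnrichment V A).comparison (CentralAction.adjunction V A) adj v) =
      𝟙 (CentralAction.F.obj v) := by
  apply mateOne_injective (CentralAction.adjunction V A)
  have h₁ (x : A) : eHomWhiskerRight V (𝟙 (𝟙_ A)) x = 𝟙 _ := eHomWhiskerRight_id _ _ _
  have h₂ (x : (realization V A).Und) :
    eHomWhiskerRight V (𝟙 (𝟙_ (realization V A).Und)) x = 𝟙 _ := eHomWhiskerRight_id _ _ _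
  have h {x y : V} (g : x ⟶ y) (f f' : y ⟶ y) (hf : f = 𝟙 y) (hf' : f' = 𝟙 y) :
    (g ≫ 𝟙 y ≫ f) ≫ 𝟙 y ≫ f' = g := by simp [hf, hf']
  refine ((LaxEnrichment.mateOne_comparison_comp ..).trans ?_).trans
    (mateOne_id (CentralAction.adjunction V A) v).symm
  refine (congrArg (· ≫ _) (LaxEnrichment.mateOne_comparison ..)).trans ?_
  exact h _ _ _ (h₂ _) (h₁ _)

end Realization

end BraidedEnriched

/-! ### Surjectivity on 0-cells up to equivalence, and the conclusion -/

namespace BraidedEnriched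

theorem isStrictMonoidal_und_realization (V : Type u) [Category.{v} V] [MonoidalCategory V]
    [BraidedCategory V] (A : Type w) [Category.{v} A] [MonoidalCategory A] [CentralAction V A]
    [RigidCategory A] (h : IsStrictMonoidal A) : IsStrictMonoidal (realization V A).Und := by
  -- The structure isomorphisms of the realization are the images under `toUnd` of those of `A`, and
  -- a functor sends `eqToHom` to `eqToHom`.
  have key {a b : A} (f : a ⟶ b) (hf : ∃ h, f = eqToHom h) :
      ∃ h, (toUnd V A).map f = eqToHom h := by
    obtain ⟨h, rfl⟩ := hf
    exact ⟨congrArg _ h, eqToHom_map _ _⟩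
  exact ⟨fun a b c => key _ (h.1 a b c), fun a => key _ (h.2.1 a), fun a => key _ (h.2.2 a)⟩

variable {V : Type u} [Category.{v} V] [MonoidalCategory V] [BraidedCategory V]

namespace VModTens

noncomputable instance (X : VModTens.{w} V) : RigidCategory X.carrier := X.rigid.some

noncomputable instance (X : VModTens.{w} V) : CentralAction V X.carrier :=
  have := X.weaklyTensored
  X.central.centralAction (Adjunction.ofIsLeftAdjoint X.central.F)

end VModTens

variable {F : ∀ 𝒜 : VMonCat.{w} V, V ⥤ 𝒜.Und} (adj : ∀ 𝒜, F 𝒜 ⊣ 𝒜.trace) (X : VModTens.{w} V)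

/-- The comparison of `ofRealization`. -/
noncomputable def ofRealizationComparison (v : V) :
    (CentralAction.F (A := X.carrier)).obj v ⟶
      (ofRealization V X.carrier).obj ((F (realization V X.carrier)).obj v) :=
  (ofRealizationEnrichment V X.carrier).comparison (adj _)
    (CentralAction.adjunction V X.carrier) v

/-- The comparison of `toRealization`. -/
noncomputable def toRealizationComparison (v : V) :
    (F (realization V X.carrier)).obj v ⟶
      (toRealization V X.carrier).obj ((CentralAction.F (A := X.carrier)).obj v) :=
  (toRealizationEnrichment V X.carrier).comparison (CentralAction.adjunction V X.carrier)
    (adj _) v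

/-- The 1-cell from the realization of `X` to `X`. -/
noncomputable def ofRealizationCell :
    (underlyingTwoFunctor adj).obj (realization V X.carrier) ⟶ X where
  functor := ofRealization V X.carrier
  lax := laxOfRealization V X.carrier
  r := ofRealizationComparison adj X
  isOneCell :=
    { strictly_unital := ⟨rfl, rfl⟩
      r_natural {u v} f := by
        have h := (ofRealizationEnrichment V X.carrier).comparison_naturality (adj _)
          (CentralAction.adjunction V X.carrier) f
        exact h
      r_unit := by
        have h := (ofRealizationEnrichment V X.carrier).comparison_unit (adj _)
          (CentralAction.adjunction V X.carrier)
        -- The coherence laws hold for the structure computed from the enrichment of `X`; the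
        -- rewriting replaces it by the central structure that `X` carries. The half-braiding and
        -- the oplaxitor are treated in the same way.
        rw [CentralAction.opcounit_adjunction] at h
        exact h
      half_braiding_coherence a v := by
        have h := (ofRealizationEnrichment V X.carrier).comparison_halfBraid (adj _)
          (CentralAction.adjunction V X.carrier) a v
        rw [CentralAction.halfBraid_adjunction] at h
        exact h
      action_coherence u v := by
        have h := (ofRealizationEnrichment V X.carrier).comparison_oplaxitor (adj _)
          (CentralAction.adjunction V X.carrier) u v
        rw [CentralAction.oplaxitor_adjunction] at h
        exact h }

/-- The 1-cell from `X` to its realization. -/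
noncomputable def toRealizationCell :
    X ⟶ (underlyingTwoFunctor adj).obj (realization V X.carrier) where
  functor := toRealization V X.carrier
  lax := laxToRealization V X.carrier
  r := toRealizationComparison adj X
  isOneCell :=
    { strictly_unital := ⟨rfl, rfl⟩
      r_natural {u v} f := by
        have h := (toRealizationEnrichment V X.carrier).comparison_naturality
          (CentralAction.adjunction V X.carrier) (adj _) f
        exact h
      r_unit := by
        have h := (toRealizationEnrichment V X.carrier).comparison_unit
          (CentralAction.adjunction V X.carrier) (adj _)
        rw [CentralAction.opcounit_adjunction] at h
        exact h
      half_braiding_coherence a v := by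
        have h := (toRealizationEnrichment V X.carrier).comparison_halfBraid
          (CentralAction.adjunction V X.carrier) (adj _) a v
        rw [CentralAction.halfBraid_adjunction] at h
        exact h
      action_coherence u v := by
        have h := (toRealizationEnrichment V X.carrier).comparison_oplaxitor
          (CentralAction.adjunction V X.carrier) (adj _) u v
        rw [CentralAction.oplaxitor_adjunction] at h
        exact h }

/-- The realization is isomorphic, not merely equivalent, to `X`: this composite and the opposite
one are identity 1-cells on the nose. -/
theorem ofRealizationCell_comp_toRealizationCell :
    ofRealizationCell adj X ≫ toRealizationCell adj X = 𝟙 _ := by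
  refine OneCell_ext (ofRealization_comp_toRealization V X.carrier) (fun a b => heq_of_eq ?_)
    fun v => heq_of_eq (comparison_ofRealization_comp (adj _) v)
  have h (a : (realization V X.carrier).Und) :
    𝟙 a ≫ (toRealization V X.carrier).map (𝟙 ((ofRealization V X.carrier).obj a)) = 𝟙 _ :=
    (Category.id_comp _).trans (CategoryTheory.Functor.map_id _ _)
  exact h _

theorem toRealizationCell_comp_ofRealizationCell :
    toRealizationCell adj X ≫ ofRealizationCell adj X = 𝟙 X := by
  refine OneCell_ext (toRealization_comp_ofRealization V X.carrier) (fun a b => heq_of_eq ?_)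
    fun v => heq_of_eq (comparison_toRealization_comp (adj _) v)
  have h (a : X.carrier) :
    𝟙 a ≫ (ofRealization V X.carrier).map (𝟙 ((toRealization V X.carrier).obj a)) = 𝟙 _ :=
    (Category.id_comp _).trans (CategoryTheory.Functor.map_id _ _)
  exact h _

/-- The equivalence between a `V`-module tensor category and the one underlying its realization. -/
noncomputable def realizationEquivalence :
    Bicategory.Equivalence ((underlyingTwoFunctor adj).obj (realization V X.carrier)) X :=
  Bicategory.Equivalence.mkOfAdjointifyCounit (f := ofRealizationCell adj X)
    (g := toRealizationCell adj X)
    (eqToIso (ofRealizationCell_comp_toRealizationCell adj X).symm)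
    (eqToIso (toRealizationCell_comp_ofRealizationCell adj X))

theorem isIso_μ_ofRealizationCell (a b) : IsIso (Functor.LaxMonoidal.μ
    (VModTens.OneCell.toPreOneCell (ofRealizationCell adj X)).functor a b) :=
  inferInstanceAs (IsIso (𝟙 ((ofUnd V X.carrier).obj a ⊗ (ofUnd V X.carrier).obj b)))

theorem isIso_μ_toRealizationCell (a b) : IsIso (Functor.LaxMonoidal.μ
    (VModTens.OneCell.toPreOneCell (toRealizationCell adj X)).functor a b) :=
  inferInstanceAs (IsIso (𝟙 ((toUnd V X.carrier).obj a ⊗ (toUnd V X.carrier).obj b)))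

theorem isTwoEquivalence_underlyingTwoFunctor : IsTwoEquivalence (underlyingTwoFunctor adj) :=
  ⟨fun X => ⟨_, ⟨realizationEquivalence adj X⟩⟩, isEquivalence_mapFunctor adj⟩

/-- A 1-cell and its image have the same laxitor, so being strong is literally the same condition on
both. The two 1-cells of the equivalence are strong since their laxitors are identities. -/
theorem restrictsToTwoEquivalence_strong :
    RestrictsToTwoEquivalence (underlyingTwoFunctor adj) (VMonCat.strong V)
      (VModTens.strong V) where
  obj_mem _ _ := trivial
  hom_mem _ h := h
  essSurj X _ := ⟨_, trivial, realizationEquivalence adj X, isIso_μ_ofRealizationCell adj X,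
    isIso_μ_toRealizationCell adj X⟩
  isEquivalence _ _ _ _ := isEquivalence_lift_mapFunctor adj _ _ (fun _ => Iff.rfl) _

theorem restrictsToTwoEquivalence_strict :
    RestrictsToTwoEquivalence (underlyingTwoFunctor adj) (VMonCat.strict V)
      (VModTens.strict V) where
  obj_mem _ h := h
  hom_mem _ _ := trivial
  essSurj X h := ⟨_, isStrictMonoidal_und_realization V X.carrier h, realizationEquivalence adj X,
    trivial, trivial⟩
  isEquivalence _ _ _ _ := isEquivalence_lift_mapFunctor adj _ _ (fun _ => Iff.rfl) _

theorem restrictsToTwoEquivalence_strictStrong :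
    RestrictsToTwoEquivalence (underlyingTwoFunctor adj) (VMonCat.strictStrong V)
      (VModTens.strictStrong V) where
  obj_mem _ h := h
  hom_mem _ h := h
  essSurj X h := ⟨_, isStrictMonoidal_und_realization V X.carrier h, realizationEquivalence adj X,
    isIso_μ_ofRealizationCell adj X, isIso_μ_toRealizationCell adj X⟩
  isEquivalence _ _ _ _ := isEquivalence_lift_mapFunctor adj _ _ (fun _ => Iff.rfl) _

end BraidedEnriched

open BraidedEnriched

theorem mainTheorem1 (V : Type u) [Category.{v} V] [MonoidalCategory V] [BraidedCategory V]
    (F : ∀ 𝒜 : VMonCat.{w} V, V ⥤ 𝒜.Und) (adj : ∀ 𝒜 : VMonCat.{w} V, F 𝒜 ⊣ 𝒜.trace) :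
    ∃ (L : ∀ 𝒜 : VMonCat.{w} V, CentralLift (adj 𝒜))
      (P : StrictPseudofunctor (VMonCat.{w} V) (VModTens.{w} V)),
      IsUnderlyingTwoFunctor L P ∧
      IsTwoEquivalence P ∧
      RestrictsToTwoEquivalence P (VMonCat.strong V) (VModTens.strong V) ∧
      RestrictsToTwoEquivalence P (VMonCat.strict V) (VModTens.strict V) ∧
      RestrictsToTwoEquivalence P (VMonCat.strictStrong V) (VModTens.strictStrong V) :=
  ⟨fun 𝒜 => 𝒜.centralLift (adj 𝒜), underlyingTwoFunctor adj, isUnderlyingTwoFunctor adj,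
    isTwoEquivalence_underlyingTwoFunctor adj, restrictsToTwoEquivalence_strong adj,
    restrictsToTwoEquivalence_strict adj, restrictsToTwoEquivalence_strictStrong adj⟩
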